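/- Let $k$ be a field and let $R$ be a commutative noetherian Gorenstein $k$-algebra with a maximal ideal $m$ such that $k\to R/m$ is an isomorphism and such that $R_p$ is a regular local ring for every prime $p\neq m$ (isolated singularity). Assume that we are in one of the following two cases. * Complete case: $R$ is local and complete with respect to its maximal ideal $m$. * Graded case: $R=\bigoplus_{n\ge 0}R_n$ is an $\mathbb N$-graded $k$-algebra and $m$ is its unique maximal homogeneous ideal. Put $M_0=R$ and let $M_1,\dots,M_l$ be indecomposable finitely generated maximal Cohen-Macaulay $R$-modules that are pairwise non-isomorphic and not isomorphic to $R$ (in the graded case: $\mathbb Z$-graded modules, indecomposable and non-isomorphic as graded modules). Put $M=\bigoplus_{i=0}^l M_i$ and $\Lambda=\operatorname{End}_R(M)$, and assume that $\Lambda$ has finite global dimension. Let $e_0\in\Lambda$ be the projection of $M$ onto $M_0=R$ and put $P_0=\Lambda e_0$. Let $D^b_f(\Lambda)$ be the full subcategory of the derived category of left $\Lambda$-modules on the objects with bounded and finitely generated cohomology, let $\langle P_0\rangle$ be the thick subcategory generated by $P_0$, and let $Q:D^b_f(\Lambda)\to D^b_f(\Lambda)/\langle P_0\rangle$ be the Verdier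 quotient. 1. In both cases, $D^b_f(\Lambda)/\langle P_0\rangle$ is $\operatorname{Hom}$-finite: all its morphism spaces are finite dimensional over $k$. Moreover, sending $a\in \Lambda$ to the image under $Q$ of the right multiplication $\Lambda\to\Lambda$, $x\mapsto xa$, induces an isomorphism of $k$-algebras $$\Lambda/\Lambda e_0\Lambda\;\cong\;\operatorname{End}_{D^b_f(\Lambda)/\langle P_0\rangle}(\Lambda)^{\mathrm{op}}$$ (the opposite ring appears because endomorphisms are composed as functions, written on the left, and act on left modules). 2. In the graded case the same holds for graded modules. Let $\Lambda_n\subset\Lambda$ be the space of endomorphisms of $M$ of degree $n$, let $D^b_f(\operatorname{gr}\Lambda)$ be the analogous full subcategory of the derived category of $\mathbb Z$-graded left $\Lambda$-modules and degree-preserving maps, and divide by the thick subcategory $\langle P_0(n)\mid n\in\mathbb Z\rangle$ generated by all degree twists of $P_0$. This Verdier quotient is $\operatorname{Hom}$-finite, and for every $n\in\mathbb Z$ right multiplication induces an isomorphism of the part of degree $n$ of $\Lambda/\Lambda e_0\Lambda$, that is $\Lambda_n/(\Lambda_n\cap\Lambda e_0\Lambda)$, with $\operatorname{Hom}(\Lambda,\Lambda(n))$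 in the quotient category. -/

import Mathlib

open CategoryTheory Limits

universe u

attribute [instance] HasDerivedCategory.standard

noncomputable section

namespace NCResolution

section CommutativeAlgebra

/-- `R` is noetherian and has finite injective dimension over itself. (For a noetherian ring of
finite Krull dimension this holds if and only if all its localizations are Gorenstein.) -/
def IsGorenstein (R : Type u) [CommRing R] : Prop :=
  IsNoetherianRing R ∧ ∃ n : ℕ, HasInjectiveDimensionLE (ModuleCat.of R R) n

/-- `Spec R ∖ {m}` is regular. -/
def IsIsolatedSingularity {R : Type u} [CommRing R] (m : Ideal R) : Prop :=
  ∀ (p : Ideal R) [p.IsPrime], p ≠ m → IsRegularLocalRing (Localization.AtPrime p)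

/-- `depth_m N = dim R`: there is an `N`-regular sequence in `m` of length `dim R`. -/
def IsMaximalCohenMacaulay {R : Type u} [CommRing R] (m : Ideal R) (N : Type u) [AddCommGroup N]
    [Module R N] : Prop :=
  ∃ rs : List R, (∀ r ∈ rs, r ∈ m) ∧ RingTheory.Sequence.IsRegular N rs ∧
    (rs.length : WithBot ℕ∞) = ringKrullDim R

/-- `Λ` has finite (left) global dimension. -/
def HasFiniteGlobalDimension (Λ : Type u) [Ring Λ] : Prop :=
  ∃ d : ℕ, ∀ M : ModuleCat.{u} Λ, HasProjectiveDimensionLE M d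

/-- A nonzero module that is not a direct sum of two nonzero submodules. -/
def IsIndecomposable (R N : Type u) [CommRing R] [AddCommGroup N] [Module R N] : Prop :=
  Nontrivial N ∧ ∀ A B : Submodule R N, IsCompl A B → A = ⊥ ∨ B = ⊥

end CommutativeAlgebra

section TriangulatedCategories

/-- All morphism spaces are finite dimensional over `k`. -/
def HomFinite (k : Type*) [Field k] (C : Type*) [Category* C] [Preadditive C] [Linear k C] : Prop :=
  ∀ X Y : C, FiniteDimensional k (X ⟶ Y)

/-- The Verdier quotient of a triangulated category by the smallest thick subcategory
that contains the objects satisfying `S`. -/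
abbrev VerdierQuotient {T : Type*} [Category* T] [Preadditive T] [HasZeroObject T] [HasShift T ℤ]
    [∀ n : ℤ, (shiftFunctor T n).Additive] [Pretriangulated T] (S : ObjectProperty T) : Type _ :=
  S.triangEnvelope.trW.Localization

/-- The quotient functor. -/
abbrev toVerdierQuotient {T : Type*} [Category* T] [Preadditive T] [HasZeroObject T] [HasShift T ℤ]
    [∀ n : ℤ, (shiftFunctor T n).Additive] [Pretriangulated T] (S : ObjectProperty T) :
    T ⥤ VerdierQuotient S :=
  S.triangEnvelope.trW.Q

variable {A : Type*} [Category* A] [Abelian A] (P : ObjectProperty A)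

/-- The objects of the derived category with bounded cohomology, whose cohomology objects all
satisfy `P`. -/
def boundedWith : ObjectProperty (DerivedCategory A) :=
  DerivedCategory.TStructure.t.bounded ⊓
    fun X => ∀ n : ℤ, P ((DerivedCategory.homologyFunctor A n).obj X)

variable [P.IsSerreClass]

instance : ObjectProperty.IsClosedUnderIsomorphisms
    (fun X : DerivedCategory A => ∀ n : ℤ, P ((DerivedCategory.homologyFunctor A n).obj X)) where
  of_iso e h n := P.prop_of_iso ((DerivedCategory.homologyFunctor A n).mapIso e) (h n)

open ZeroObject in
instance : ObjectProperty.IsTriangulated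
    (fun X : DerivedCategory A => ∀ n : ℤ, P ((DerivedCategory.homologyFunctor A n).obj X)) where
  exists_zero := ⟨0, isZero_zero _, fun n =>
    P.prop_of_isZero ((DerivedCategory.homologyFunctor A n).map_isZero (isZero_zero _))⟩
  isStableUnderShiftBy a := ⟨fun X hX n => P.prop_of_iso
    (((DerivedCategory.homologyFunctor A 0).shiftIso a n (a + n) rfl).app X).symm (hX (a + n))⟩
  toIsTriangulatedClosed₂ := .mk' fun T hT h₁ h₃ n =>
    P.prop_X₂_of_exact (DerivedCategory.HomologySequence.exact₂ T hT n) (h₁ n) (h₃ n)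

instance : (boundedWith P).IsTriangulated := by
  unfold boundedWith; infer_instance

lemma boundedWith_single (X : A) (hX : P X) :
    boundedWith P ((DerivedCategory.singleFunctor A 0).obj X) := by
  refine ⟨⟨⟨0, ?_⟩, ⟨0, ?_⟩⟩, fun n => ?_⟩
  · exact (inferInstance : ((DerivedCategory.singleFunctor A 0).obj X).IsGE 0)
  · exact (inferInstance : ((DerivedCategory.singleFunctor A 0).obj X).IsLE 0)
  · rcases lt_trichotomy n 0 with h | rfl | h
    · exact P.prop_of_isZero (DerivedCategory.isZero_of_isGE _ 0 n h)
    · exact P.prop_of_iso ((DerivedCategory.homologyFunctor A 0).mapIso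
        ((DerivedCategory.singleFunctorIsoCompQ A 0).app X) ≪≫
          (DerivedCategory.homologyFunctorFactors A 0).app _ ≪≫
          (HomologicalComplex.homologyFunctorSingleIso A (ComplexShape.up ℤ) 0).app X).symm hX
    · exact P.prop_of_isZero (DerivedCategory.isZero_of_isLE _ 0 n h)

/-- Objects of `A` that satisfy `P`, as complexes concentrated in degree `0`. -/
def stalk : P.FullSubcategory ⥤ (boundedWith P).FullSubcategory :=
  (boundedWith P).lift (P.ι ⋙ DerivedCategory.singleFunctor A 0)
    fun X => boundedWith_single P X.1 X.2

end TriangulatedCategories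

section Modules

variable {Λ : Type u} [Ring Λ] [IsNoetherianRing Λ]

instance : (ModuleCat.isFG.{u} Λ).IsSerreClass where
  exists_zero := ⟨.of Λ PUnit, ModuleCat.isZero_of_subsingleton _,
    (inferInstance : Module.Finite Λ PUnit.{u + 1})⟩
  prop_of_mono {M N} f hf (hN : Module.Finite Λ N) :=
    Module.Finite.of_injective f.hom ((ModuleCat.mono_iff_injective f).1 hf)
  prop_of_epi {M N} f hf (hM : Module.Finite Λ M) :=
    Module.Finite.of_surjective f.hom ((ModuleCat.epi_iff_surjective f).1 hf)
  prop_X₂_of_shortExact {S} hS h₁ h₃ := by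
    have h₁ : Module.Finite Λ S.X₁ := h₁
    have h₃ : Module.Finite Λ S.X₃ := h₃
    refine ⟨Submodule.fg_of_fg_map_of_fg_inf_ker S.g.hom ?_ ?_⟩
    · exact IsNoetherian.noetherian _
    · rw [top_inf_eq, ← hS.exact.moduleCat_range_eq_ker, LinearMap.range_eq_map]
      exact h₁.fg_top.map S.f.hom

variable (Λ)

/-- `D^b_f(Λ)`: the full subcategory of the derived category of left `Λ`-modules on the objects
with bounded and finitely generated cohomology. -/
abbrev Dbf : Type _ := (boundedWith (ModuleCat.isFG.{u} Λ)).FullSubcategory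

/-- The left module `Λ`, as an object of `D^b_f(Λ)`. -/
def regularObj : Dbf Λ :=
  (stalk (ModuleCat.isFG.{u} Λ)).obj ⟨.of Λ Λ, (inferInstance : Module.Finite Λ Λ)⟩

variable {Λ}

/-- Right multiplication by `a`, as an endomorphism of `Λ` in `D^b_f(Λ)`. -/
def rightMul (a : Λ) : regularObj Λ ⟶ regularObj Λ :=
  (stalk (ModuleCat.isFG.{u} Λ)).map
    (ObjectProperty.homMk (ModuleCat.ofHom (LinearMap.toSpanSingleton Λ Λ a)))

/-- The left module `Λe`, as an object of `D^b_f(Λ)`. -/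
def leftIdealObj (e : Λ) : Dbf Λ :=
  (stalk (ModuleCat.isFG.{u} Λ)).obj
    ⟨.of Λ (Ideal.span {e} : Ideal Λ), (inferInstance : Module.Finite Λ (Ideal.span {e}))⟩

/-- The Verdier quotient `D^b_f(Λ)/⟨Λe⟩`. -/
abbrev DbfQuotient (e : Λ) : Type _ := VerdierQuotient (.singleton (leftIdealObj e))

/-- The quotient functor `D^b_f(Λ) → D^b_f(Λ)/⟨Λe⟩`. -/
abbrev toDbfQuotient (e : Λ) : Dbf Λ ⥤ DbfQuotient e :=
  toVerdierQuotient (.singleton (leftIdealObj e))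

/-- The two-sided ideal `ΛeΛ`. -/
abbrev twoSided {Λ : Type u} [Ring Λ] (e : Λ) : Ideal Λ := (TwoSidedIdeal.span {e}).asIdeal

end Modules

/-- A graded left module over the `ℤ`-graded `k`-algebra with homogeneous parts `𝒜 i ⊆ Λ`:
a family of `k`-vector spaces `X j` with an action `𝒜 i × X j → X (i + j)`. -/
structure GrMod {k Λ : Type u} [Field k] [Ring Λ] [Algebra k Λ]
    (𝒜 : ℤ → Submodule k Λ) [SetLike.GradedMonoid 𝒜] where
  X : ℤ → Type u
  [addCommGroup : ∀ j, AddCommGroup (X j)]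
  [module : ∀ j, Module k (X j)]
  act : ∀ {i j n : ℤ}, i + j = n → 𝒜 i →ₗ[k] X j →ₗ[k] X n
  one_act : ∀ {j : ℤ} (x : X j), act (zero_add j) ⟨1, SetLike.GradedOne.one_mem⟩ x = x
  mul_act : ∀ {i j l m n : ℤ} (hm : j + l = m) (hn : i + m = n) (h : i + j + l = n)
    (a : 𝒜 i) (b : 𝒜 j) (x : X l),
    act h ⟨(a : Λ) * b, SetLike.GradedMul.mul_mem a.2 b.2⟩ x = act hn a (act hm b x)

namespace GrMod

attribute [instance] GrMod.addCommGroup GrMod.module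

variable {k Λ : Type u} [Field k] [Ring Λ] [Algebra k Λ]
  {𝒜 : ℤ → Submodule k Λ} [SetLike.GradedMonoid 𝒜]

lemma act_congr (M : GrMod 𝒜) {i i' j n : ℤ} (hi : i = i') (h : i + j = n) (h' : i' + j = n)
    {a : 𝒜 i} {a' : 𝒜 i'} (ha : (a : Λ) = a') (x : M.X j) : M.act h a x = M.act h' a' x := by
  subst hi
  rw [Subtype.ext ha]

/-- The `k`-vector space of degree-preserving `Λ`-linear maps. -/
def homs (M N : GrMod 𝒜) : Submodule k (∀ j, M.X j →ₗ[k] N.X j) where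
  carrier := {f | ∀ (i j n : ℤ) (h : i + j = n) (a : 𝒜 i) (x : M.X j),
    f n (M.act h a x) = N.act h a (f j x)}
  zero_mem' _ _ _ _ _ _ := by simp
  add_mem' hf hg _ _ _ _ _ _ := by simp [hf _ _ _ _, hg _ _ _ _]
  smul_mem' c f hf _ _ _ _ _ _ := by simp [hf _ _ _ _]

instance : Category (GrMod 𝒜) where
  Hom M N := homs M N
  id M := ⟨fun _ => LinearMap.id, fun _ _ _ _ _ _ => rfl⟩
  comp f g := ⟨fun j => g.1 j ∘ₗ f.1 j, fun _ _ _ h a x => by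
    simp [f.2 _ _ _ h, g.2 _ _ _ h]⟩

/-- The degree `j` part of a morphism. -/
def app {M N : GrMod 𝒜} (f : M ⟶ N) (j : ℤ) : M.X j →ₗ[k] N.X j := f.1 j

/-- Build a morphism from its homogeneous parts. -/
def ofApp {M N : GrMod 𝒜} (f : ∀ j, M.X j →ₗ[k] N.X j)
    (h : ∀ (i j n : ℤ) (h : i + j = n) (a : 𝒜 i) (x : M.X j),
      f n (M.act h a x) = N.act h a (f j x)) : M ⟶ N := ⟨f, h⟩

variable {M N P : GrMod 𝒜}

@[simp] lemma app_ofApp (f : ∀ j, M.X j →ₗ[k] N.X j) (h) (j : ℤ) : app (ofApp f h) j = f j := rfl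

lemma map_act (f : M ⟶ N) {i j n : ℤ} (h : i + j = n) (a : 𝒜 i) (x : M.X j) :
    app f n (M.act h a x) = N.act h a (app f j x) := f.2 i j n h a x

lemma hom_ext {f g : M ⟶ N} (h : ∀ j x, app f j x = app g j x) : f = g :=
  Subtype.ext (funext fun j => LinearMap.ext (h j))

@[simp] lemma id_app (j : ℤ) (x : M.X j) : app (𝟙 M) j x = x := rfl

@[simp] lemma comp_app (f : M ⟶ N) (g : N ⟶ P) (j : ℤ) (x : M.X j) :
    app (f ≫ g) j x = app g j (app f j x) := rfl

instance : Preadditive (GrMod 𝒜) where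
  homGroup M N := inferInstanceAs (AddCommGroup (homs M N))
  add_comp _ _ _ f f' g := hom_ext fun j x => map_add (app g j) (app f j x) (app f' j x)
  comp_add _ _ _ _ _ _ := rfl

instance : Linear k (GrMod 𝒜) where
  homModule M N := inferInstanceAs (Module k (homs M N))
  smul_comp _ _ _ c f g := hom_ext fun j x => map_smul (app g j) c (app f j x)
  comp_smul _ _ _ _ _ _ := rfl

@[simp] lemma zero_app (j : ℤ) (x : M.X j) : app (0 : M ⟶ N) j x = 0 := rfl

lemma app_eq_zero_of_comp {f : M ⟶ N} {g : N ⟶ P} (w : f ≫ g = 0) (j : ℤ) (x : M.X j) :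
    app g j (app f j x) = 0 := by
  rw [← comp_app, w]; rfl

/-- The kernel of a morphism, computed degreewise. -/
def ker (f : M ⟶ N) : GrMod 𝒜 where
  X j := LinearMap.ker (app f j)
  act {i j n} h := LinearMap.mk₂ k
    (fun a x => ⟨M.act h a x.1, by
      have := x.2
      rw [LinearMap.mem_ker] at this ⊢
      rw [map_act, this, map_zero]⟩)
    (fun _ _ _ => by ext; simp) (fun _ _ _ => by ext; simp)
    (fun _ _ _ => by ext; simp) (fun _ _ _ => by ext; simp)
  one_act x := Subtype.ext (M.one_act x.1)
  mul_act hm hn h a b x := Subtype.ext (M.mul_act hm hn h a b x.1)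

/-- The inclusion of the kernel. -/
def kerι (f : M ⟶ N) : ker f ⟶ M := ofApp (fun j => (LinearMap.ker (app f j)).subtype)
  fun _ _ _ _ _ _ => rfl

lemma kerι_comp (f : M ⟶ N) : kerι f ≫ f = 0 := hom_ext fun _ x => x.2

/-- The universal property of the kernel. -/
def kerIsLimit (f : M ⟶ N) : IsLimit (KernelFork.ofι (kerι f) (kerι_comp f)) :=
  KernelFork.IsLimit.ofι _ _
    (fun g w => ofApp (fun j => (app g j).codRestrict _ (app_eq_zero_of_comp w j))
      fun _ _ _ h a x => Subtype.ext (map_act g h a x))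
    (fun _ _ => rfl)
    (fun _ _ m hm => hom_ext fun j x => Subtype.ext (by subst hm; rfl))

/-- The cokernel of a morphism, computed degreewise. -/
def coker (f : M ⟶ N) : GrMod 𝒜 where
  X j := N.X j ⧸ LinearMap.range (app f j)
  act {i j n} h :=
    { toFun := fun a => Submodule.mapQ _ _ (N.act h a) (by
        rintro _ ⟨x, rfl⟩
        exact ⟨M.act h a x, map_act f h a x⟩)
      map_add' := fun a b => by ext x; simp
      map_smul' := fun c a => by ext x; simp }
  one_act x := by
    obtain ⟨x, rfl⟩ := Submodule.mkQ_surjective _ x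
    exact congrArg (Submodule.mkQ _) (N.one_act x)
  mul_act hm hn h a b x := by
    obtain ⟨x, rfl⟩ := Submodule.mkQ_surjective _ x
    exact congrArg (Submodule.mkQ _) (N.mul_act hm hn h a b x)

/-- The projection to the cokernel. -/
def cokerπ (f : M ⟶ N) : N ⟶ coker f := ofApp (fun j => (LinearMap.range (app f j)).mkQ)
  fun _ _ _ _ _ _ => rfl

lemma comp_cokerπ (f : M ⟶ N) : f ≫ cokerπ f = 0 :=
  hom_ext fun _ x => (Submodule.Quotient.mk_eq_zero _).2 ⟨x, rfl⟩

/-- The universal property of the cokernel. -/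
def cokerIsColimit (f : M ⟶ N) : IsColimit (CokernelCofork.ofπ (cokerπ f) (comp_cokerπ f)) :=
  CokernelCofork.IsColimit.ofπ _ _
    (fun g w => ofApp (fun j => Submodule.liftQ _ (app g j) (by
        rintro _ ⟨x, rfl⟩
        exact app_eq_zero_of_comp w j x))
      fun _ _ _ h a x => by
        obtain ⟨x, rfl⟩ := Submodule.mkQ_surjective _ x
        exact map_act g h a x)
    (fun _ _ => rfl)
    (fun _ _ m hm => hom_ext fun j x => by
      obtain ⟨x, rfl⟩ := Submodule.mkQ_surjective _ x
      subst hm; rfl)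

lemma injective_of_mono (f : M ⟶ N) [Mono f] (j : ℤ) : Function.Injective (app f j) := by
  have h : kerι f = 0 := by rw [← cancel_mono f, kerι_comp, zero_comp]
  rw [injective_iff_map_eq_zero]
  intro x hx
  exact congrArg (fun g : ker f ⟶ M => app g j (⟨x, hx⟩ : LinearMap.ker (app f j))) h

lemma surjective_of_epi (f : M ⟶ N) [Epi f] (j : ℤ) : Function.Surjective (app f j) := by
  have h : cokerπ f = 0 := by rw [← cancel_epi f, comp_cokerπ, comp_zero]
  intro y
  have := congrArg (fun g => app g j y) h
  exact (Submodule.Quotient.mk_eq_zero _).1 this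

/-- Products, computed degreewise. -/
def pi {J : Type} (M : J → GrMod 𝒜) : GrMod 𝒜 where
  X j := ∀ s, (M s).X j
  act {i j n} h := LinearMap.mk₂ k (fun a x s => (M s).act h a (x s))
    (fun _ _ _ => by ext; simp) (fun _ _ _ => by ext; simp)
    (fun _ _ _ => by ext; simp) (fun _ _ _ => by ext; simp)
  one_act x := funext fun s => (M s).one_act (x s)
  mul_act hm hn h a b x := funext fun s => (M s).mul_act hm hn h a b (x s)

/-- The projections of a product. -/
def piProj {J : Type} (M : J → GrMod 𝒜) (s : J) : pi M ⟶ M s :=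
  ofApp (M := pi M) (fun _ => LinearMap.proj (φ := fun s => (M s).X _) s) fun _ _ _ _ _ _ => rfl

/-- The universal property of products. -/
def piIsLimit {J : Type} (M : J → GrMod 𝒜) : IsLimit (Fan.mk (pi M) (piProj M)) :=
  Fan.IsLimit.mk _
    (fun c => ofApp (N := pi M)
      (fun j => LinearMap.pi (φ := fun s => (M s).X j) fun s => app (c.proj s) j)
      fun _ _ _ h a x => funext fun s => map_act (c.proj s) h a x)
    (fun _ _ => rfl)
    (fun c _ hm => hom_ext fun j x => funext fun s =>
      congrArg (fun g : c.pt ⟶ M s => app g j x) (hm s))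

instance : HasFiniteProducts (GrMod 𝒜) where
  out _ := ⟨fun F => @hasLimit_of_iso _ _ _ _ _ _ ⟨⟨_, piIsLimit fun s => F.obj ⟨s⟩⟩⟩
    (Discrete.natIsoFunctor (F := F)).symm⟩

lemma symm_apply_map {V W : Type u} [AddCommGroup V] [AddCommGroup W] [Module k V] [Module k W]
    (f : V →ₗ[k] W) (hf : Function.Surjective f) (x : V) :
    (f.quotKerEquivOfSurjective hf).symm (f x) = Submodule.Quotient.mk x := by
  rw [LinearEquiv.symm_apply_eq]; rfl

instance : Abelian (GrMod 𝒜) where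
  has_kernels := ⟨fun f => ⟨⟨_, kerIsLimit f⟩⟩⟩
  has_cokernels := ⟨fun f => ⟨⟨_, cokerIsColimit f⟩⟩⟩
  normalMonoOfMono {M N} f _ := ⟨
    { Z := coker f
      g := cokerπ f
      w := comp_cokerπ f
      isLimit := KernelFork.IsLimit.ofι _ _
        (fun {W} g w => ofApp
          (fun j => (LinearEquiv.ofInjective _ (injective_of_mono f j)).symm.toLinearMap ∘ₗ
            (app g j).codRestrict _ fun x => (Submodule.Quotient.mk_eq_zero _).1
              (app_eq_zero_of_comp w j x))
          fun i j n h a x => injective_of_mono f n (by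
            rw [map_act]
            simp [map_act]))
        (fun g w => hom_ext fun j x => by simp)
        (fun g w m hm => hom_ext fun j x => injective_of_mono f j (by subst hm; simp)) }⟩
  normalEpiOfEpi {M N} f _ := ⟨
    { W := ker f
      g := kerι f
      w := kerι_comp f
      isColimit := CokernelCofork.IsColimit.ofπ _ _
        (fun g w => ofApp
          (fun j => (LinearMap.ker (app f j)).liftQ (app g j) (fun x hx =>
              app_eq_zero_of_comp w j (⟨x, hx⟩ : LinearMap.ker (app f j))) ∘ₗ
            ((app f j).quotKerEquivOfSurjective (surjective_of_epi f j)).symm.toLinearMap)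
          fun i j n h a x => by
            obtain ⟨x, rfl⟩ := surjective_of_epi f j x
            rw [← map_act]
            simp only [LinearMap.comp_apply, LinearEquiv.coe_coe, symm_apply_map]
            exact map_act g h a x)
        (fun g w => hom_ext fun j x => by
          simp only [comp_app, app_ofApp, LinearMap.comp_apply, LinearEquiv.coe_coe,
            symm_apply_map]
          rfl)
        (fun g w m hm => hom_ext fun j x => by
          obtain ⟨x, rfl⟩ := surjective_of_epi f j x
          subst hm
          simp only [app_ofApp, LinearMap.comp_apply, LinearEquiv.coe_coe, symm_apply_map]
          rfl) }⟩

lemma exists_of_shortExact {S : ShortComplex (GrMod 𝒜)} (hS : S.ShortExact) {j : ℤ}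
    (y : S.X₂.X j) (hy : app S.g j y = 0) : ∃ x, app S.f j x = y := by
  have h := hS.fIsKernel.fac (KernelFork.ofι (kerι S.g) (kerι_comp S.g)) WalkingParallelPair.zero
  exact ⟨_, congrArg (fun g : ker S.g ⟶ S.X₂ => app g j (⟨y, hy⟩ : LinearMap.ker (app S.g j))) h⟩

/-- Finitely generated graded modules: there are finitely many homogeneous elements `x s` of
degrees `d s` such that every homogeneous element is a combination of them with homogeneous
coefficients. -/
def isFG (𝒜 : ℤ → Submodule k Λ) [SetLike.GradedMonoid 𝒜] : ObjectProperty (GrMod 𝒜) := fun M =>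
  ∃ (ι : Type u) (_ : Fintype ι) (d : ι → ℤ) (x : ∀ s, M.X (d s)), ∀ (j : ℤ) (y : M.X j),
    ∃ a : ∀ s, 𝒜 (j - d s), y = ∑ s, M.act (sub_add_cancel j (d s)) (a s) (x s)

lemma isFG_of_epi (f : M ⟶ N) [Epi f] (hM : isFG 𝒜 M) : isFG 𝒜 N := by
  obtain ⟨ι, _, d, x, h⟩ := hM
  refine ⟨ι, inferInstance, d, fun s => app f _ (x s), fun j y => ?_⟩
  obtain ⟨y, rfl⟩ := surjective_of_epi f j y
  obtain ⟨a, rfl⟩ := h j y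
  exact ⟨a, by simp only [map_sum, map_act]⟩

lemma isFG_of_shortExact {S : ShortComplex (GrMod 𝒜)} (hS : S.ShortExact)
    (h₁ : isFG 𝒜 S.X₁) (h₃ : isFG 𝒜 S.X₃) : isFG 𝒜 S.X₂ := by
  obtain ⟨ι, _, d, x, h⟩ := h₁
  obtain ⟨ι', _, d', x', h'⟩ := h₃
  have := hS.epi_g
  choose z hz using fun s => surjective_of_epi S.g (d' s) (x' s)
  refine ⟨ι ⊕ ι', inferInstance, Sum.elim d d', fun s => match s with
    | .inl s => app S.f _ (x s)
    | .inr s => z s, fun j y => ?_⟩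
  obtain ⟨b, hb⟩ := h' j (app S.g j y)
  obtain ⟨w, hw⟩ := exists_of_shortExact hS
    (y - ∑ s, S.X₂.act (sub_add_cancel j (d' s)) (b s) (z s)) (by
      simp only [map_sub, map_sum, map_act, hz, hb, sub_self])
  obtain ⟨a, rfl⟩ := h j w
  refine ⟨fun s => match s with
    | .inl s => a s
    | .inr s => b s, ?_⟩
  rw [Fintype.sum_sum_type]
  simp only [map_sum, map_act] at hw
  exact (sub_eq_iff_eq_add.1 hw.symm)

lemma isFG_of_mono [GradedAlgebra 𝒜] [IsNoetherianRing Λ] (f : M ⟶ N) [Mono f]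
    (hN : isFG 𝒜 N) : isFG 𝒜 M := by
  obtain ⟨ι, _, d, x, h⟩ := hN
  let T : Set (ι → Λ) := {b | ∃ (j : ℤ) (a : ∀ s, 𝒜 (j - d s)) (y : M.X j),
    (∀ s, b s = a s) ∧ app f j y = ∑ s, N.act (sub_add_cancel j (d s)) (a s) (x s)}
  obtain ⟨t, htT, ht⟩ := (Submodule.fg_span_iff_fg_span_finset_subset (R := Λ) T).1
    (IsNoetherian.noetherian _)
  choose e a y hba hy using fun b : t => htT b.2
  refine ⟨t, inferInstance, e, y, fun j z => ?_⟩
  obtain ⟨c, hc⟩ := h j (app f j z)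
  have hmem : (fun s => (c s : Λ)) ∈ Submodule.span Λ (t : Set (ι → Λ)) := by
    rw [← ht]
    exact Submodule.subset_span ⟨j, c, z, fun _ => rfl, hc⟩
  obtain ⟨g, hg⟩ := (Submodule.mem_span_range_iff_exists_fun Λ (v := fun b : t => (b : ι → Λ))).1
    (by simpa using hmem)
  refine ⟨fun b => DirectSum.decompose 𝒜 (g b) (j - e b), injective_of_mono f j ?_⟩
  have hcs : ∀ s, c s = ∑ b : t, (⟨(DirectSum.decompose 𝒜 (g b) (j - e b) : Λ) * a b s, by
      have := SetLike.GradedMul.mul_mem (DirectSum.decompose 𝒜 (g b) (j - e b)).2 (a b s).2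
      rwa [sub_add_sub_cancel] at this⟩ : 𝒜 (j - d s)) := by
    intro s
    refine Subtype.ext ?_
    have h1 := congrArg (fun u => (DirectSum.decompose 𝒜 u (j - d s) : Λ)) (congrFun hg s)
    simp only [Finset.sum_apply, Pi.smul_apply, smul_eq_mul, DirectSum.decompose_coe,
      DirectSum.of_eq_same, DirectSum.decompose_sum] at h1
    rw [← h1, DFinsupp.finsetSum_apply, AddSubmonoidClass.coe_finsetSum,
      AddSubmonoidClass.coe_finsetSum]
    refine Finset.sum_congr rfl fun b _ => ?_
    rw [hba b s]
    refine Eq.trans ?_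
      (DirectSum.coe_decompose_mul_add_of_right_mem 𝒜 (i := j - e b) (a b s).2)
    rw [sub_add_sub_cancel]
  simp only [map_sum, map_act]
  rw [hc]
  simp only [hy, map_sum]
  rw [Finset.sum_comm]
  refine Finset.sum_congr rfl fun s _ => ?_
  rw [hcs s, map_sum, LinearMap.sum_apply]
  refine Finset.sum_congr rfl fun b _ => ?_
  rw [← N.mul_act (sub_add_cancel (e b) (d s)) (sub_add_cancel j (e b)) (by ring)]
  exact N.act_congr (sub_add_sub_cancel ..).symm _ _ rfl _

instance [GradedAlgebra 𝒜] [IsNoetherianRing Λ] : (isFG 𝒜).IsSerreClass where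
  exists_zero := ⟨_, isZero_zero _, PEmpty, inferInstance, nofun, nofun, fun j y => ⟨nofun, by
    rw [Finset.univ_eq_empty, Finset.sum_empty]
    exact congrArg (fun g => app g j y) ((isZero_zero (GrMod 𝒜)).eq_of_src (𝟙 _) 0)⟩⟩
  prop_of_mono f _ h := isFG_of_mono f h
  prop_of_epi f _ h := isFG_of_epi f h
  prop_X₂_of_shortExact hS h₁ h₃ := isFG_of_shortExact hS h₁ h₃

/-- The graded module `I(n)` for a left ideal `I` of `Λ` that is generated by homogeneous elements;
its part of degree `j` is `I ∩ 𝒜 (j + n)`. -/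
def ofLeftIdeal (𝒜 : ℤ → Submodule k Λ) [SetLike.GradedMonoid 𝒜] (I : Ideal Λ) (n : ℤ) :
    GrMod 𝒜 where
  X j := ↥(𝒜 (j + n) ⊓ I.restrictScalars k)
  act {i j m} h := LinearMap.mk₂ k
    (fun a x => ⟨(a : Λ) * x, by
      have := SetLike.GradedMul.mul_mem a.2 x.2.1
      rwa [← add_assoc, h] at this, I.mul_mem_left _ x.2.2⟩)
    (fun _ _ _ => Subtype.ext (add_mul _ _ _)) (fun _ _ _ => Subtype.ext (smul_mul_assoc _ _ _))
    (fun _ _ _ => Subtype.ext (mul_add _ _ _)) (fun _ _ _ => Subtype.ext (mul_smul_comm _ _ _))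
  one_act x := Subtype.ext (one_mul _)
  mul_act _ _ _ _ _ _ := Subtype.ext (mul_assoc _ _ _)

lemma isFG_ofLeftIdeal (e : Λ) (he : e ∈ 𝒜 0) (hee : e * e = e) (n : ℤ) :
    isFG 𝒜 (ofLeftIdeal 𝒜 (Ideal.span {e}) n) := by
  refine ⟨PUnit, inferInstance, fun _ => -n, fun _ => ⟨e, by rwa [neg_add_cancel],
    Ideal.subset_span rfl⟩, fun j y => ⟨fun _ => ⟨y.1, by rw [sub_neg_eq_add]; exact y.2.1⟩, ?_⟩⟩
  rw [Fintype.sum_unique]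
  obtain ⟨b, hb⟩ := Ideal.mem_span_singleton'.1 y.2.2
  refine Subtype.ext (?_ : y.1 = y.1 * e)
  rw [← hb, mul_assoc, hee]

/-- The graded module `Λ(n)`. -/
def regular (𝒜 : ℤ → Submodule k Λ) [SetLike.GradedMonoid 𝒜] (n : ℤ) : GrMod 𝒜 :=
  ofLeftIdeal 𝒜 ⊤ n

lemma isFG_regular (n : ℤ) : isFG 𝒜 (regular 𝒜 n) := by
  rw [regular, ← Ideal.span_singleton_one]
  exact isFG_ofLeftIdeal 1 SetLike.GradedOne.one_mem (one_mul 1) n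

/-- Right multiplication `Λ → Λ(n)` by an element of degree `n`. -/
def rightMul {n : ℤ} (a : 𝒜 n) : regular 𝒜 0 ⟶ regular 𝒜 n :=
  ofApp (M := regular 𝒜 0) (N := regular 𝒜 n)
    (fun j =>
      { toFun := fun x => ⟨x.1 * a, by
          have h := SetLike.GradedMul.mul_mem x.2.1 a.2
          exact (congrArg (fun i => x.1 * a.1 ∈ 𝒜 (i + n)) (add_zero j)).mp h, trivial⟩
        map_add' := fun _ _ => Subtype.ext (add_mul _ _ _)
        map_smul' := fun _ _ => Subtype.ext (smul_mul_assoc _ _ _) })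
    fun _ _ _ _ _ _ => Subtype.ext (mul_assoc _ _ _)

end GrMod

section Gradings

/-- A direct sum decomposition from a family of projections. -/
@[reducible]
def decompositionOfProj {k M : Type*} [Field k] [AddCommGroup M] [Module k M]
    (𝓜 : ℤ → Submodule k M) (p : ℤ → M →ₗ[k] M) (hmem : ∀ j x, p j x ∈ 𝓜 j)
    (hfin : ∀ x, {j | p j x ≠ 0}.Finite) (hsum : ∀ x, ∑ j ∈ (hfin x).toFinset, p j x = x)
    (hself : ∀ j, ∀ x ∈ 𝓜 j, p j x = x) (hne : ∀ i j, i ≠ j → ∀ x ∈ 𝓜 i, p j x = 0) :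
    DirectSum.Decomposition 𝓜 where
  decompose' x := ∑ j ∈ (hfin x).toFinset, DirectSum.of (fun j => 𝓜 j) j ⟨p j x, hmem j x⟩
  left_inv x := by
    rw [map_sum]
    simp only [DirectSum.coeAddMonoidHom_of]
    exact hsum x
  right_inv d := by
    have key : ∀ (d : DirectSum ℤ fun j => 𝓜 j) (j : ℤ),
        p j (DirectSum.coeAddMonoidHom 𝓜 d) = d j := by
      intro d j
      induction d using DirectSum.induction_on with
      | zero => simp
      | of i x =>
        rw [DirectSum.coeAddMonoidHom_of]
        by_cases h : i = j
        · subst h; rw [hself i x x.2, DirectSum.of_eq_same]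
        · rw [hne i j h x x.2, DirectSum.of_eq_of_ne _ _ _ (Ne.symm h)]; rfl
      | add x y hx hy => simp [hx, hy]
    refine DFinsupp.ext fun j => Subtype.ext ?_
    rw [DFinsupp.finsetSum_apply, AddSubmonoidClass.coe_finsetSum]
    by_cases hj : j ∈ (hfin (DirectSum.coeAddMonoidHom 𝓜 d)).toFinset
    · rw [Finset.sum_eq_single_of_mem j hj]
      · exact (congrArg Subtype.val (DirectSum.of_eq_same (β := fun j => 𝓜 j) j _)).trans (key d j)
      · intro i _ hi
        exact congrArg Subtype.val (DirectSum.of_eq_of_ne (β := fun j => 𝓜 j) i j _ (Ne.symm hi))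
    · rw [Finset.sum_eq_zero]
      · rw [← key d j]
        simpa [eq_comm] using hj
      · intro i hi
        refine congrArg Subtype.val (DirectSum.of_eq_of_ne (β := fun j => 𝓜 j) i j _ ?_)
        rintro rfl
        exact hj hi

variable {k R : Type*} [Field k] [CommRing R] [Algebra k R]

/-- The projection of a graded vector space onto its part of degree `j`. -/
def grProj {M : Type*} [AddCommGroup M] [Module k M] (𝓜 : ℤ → Submodule k M)
    [DirectSum.Decomposition 𝓜] (j : ℤ) : M →ₗ[k] M :=
  (𝓜 j).subtype ∘ₗ DirectSum.component k ℤ (fun i => 𝓜 i) j ∘ₗ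
    (DirectSum.decomposeLinearEquiv 𝓜).toLinearMap

section
variable {M : Type*} [AddCommGroup M] [Module k M] (𝓜 : ℤ → Submodule k M)
    [DirectSum.Decomposition 𝓜]

lemma grProj_apply (j : ℤ) (x : M) : grProj 𝓜 j x = DirectSum.decompose 𝓜 x j := rfl

lemma grProj_mem (j : ℤ) (x : M) : grProj 𝓜 j x ∈ 𝓜 j := (DirectSum.decompose 𝓜 x j).2

lemma grProj_self (j : ℤ) (x : M) (hx : x ∈ 𝓜 j) : grProj 𝓜 j x = x :=
  DirectSum.decompose_of_mem_same 𝓜 hx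

lemma grProj_ne (i j : ℤ) (h : i ≠ j) (x : M) (hx : x ∈ 𝓜 i) : grProj 𝓜 j x = 0 :=
  DirectSum.decompose_of_mem_ne 𝓜 hx h

lemma grProj_finite (x : M) : {j | grProj 𝓜 j x ≠ 0}.Finite := by
  classical
  refine ((DirectSum.decompose 𝓜 x).support.finite_toSet).subset fun j hj => ?_
  simpa [grProj_apply] using hj

lemma sum_grProj_of_subset (x : M) (F : Finset ℤ) (hF : ∀ j, grProj 𝓜 j x ≠ 0 → j ∈ F) :
    ∑ j ∈ F, grProj 𝓜 j x = x := by
  classical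
  conv_rhs => rw [← DirectSum.sum_support_decompose 𝓜 x]
  refine (Finset.sum_subset (fun j hj => hF j ?_) fun j _ hj => ?_).symm
  · simpa [grProj_apply] using hj
  · simpa [grProj_apply] using hj

end

section Prod
variable {ι : Type*} {N : ι → Type*} [∀ i, AddCommGroup (N i)] [∀ i, Module k (N i)]

/-- The grading of `R ⊕ ⨁ N i` by total degree. -/
def sumGrading (𝓡 : ℤ → Submodule k R) (𝒩 : ∀ i, ℤ → Submodule k (N i)) (j : ℤ) :
    Submodule k (R × ∀ i, N i) :=
  (𝓡 j).prod (Submodule.pi Set.univ fun i => 𝒩 i j)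

variable (𝓡 : ℤ → Submodule k R) (𝒩 : ∀ i, ℤ → Submodule k (N i))

lemma mem_sumGrading (j : ℤ) (x : R × ∀ i, N i) :
    x ∈ sumGrading 𝓡 𝒩 j ↔ x.1 ∈ 𝓡 j ∧ ∀ i, x.2 i ∈ 𝒩 i j := by
  simp [sumGrading, Submodule.mem_prod, Submodule.mem_pi]

instance [Fintype ι] [DirectSum.Decomposition 𝓡] [∀ i, DirectSum.Decomposition (𝒩 i)] :
    DirectSum.Decomposition (sumGrading 𝓡 𝒩) :=
  decompositionOfProj _
    (fun j => (grProj 𝓡 j).prodMap (LinearMap.pi fun i => grProj (𝒩 i) j ∘ₗ LinearMap.proj i))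
    (fun j x => (mem_sumGrading ..).2 ⟨grProj_mem .., fun i => grProj_mem ..⟩)
    (fun x => ((grProj_finite 𝓡 x.1).union
      (Set.finite_iUnion fun i => grProj_finite (𝒩 i) (x.2 i))).subset fun j hj => by
        by_contra h
        simp only [Set.mem_union, Set.mem_ofPred_eq, Set.mem_iUnion, not_or, not_not,
          not_exists] at h
        exact hj (Prod.ext h.1 (funext h.2)))
    (fun x => by
      refine Prod.ext ?_ (funext fun i => ?_)
      · rw [Prod.fst_sum]
        refine sum_grProj_of_subset 𝓡 x.1 _ fun j hj => ?_
        simp only [Set.Finite.mem_toFinset, Set.mem_ofPred_eq]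
        exact fun h => hj (congrArg Prod.fst h)
      · rw [Prod.snd_sum, Finset.sum_apply]
        refine sum_grProj_of_subset (𝒩 i) (x.2 i) _ fun j hj => ?_
        simp only [Set.Finite.mem_toFinset, Set.mem_ofPred_eq]
        exact fun h => hj (congrFun (congrArg Prod.snd h) i))
    (fun j x hx => by
      rw [mem_sumGrading] at hx
      exact Prod.ext (grProj_self _ _ _ hx.1) (funext fun i => grProj_self _ _ _ (hx.2 i)))
    (fun i j h x hx => by
      rw [mem_sumGrading] at hx
      exact Prod.ext (grProj_ne _ _ _ h _ hx.1) (funext fun s => grProj_ne _ _ _ h _ (hx.2 s)))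

variable [∀ i, Module R (N i)]

instance [SetLike.GradedMonoid 𝓡] [∀ i, SetLike.GradedSMul 𝓡 (𝒩 i)] :
    SetLike.GradedSMul 𝓡 (sumGrading 𝓡 𝒩) where
  smul_mem {i j a x} ha hx := by
    rw [mem_sumGrading] at hx ⊢
    exact ⟨SetLike.GradedMul.mul_mem ha hx.1, fun s => SetLike.GradedSMul.smul_mem ha (hx.2 s)⟩

end Prod

section End
variable {M : Type*} [AddCommGroup M] [Module k M] [Module R M] [IsScalarTower k R M]

/-- The `R`-linear endomorphisms of degree `n` of a graded `R`-module. -/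
def endGrading (R : Type*) [CommRing R] [Algebra k R] [Module R M] [IsScalarTower k R M]
    (𝓜 : ℤ → Submodule k M) (n : ℤ) : Submodule k (Module.End R M) where
  carrier := {f | ∀ j, ∀ x ∈ 𝓜 j, f x ∈ 𝓜 (n + j)}
  zero_mem' _ _ _ := by simp
  add_mem' hf hg j x hx := add_mem (hf j x hx) (hg j x hx)
  smul_mem' c _ hf j x hx := Submodule.smul_mem _ c (hf j x hx)

variable (𝓡 : ℤ → Submodule k R) (𝓜 : ℤ → Submodule k M)

instance : SetLike.GradedMonoid (endGrading R 𝓜) where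
  one_mem j x hx := by simpa using hx
  mul_mem {i j f g} hf hg n x hx := by
    rw [add_assoc]
    exact hf _ _ (hg _ _ hx)

lemma grProj_smul {M : Type*} [AddCommGroup M] [Module k M] [Module R M]
    (𝓡 : ℤ → Submodule k R) (𝓜 : ℤ → Submodule k M) [DirectSum.Decomposition 𝓜]
    [SetLike.GradedSMul 𝓡 𝓜] (i q : ℤ) (r : R) (hr : r ∈ 𝓡 i) (y : M) :
    grProj 𝓜 (i + q) (r • y) = r • grProj 𝓜 q y := by
  induction y using DirectSum.Decomposition.inductionOn 𝓜 with
  | zero => simp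
  | @homogeneous j y =>
    have hy : r • (y : M) ∈ 𝓜 (i + j) := SetLike.GradedSMul.smul_mem hr y.2
    by_cases h : j = q
    · subst h; rw [grProj_self _ _ _ hy, grProj_self _ _ _ y.2]
    · rw [grProj_ne _ _ _ (by lia) _ hy, grProj_ne _ _ _ h _ y.2, smul_zero]
  | add x y hx hy => simp only [smul_add, map_add, hx, hy]

variable [GradedAlgebra 𝓡] [DirectSum.Decomposition 𝓜] [SetLike.GradedSMul 𝓡 𝓜]

/-- The degree `n` component of a `k`-linear endomorphism. -/
def linComp (n : ℤ) (f : M →ₗ[k] M) : M →ₗ[k] M :=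
  DirectSum.toModule k ℤ M (fun j => grProj 𝓜 (n + j) ∘ₗ f ∘ₗ (𝓜 j).subtype) ∘ₗ
    (DirectSum.decomposeLinearEquiv 𝓜).toLinearMap

lemma linComp_apply (n : ℤ) (f : M →ₗ[k] M) {j : ℤ} {x : M} (hx : x ∈ 𝓜 j) :
    linComp 𝓜 n f x = grProj 𝓜 (n + j) (f x) := by
  lift x to 𝓜 j using hx
  simp [linComp]

/-- The degree `n` component of an `R`-linear endomorphism. -/
def endComp (n : ℤ) : Module.End R M →ₗ[k] Module.End R M where
  toFun f :=
    { toFun := linComp 𝓜 n (f.restrictScalars k)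
      map_add' := map_add _
      map_smul' := fun r x => by
        induction x using DirectSum.Decomposition.inductionOn 𝓜 with
        | zero => simp
        | @homogeneous j x =>
          induction r using DirectSum.Decomposition.inductionOn 𝓡 with
          | zero => simp
          | @homogeneous i r =>
            have h : (r : R) • (x : M) ∈ 𝓜 (i + j) := SetLike.GradedSMul.smul_mem r.2 x.2
            rw [linComp_apply 𝓜 n _ h, linComp_apply 𝓜 n _ x.2, RingHom.id_apply,
              ← grProj_smul 𝓡 𝓜 i (n + j) r r.2]
            simp only [LinearMap.coe_restrictScalars, map_smul]
            congr 2
            ring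
          | add r s hr hs => simp only [add_smul, map_add, hr, hs, RingHom.id_apply]
        | add x y hx hy => simp only [smul_add, map_add, hx, hy] }
  map_add' f g := by
    ext x
    induction x using DirectSum.Decomposition.inductionOn 𝓜 with
    | zero => simp
    | @homogeneous j x => simp [linComp_apply 𝓜 n _ x.2]
    | add x y hx hy => rw [map_add, hx, hy, map_add]
  map_smul' c f := by
    ext x
    induction x using DirectSum.Decomposition.inductionOn 𝓜 with
    | zero => simp
    | @homogeneous j x => simp [linComp_apply 𝓜 n _ x.2]
    | add x y hx hy => rw [map_add, hx, hy, map_add]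

lemma endComp_apply (n : ℤ) (f : Module.End R M) {j : ℤ} {x : M} (hx : x ∈ 𝓜 j) :
    endComp 𝓡 𝓜 n f x = grProj 𝓜 (n + j) (f x) := linComp_apply 𝓜 n _ hx

lemma endComp_apply_finite (f : Module.End R M) (x : M) : {n | endComp 𝓡 𝓜 n f x ≠ 0}.Finite := by
  induction x using DirectSum.Decomposition.inductionOn 𝓜 with
  | zero => simp
  | @homogeneous j x =>
    simp only [endComp_apply 𝓡 𝓜 _ _ x.2]
    exact (grProj_finite 𝓜 (f x)).preimage (f := fun n => n + j) (add_left_injective j).injOn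
  | add x y hx hy =>
    refine (hx.union hy).subset fun n hn => ?_
    by_contra h
    simp only [Set.mem_union, Set.mem_ofPred_eq, not_or, not_not] at h
    exact hn (by rw [map_add, h.1, h.2, add_zero])

/-- The endomorphism algebra of a finitely generated graded module is the direct sum of its
homogeneous parts. -/
@[reducible]
def endGradedAlgebra [Module.Finite R M] : GradedAlgebra (endGrading R 𝓜) where
  toDecomposition := decompositionOfProj _ (endComp 𝓡 𝓜)
    (fun n f j x hx => by
      rw [endComp_apply 𝓡 𝓜 n f hx]; exact grProj_mem ..)
    (fun f => by
      obtain ⟨s, hs⟩ := Module.Finite.fg_top (R := R) (M := M)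
      refine (s.finite_toSet.biUnion fun x _ => endComp_apply_finite 𝓡 𝓜 f x).subset
        fun n hn => ?_
      by_contra h
      simp only [Set.mem_iUnion, Set.mem_ofPred_eq, not_exists, not_not] at h
      exact hn (LinearMap.ext_on hs fun x hx => h x hx))
    (fun f => by
      ext x
      induction x using DirectSum.Decomposition.inductionOn 𝓜 with
      | zero => simp
      | @homogeneous j x =>
        rw [LinearMap.sum_apply]
        simp only [endComp_apply 𝓡 𝓜 _ _ x.2]
        refine (Finset.sum_map _ (addRightEmbedding j) fun n => grProj 𝓜 n (f x)).symm.trans ?_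
        refine sum_grProj_of_subset 𝓜 _ _ fun n hn => ?_
        simp only [Finset.mem_map, addRightEmbedding_apply, Set.Finite.mem_toFinset,
          Set.mem_ofPred_eq]
        refine ⟨n - j, fun h => hn ?_, sub_add_cancel n j⟩
        have := LinearMap.congr_fun h (x : M)
        rwa [endComp_apply 𝓡 𝓜 _ _ x.2, sub_add_cancel] at this
      | add x y hx hy => rw [map_add, hx, hy, map_add])
    (fun n f hf => by
      ext x
      induction x using DirectSum.Decomposition.inductionOn 𝓜 with
      | zero => simp
      | @homogeneous j x => rw [endComp_apply 𝓡 𝓜 _ _ x.2, grProj_self _ _ _ (hf _ _ x.2)]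
      | add x y hx hy => rw [map_add, hx, hy, map_add])
    (fun m n h f hf => by
      ext x
      induction x using DirectSum.Decomposition.inductionOn 𝓜 with
      | zero => simp
      | @homogeneous j x =>
        rw [endComp_apply 𝓡 𝓜 _ _ x.2, grProj_ne _ _ _ (by lia) _ (hf _ _ x.2)]; rfl
      | add x y hx hy => rw [map_add, hx, hy, map_add])

end End
end Gradings

section Graded

variable {k Λ : Type u} [Field k] [Ring Λ] [Algebra k Λ] [IsNoetherianRing Λ]
  (𝒜 : ℤ → Submodule k Λ) [GradedAlgebra 𝒜]

/-- The graded version of `D^b_f(Λ)`: the full subcategory of the derived category of graded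
left `Λ`-modules on the objects with bounded and finitely generated cohomology. -/
abbrev DbfGr : Type _ := (boundedWith (GrMod.isFG 𝒜)).FullSubcategory

/-- `Λ(n)` as an object of the graded `D^b_f(Λ)`. -/
def regularGr (n : ℤ) : DbfGr 𝒜 :=
  (stalk (GrMod.isFG 𝒜)).obj ⟨GrMod.regular 𝒜 n, GrMod.isFG_regular n⟩

variable {𝒜}

/-- Right multiplication `Λ → Λ(n)` by an element of degree `n`. -/
def rightMulGr {n : ℤ} (a : 𝒜 n) : regularGr 𝒜 0 ⟶ regularGr 𝒜 n :=
  (stalk (GrMod.isFG 𝒜)).map (ObjectProperty.homMk (GrMod.rightMul a))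

/-- `(Λe)(n)` for an idempotent `e` of degree `0`, as an object of the graded `D^b_f(Λ)`. -/
def leftIdealGr (e : Λ) (he : e ∈ 𝒜 0) (hee : e * e = e) (n : ℤ) : DbfGr 𝒜 :=
  (stalk (GrMod.isFG 𝒜)).obj
    ⟨GrMod.ofLeftIdeal 𝒜 (Ideal.span {e}) n, GrMod.isFG_ofLeftIdeal e he hee n⟩

end Graded

section Setting

variable {k R : Type u} [Field k] [CommRing R] [Algebra k R] {l : ℕ} (N : Fin l → Type u)
  [∀ i, AddCommGroup (N i)] [∀ i, Module k (N i)] [∀ i, Module R (N i)]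
  [∀ i, IsScalarTower k R (N i)]

/-- `Λ = End_R(M)` for `M = R ⊕ ⨁ N i`. -/
abbrev EndAlg (R : Type u) [CommRing R] [∀ i, Module R (N i)] : Type u :=
  Module.End R (R × ∀ i, N i)

instance [IsNoetherianRing R] [∀ i, Module.Finite R (N i)] : IsNoetherianRing (EndAlg N R) :=
  IsNoetherianRing.of_finite R _

/-- The projection `e₀` of `M = R ⊕ ⨁ N i` onto the summand `R`. -/
def e₀ (R : Type u) [CommRing R] [∀ i, Module R (N i)] : EndAlg N R :=
  LinearMap.inl R R (∀ i, N i) ∘ₗ LinearMap.fst R R (∀ i, N i)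

lemma e₀_mul_e₀ (R : Type u) [CommRing R] [∀ i, Module R (N i)] : e₀ N R * e₀ N R = e₀ N R := by
  ext <;> simp [e₀]

/-- The grading of `Λ = End_R(M)`: the part of degree `n` consists of the endomorphisms of
degree `n`. -/
abbrev endAlgGrading {N : Fin l → Type u} [∀ i, AddCommGroup (N i)] [∀ i, Module k (N i)]
    [∀ i, Module R (N i)] [∀ i, IsScalarTower k R (N i)] (𝓡 : ℤ → Submodule k R)
    (𝒩 : ∀ i, ℤ → Submodule k (N i)) : ℤ → Submodule k (EndAlg N R) :=
  endGrading R (sumGrading 𝓡 𝒩)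

variable {N} in
lemma e₀_mem (𝓡 : ℤ → Submodule k R) (𝒩 : ∀ i, ℤ → Submodule k (N i)) :
    e₀ N R ∈ endAlgGrading 𝓡 𝒩 0 := fun j x hx => by
  rw [zero_add]
  rw [mem_sumGrading] at hx ⊢
  exact ⟨hx.1, fun i => zero_mem _⟩

/-- The conditions on the ring and the modules in the complete case. -/
structure IsCompleteSetting (m : Ideal R) : Prop where
  isLocalRing : IsLocalRing R
  isAdicComplete : IsAdicComplete m R
  indecomposable : ∀ i, IsIndecomposable R (N i)
  not_iso : ∀ i j, i ≠ j → IsEmpty (N i ≃ₗ[R] N j)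
  not_iso_self : ∀ i, IsEmpty (N i ≃ₗ[R] R)

variable {N} (𝓡 : ℤ → Submodule k R) [GradedAlgebra 𝓡] (𝒩 : ∀ i, ℤ → Submodule k (N i))
  [∀ i, DirectSum.Decomposition (𝒩 i)]

/-- The conditions on the ring and the modules in the graded case: `R` is `ℕ`-graded and `m` is
its unique maximal homogeneous ideal. -/
structure IsGradedSetting (m : Ideal R) : Prop where
  eq_bot_of_neg : ∀ n < 0, 𝓡 n = ⊥
  isHomogeneous : m.IsHomogeneous 𝓡
  le_of_isHomogeneous : ∀ I : Ideal R, I.IsHomogeneous 𝓡 → I ≠ ⊤ → I ≤ m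
  nontrivial : ∀ i, Nontrivial (N i)
  indecomposable : ∀ (i) (A B : Submodule R (N i)), A.IsHomogeneous (𝒩 i) →
    B.IsHomogeneous (𝒩 i) → IsCompl A B → A = ⊥ ∨ B = ⊥
  not_iso : ∀ i j, i ≠ j → ¬ ∃ f : N i ≃ₗ[R] N j, ∀ n, ∀ x ∈ 𝒩 i n, f x ∈ 𝒩 j n
  not_iso_self : ∀ i, ¬ ∃ f : N i ≃ₗ[R] R, ∀ n, ∀ x ∈ 𝒩 i n, f x ∈ 𝓡 n

instance [∀ i, SetLike.GradedSMul 𝓡 (𝒩 i)] [∀ i, Module.Finite R (N i)] :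
    GradedAlgebra (endAlgGrading 𝓡 𝒩) :=
  endGradedAlgebra 𝓡 _

variable [IsNoetherianRing R] [∀ i, Module.Finite R (N i)] [∀ i, SetLike.GradedSMul 𝓡 (𝒩 i)]

/-- The graded version of `D^b_f(Λ)/⟨P₀⟩` for `P₀ = Λe₀`: the Verdier quotient by the smallest
thick subcategory that contains all `P₀(n)`. -/
abbrev DbfGrQuotient : Type _ :=
  VerdierQuotient (.ofObj (leftIdealGr (e₀ N R) (e₀_mem 𝓡 𝒩) (e₀_mul_e₀ N R)))

/-- The quotient functor to the graded version of `D^b_f(Λ)/⟨P₀⟩`. -/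
abbrev toDbfGrQuotient : DbfGr (endAlgGrading 𝓡 𝒩) ⥤ DbfGrQuotient 𝓡 𝒩 :=
  toVerdierQuotient (.ofObj (leftIdealGr (e₀ N R) (e₀_mem 𝓡 𝒩) (e₀_mul_e₀ N R)))

end Setting

end NCResolution
end

noncomputable section

namespace NCResolution

set_option linter.unusedSectionVars false

section

open Pretriangulated Triangulated ZeroObject

/-! ### Morphisms in a Verdier quotient, computed by iterated precovers -/

section VerdierHom

variable {T : Type*} [Category* T] [Preadditive T] [HasZeroObject T] [HasShift T ℤ]
  [∀ n : ℤ, (shiftFunctor T n).Additive] [Pretriangulated T]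

section DistinguishedTriangles

variable {X₁ X₂ X₃ : T} {f : X₁ ⟶ X₂} {g : X₂ ⟶ X₃} {h : X₃ ⟶ X₁⟦(1 : ℤ)⟧}

/-! Let `T` be the bounded derived category, `E` the projective `P₀` (in the graded case: all its
twists) and `U` the thick subcategory generated by `E`. Since `Hom(P₀⟦n⟧, Y)` is `e₀H⁻ⁿ(Y)` and `Λ`
is noetherian, every `Y` has a precover `p` by a finite sum of shifts of `E` in any given degree. If
maps from shifts of `E` to `Y` occur only in degree `j`, then for the cone `Y'` of a degree `j`
precover they occur only in degree `j + 1`, and `Y ⟶ Y'` becomes invertible in `T/U`. Each object of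
`U` has no maps to such objects of high degree, so iterating computes `Hom` in `T/U` by honest
morphisms of `T` (`trW_Q_map_bijective`).

This has two consequences. For `X` free in degree `n = j`, the map from `Hom(X, Y)` to `Hom` in the
quotient is surjective, and its kernel consists of the maps through the precover
(`trW_Q_map_surjective`, `trW_Q_map_eq_zero`). For `X = Y = Λ` these are the right multiplications
by elements of `Λe₀Λ`. For general `n` one may assume that `Y` sits in a degree beyond `n`; then
`e₀H⁻ⁿ(Y) = 0`, so `Hom(X, Y)` is a finitely generated `Λ/Λe₀Λ`-module (`finite_hom_trW_Q`). Finite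
global dimension makes `Λ` (with its twists) generate `T`, and Hom-finiteness follows by dévissage
once `Λ/Λe₀Λ` is finite dimensional.

For the last point, let `J` be the ideal of scalars in `Λe₀Λ` (`scalarIdeal`). For a prime `p < m`,
the Gorenstein and Cohen-Macaulay conditions make `Extⁱ(Mᵢ, R)`, `i ≥ 1`, vanish at `m` and hence at
`p`. As `R_p` is regular, syzygies have finite projective dimension at `p`, so `Ext¹` from `Mᵢ` into
a syzygy also vanishes at `p`. Some multiple `s · id` of the identity of `Mᵢ` with `s ∉ p` therefore
factors through a free module (`exists_factor_of_isMaximalCohenMacaulay`), which forces `J ≰ p`.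
Thus `m` is the only prime over `J`: directly if `R` is local, and through homogeneous cores in the
graded case. So `J` contains a power of `m`, and `Λ/Λe₀Λ` is finite dimensional because `R/m = k`.
-/

lemma distTriang_comp_zero (hT : Triangle.mk f g h ∈ distTriang T) : f ≫ g = 0 :=
  comp_distTriang_mor_zero₁₂ _ hT

lemma distTriang_exists_lift₂ (hT : Triangle.mk f g h ∈ distTriang T) {X : T} (φ : X ⟶ X₂)
    (hφ : φ ≫ g = 0) : ∃ ψ : X ⟶ X₁, φ = ψ ≫ f :=
  Triangle.coyoneda_exact₂ _ hT φ hφ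

lemma distTriang_exists_lift₃ (hT : Triangle.mk f g h ∈ distTriang T) {X : T} (φ : X ⟶ X₃)
    (hφ : φ ≫ h = 0) : ∃ ψ : X ⟶ X₂, φ = ψ ≫ g :=
  Triangle.coyoneda_exact₃ _ hT φ hφ

lemma distTriang_exists_desc (hT : Triangle.mk f g h ∈ distTriang T) {X : T} (φ : X₂ ⟶ X)
    (hφ : f ≫ φ = 0) : ∃ ψ : X₃ ⟶ X, φ = g ≫ ψ :=
  Triangle.yoneda_exact₂ _ hT φ hφ

end DistinguishedTriangles

section Concentrated

variable (S : ℤ → ObjectProperty T)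

/-- There are no nonzero morphisms from objects in `S n` to `Y`, for `n ≠ j`. -/
def IsConcentrated (j : ℤ) (Y : T) : Prop :=
  ∀ n, n ≠ j → ∀ E, S n E → ∀ f : E ⟶ Y, f = 0

variable {S}

lemma eq_zero_of_shift {C Y : T} (a b : ℤ) (hab : a + b = 0)
    (h : ∀ f : C ⟶ Y⟦b⟧, f = 0) (f : C⟦a⟧ ⟶ Y) : f = 0 := by
  apply (shiftFunctor T b).map_injective
  rw [← cancel_epi ((shiftFunctorCompIsoId T a b hab).inv.app C), Functor.map_zero, comp_zero]
  exact h _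

lemma IsConcentrated.shift (hS : ∀ n a X, S n X → S (n + a) (X⟦a⟧)) {j : ℤ} {Y : T}
    (hY : IsConcentrated S j Y) (b : ℤ) : IsConcentrated S (j + b) (Y⟦b⟧) := by
  intro n hn E hE f
  have := hY (n + -b) (by lia) _ (hS n (-b) E hE)
  apply (shiftFunctor T (-b)).map_injective
  rw [← cancel_mono ((shiftFunctorCompIsoId T b (-b) (by simp)).hom.app Y), Functor.map_zero,
    zero_comp]
  exact this _

variable (S) in
/-- The objects `C` without nonzero morphisms to objects concentrated in high degrees. -/
def eventuallyOrthogonal : ObjectProperty T := fun C =>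
  ∃ N : ℤ, ∀ j, N ≤ j → ∀ Y, IsConcentrated S j Y → ∀ f : C ⟶ Y, f = 0

instance : (eventuallyOrthogonal S).IsStableUnderRetracts where
  of_retract r := by
    rintro ⟨N, hN⟩
    refine ⟨N, fun j hj Y hY f => ?_⟩
    rw [← Category.id_comp f, ← r.retract, Category.assoc, hN j hj Y hY (r.r ≫ f), comp_zero]

/-- A shift moves the bound `N`, and an extension needs the larger of two bounds. As retracts keep
the bound, a thick subcategory is eventually orthogonal as soon as its generators are. -/
lemma isTriangulated_eventuallyOrthogonal (hS : ∀ n a X, S n X → S (n + a) (X⟦a⟧)) :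
    (eventuallyOrthogonal S).IsTriangulated where
  exists_zero := ⟨0, isZero_zero _, 0, fun _ _ _ _ f => (isZero_zero T).eq_of_src f 0⟩
  isStableUnderShiftBy a := ⟨by
    rintro C ⟨N, hN⟩
    refine ⟨N + a, fun j hj Y hY f => eq_zero_of_shift a (-a) (by simp) (fun g => ?_) f⟩
    exact hN (j + -a) (by lia) _ (hY.shift hS (-a)) g⟩
  toIsTriangulatedClosed₂ := .mk' (by
    rintro D hD ⟨N₁, h₁⟩ ⟨N₃, h₃⟩
    refine ⟨max N₁ N₃, fun j hj Y hY f => ?_⟩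
    obtain ⟨g, rfl⟩ := Triangle.yoneda_exact₂ D hD f (h₁ j (by lia) Y hY _)
    rw [h₃ j (by lia) Y hY g, comp_zero])

end Concentrated

/-- A precover of `Y` by objects in `S j`, whose domain `E` lies in `U` and behaves like an object
of degree `j` with respect to `S` and `G`. -/
structure IsPrecover (S G : ℤ → ObjectProperty T) (U : ObjectProperty T) (j : ℤ) {E Y : T}
    (p : E ⟶ Y) : Prop where
  mem : U E
  exists_lift : ∀ X, S j X → ∀ f : X ⟶ Y, ∃ g, f = g ≫ p
  eq_zero : ∀ n, n ≠ j → ∀ X, S n X ∨ G n X → ∀ f : X ⟶ E, f = 0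
  eq_zero' : ∀ n, n ≠ j + 1 → ∀ X, S n X ∨ G n X → ∀ f : X ⟶ E⟦(1 : ℤ)⟧, f = 0

variable {S G : ℤ → ObjectProperty T} {U : ObjectProperty T}

/-- By the long exact sequence of the cone: outside degree `j + 1` a map to `Y'` lifts to `Y`. In
degree `j` the lift factors through `p` and dies in `Y'`; in other degrees it is zero already. -/
lemma IsPrecover.isConcentrated {j : ℤ} {E Y Y' : T} {p : E ⟶ Y} {t : Y ⟶ Y'} {w : Y' ⟶ E⟦(1 : ℤ)⟧}
    (hp : IsPrecover S G U j p) (hT : Triangle.mk p t w ∈ distTriang T)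
    (hY : IsConcentrated S j Y) : IsConcentrated S (j + 1) Y' := by
  intro n hn X hX f
  obtain ⟨g, rfl⟩ := distTriang_exists_lift₃ hT f (hp.eq_zero' n hn X (.inl hX) _)
  by_cases h : n = j
  · subst h
    obtain ⟨q, rfl⟩ := hp.exists_lift X hX g
    rw [Category.assoc, distTriang_comp_zero hT, comp_zero]
  · rw [hY n h X hX g, zero_comp]

lemma IsPrecover.exists_comp {j n : ℤ} {E Y Y' : T} {p : E ⟶ Y} {t : Y ⟶ Y'} {w : Y' ⟶ E⟦(1 : ℤ)⟧}
    (hp : IsPrecover S G U j p) (hT : Triangle.mk p t w ∈ distTriang T) (hn : n ≠ j + 1) {X : T}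
    (hX : G n X) (f : X ⟶ Y') : ∃ g, f = g ≫ t :=
  distTriang_exists_lift₃ hT f (hp.eq_zero' n hn X (.inr hX) _)

lemma IsPrecover.eq_zero_of_comp {j n : ℤ} {E Y Y' : T} {p : E ⟶ Y} {t : Y ⟶ Y'}
    {w : Y' ⟶ E⟦(1 : ℤ)⟧} (hp : IsPrecover S G U j p) (hT : Triangle.mk p t w ∈ distTriang T)
    (hn : n ≠ j) {X : T} (hX : G n X) (f : X ⟶ Y) (hf : f ≫ t = 0) : f = 0 := by
  obtain ⟨g, rfl⟩ := distTriang_exists_lift₂ hT f hf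
  rw [hp.eq_zero n hn X (.inr hX) g, zero_comp]

variable [IsTriangulated T] [U.IsTriangulated]

/-- Coning off precovers `d` times raises the degree by `d` inside one isomorphism class of the
quotient. The domain of each precover is invisible to `G n` for `n < j`, so `Hom` from `G n` never
changes. -/
lemma exists_isConcentrated (happ : ∀ j Y, ∃ (E : T) (p : E ⟶ Y), IsPrecover S G U j p) {j : ℤ}
    {Y : T} (hY : IsConcentrated S j Y) (d : ℕ) :
    ∃ (Y' : T) (t : Y ⟶ Y'), U.trW t ∧ IsConcentrated S (j + d) Y' ∧
      ∀ n < j, ∀ X, G n X → Function.Bijective fun f : X ⟶ Y => f ≫ t := by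
  induction d with
  | zero => exact ⟨Y, 𝟙 Y, U.trW.id_mem Y, by simpa using hY, fun n _ X _ => by
      simp only [Category.comp_id]; exact Function.bijective_id⟩
  | succ d ih =>
    obtain ⟨Z, t, ht, hZ, hbij⟩ := ih
    obtain ⟨E, p, hp⟩ := happ (j + d) Z
    obtain ⟨Z', s, w, hT⟩ := distinguished_cocone_triangle p
    refine ⟨Z', t ≫ s, U.trW.comp_mem _ _ ht (ObjectProperty.trW.mk' U hT hp.mem), ?_,
      fun n hn X hX => ?_⟩
    · have := hp.isConcentrated hT hZ
      rwa [add_assoc] at this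
    · have : Function.Bijective fun f : X ⟶ Z => f ≫ s := by
        refine ⟨fun f g h => sub_eq_zero.1 (hp.eq_zero_of_comp hT (n := n) (by lia) hX _ ?_),
          fun f => ?_⟩
        · rw [Preadditive.sub_comp, sub_eq_zero]; exact h
        · obtain ⟨g, rfl⟩ := hp.exists_comp hT (n := n) (by lia) hX f
          exact ⟨g, rfl⟩
      simpa only [← Category.assoc] using! this.comp (hbij n hn X hX)

lemma trW_Q_map_bijective (happ : ∀ j Y, ∃ (E : T) (p : E ⟶ Y), IsPrecover S G U j p)
    (hU : U ≤ eventuallyOrthogonal S) {j n : ℤ} (hn : n < j) {X Y : T} (hX : G n X)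
    (hY : IsConcentrated S j Y) :
    Function.Bijective (U.trW.Q.map : (X ⟶ Y) → _) := by
  -- A morphism in the quotient involves only one object `C` of `U`. Here `Y` is moved out of the
  -- reach of `C` without changing `Hom(X, Y)`.
  have key : ∀ C, U C → ∃ (Y' : T) (t : Y ⟶ Y'), U.trW t ∧ (∀ g : C ⟶ Y', g = 0) ∧
      Function.Bijective fun f : X ⟶ Y => f ≫ t := fun C hC => by
    obtain ⟨N, hN⟩ := hU C hC
    obtain ⟨Y', t, ht, hY', hb⟩ := exists_isConcentrated happ hY (N - j).toNat
    exact ⟨Y', t, ht, hN _ (by lia) Y' hY', hb n hn X hX⟩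
  constructor
  · intro f g hfg
    obtain ⟨Z, s, hs, h⟩ := (MorphismProperty.map_eq_iff_postcomp U.trW.Q U.trW f g).1 hfg
    -- If `f` and `g` agree after `s`, their difference factors through the fibre `C` of `s`, so it
    -- vanishes in `Y'`.
    obtain ⟨C, i, w, hT, hC⟩ := (U.trW_iff' s).1 hs
    obtain ⟨q, hq⟩ := distTriang_exists_lift₂ hT (f - g)
      (by rw [Preadditive.sub_comp, h, sub_self])
    obtain ⟨Y', t, -, h0, hb⟩ := key C hC
    apply hb.1
    dsimp only
    rw [← sub_eq_zero, ← Preadditive.sub_comp, hq, Category.assoc, h0 (i ≫ t), comp_zero]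
  · intro φ
    obtain ⟨α, rfl⟩ := Localization.exists_rightFraction U.trW.Q U.trW φ
    obtain ⟨C, i, w, hT, hC⟩ := (U.trW_iff' α.s).1 α.hs
    obtain ⟨Y', t, ht, h0, hb⟩ := key C hC
    -- The numerator of the fraction, pushed to `Y'`, vanishes on the fibre of the denominator and
    -- so descends to `X`.
    obtain ⟨g, hg⟩ := distTriang_exists_desc hT (α.f ≫ t) (h0 _)
    obtain ⟨f, rfl⟩ := hb.2 g
    refine ⟨f, ?_⟩
    have := Localization.inverts U.trW.Q U.trW _ ht
    have := Localization.inverts U.trW.Q U.trW _ α.hs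
    rw [← cancel_mono (U.trW.Q.map t), ← cancel_epi (U.trW.Q.map α.s)]
    simp only [MorphismProperty.RightFraction.map, ← Category.assoc, IsIso.hom_inv_id,
      Category.id_comp]
    simp only [Category.assoc, ← Functor.map_comp, hg]

end VerdierHom

end

section

open Pretriangulated Triangulated ZeroObject

/-! ### Hom-finiteness of the quotient -/

section HomFiniteness

variable (k : Type*) [Field k] {D : Type*} [Category* D] [Preadditive D] [Linear k D]

lemma finite_hom_of_iso {X X' Y Y' : D} (e : X ≅ X') (e' : Y ≅ Y')
    [Module.Finite k (X ⟶ Y)] : Module.Finite k (X' ⟶ Y') :=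
  Module.Finite.equiv (Linear.homCongr k e e')

lemma finite_of_forall_exists {V₁ V₂ V₃ : Type*} [AddCommGroup V₁] [AddCommGroup V₂]
    [AddCommGroup V₃] [Module k V₁] [Module k V₂] [Module k V₃] (f : V₁ →ₗ[k] V₂) (g : V₂ →ₗ[k] V₃)
    [Module.Finite k V₁] [Module.Finite k V₃] (h : ∀ x, g x = 0 → ∃ y, x = f y) :
    Module.Finite k V₂ := by
  refine ⟨Submodule.fg_of_fg_map_of_fg_inf_ker g (IsNoetherian.noetherian _) ?_⟩
  have : LinearMap.ker g ≤ LinearMap.range f := fun x hx => by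
    obtain ⟨y, rfl⟩ := h x hx
    exact ⟨y, rfl⟩
  rw [top_inf_eq]
  exact (Submodule.fg_top _).1 ((Module.Finite.of_injective (Submodule.inclusion this)
    (Submodule.inclusion_injective this)).fg_top)

variable [HasZeroObject D] [HasShift D ℤ] [∀ n : ℤ, (shiftFunctor D n).Additive] [Pretriangulated D]

/-- The objects `X` such that all `Hom(Z, X⟦a⟧)` are finite dimensional. -/
def finiteHomFrom (Z : D) : ObjectProperty D := fun X => ∀ a : ℤ, Module.Finite k (Z ⟶ X⟦a⟧)

/-- The objects `X` such that all `Hom(X⟦a⟧, Z)` are finite dimensional. -/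
def finiteHomTo (Z : D) : ObjectProperty D := fun X => ∀ a : ℤ, Module.Finite k (X⟦a⟧ ⟶ Z)

instance (Z : D) : (finiteHomFrom k Z).IsStableUnderRetracts where
  of_retract {X Y} r h a := by
    have := h a
    refine Module.Finite.of_injective (Linear.rightComp k Z (r.i⟦a⟧')) fun f g hfg => ?_
    have := congrArg (· ≫ r.r⟦a⟧') hfg
    simpa [← Functor.map_comp] using this

instance (Z : D) : (finiteHomTo k Z).IsStableUnderRetracts where
  of_retract {X Y} r h a := by
    have := h a
    refine Module.Finite.of_injective (Linear.leftComp k Z (r.r⟦a⟧')) fun f g hfg => ?_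
    have := congrArg (r.i⟦a⟧' ≫ ·) hfg
    simpa [← Functor.map_comp_assoc] using this

instance (Z : D) : (finiteHomFrom k Z).IsTriangulated where
  exists_zero := ⟨0, isZero_zero _, fun a => by
    have : Subsingleton (Z ⟶ (0 : D)⟦a⟧) :=
      ⟨((shiftFunctor D a).map_isZero (isZero_zero D)).eq_of_tgt⟩
    infer_instance⟩
  isStableUnderShiftBy b := ⟨fun X h a => by
    have := h (b + a)
    exact finite_hom_of_iso k (Iso.refl Z) ((shiftFunctorAdd' D b a (b + a) rfl).app X)⟩
  toIsTriangulatedClosed₂ := .mk' fun T hT h₁ h₃ a => by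
    have := h₁ a
    have := h₃ a
    have hT' := Triangle.shift_distinguished T hT a
    exact finite_of_forall_exists k (V₁ := Z ⟶ T.obj₁⟦a⟧) (V₃ := Z ⟶ T.obj₃⟦a⟧)
      (Linear.rightComp k Z ((Triangle.shiftFunctor D a).obj T).mor₁)
      (Linear.rightComp k Z ((Triangle.shiftFunctor D a).obj T).mor₂)
      fun x hx => Triangle.coyoneda_exact₂ _ hT' x hx

instance (Z : D) : (finiteHomTo k Z).IsTriangulated where
  exists_zero := ⟨0, isZero_zero _, fun a => by
    have : Subsingleton ((0 : D)⟦a⟧ ⟶ Z) :=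
      ⟨((shiftFunctor D a).map_isZero (isZero_zero D)).eq_of_src⟩
    infer_instance⟩
  isStableUnderShiftBy b := ⟨fun X h a => by
    have := h (b + a)
    exact finite_hom_of_iso k ((shiftFunctorAdd' D b a (b + a) rfl).app X) (Iso.refl Z)⟩
  toIsTriangulatedClosed₂ := .mk' fun T hT h₁ h₃ a => by
    have := h₁ a
    have := h₃ a
    have hT' := Triangle.shift_distinguished T hT a
    exact finite_of_forall_exists k (V₁ := T.obj₃⟦a⟧ ⟶ Z) (V₃ := T.obj₁⟦a⟧ ⟶ Z)
      (Linear.leftComp k Z ((Triangle.shiftFunctor D a).obj T).mor₂)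
      (Linear.leftComp k Z ((Triangle.shiftFunctor D a).obj T).mor₁)
      fun x hx => Triangle.yoneda_exact₂ _ hT' x hx

end HomFiniteness

instance isStableUnderRetracts_inverseImage {C D : Type*} [Category* C] [Category* D]
    (P : ObjectProperty D) [P.IsStableUnderRetracts] (F : C ⥤ D) :
    (P.inverseImage F).IsStableUnderRetracts where
  of_retract r h := P.prop_of_retract (r.map F) h

section VerdierHom

variable {T : Type*} [Category* T] [Preadditive T] [HasZeroObject T] [HasShift T ℤ]
  [∀ n : ℤ, (shiftFunctor T n).Additive] [Pretriangulated T]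
  {S G : ℤ → ObjectProperty T} {U : ObjectProperty T} [IsTriangulated T] [U.IsTriangulated]

/-- In the boundary case `n = j` a single precover brings `Y` into the bijective range. Passing to
its cone is surjective on maps from `X`, and its kernel consists of the maps through the precover,
as the next lemma records. -/
lemma trW_Q_map_surjective (happ : ∀ j Y, ∃ (E : T) (p : E ⟶ Y), IsPrecover S G U j p)
    (hU : U ≤ eventuallyOrthogonal S) {X Y : T} {j : ℤ} (hX : G j X) (hY : IsConcentrated S j Y) :
    Function.Surjective (U.trW.Q.map : (X ⟶ Y) → _) := by
  intro φ
  obtain ⟨E, p, hp⟩ := happ j Y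
  obtain ⟨Y', t, w, hT⟩ := distinguished_cocone_triangle p
  have ht : U.trW t := ObjectProperty.trW.mk' U hT hp.mem
  obtain ⟨g, hg⟩ := (trW_Q_map_bijective happ hU (lt_add_one j) hX
    (hp.isConcentrated hT hY)).2 (φ ≫ U.trW.Q.map t)
  obtain ⟨f, rfl⟩ := hp.exists_comp hT (by lia) hX g
  have := Localization.inverts U.trW.Q U.trW _ ht
  refine ⟨f, ?_⟩
  rw [← cancel_mono (U.trW.Q.map t), ← hg, Functor.map_comp]

lemma trW_Q_map_eq_zero (happ : ∀ j Y, ∃ (E : T) (p : E ⟶ Y), IsPrecover S G U j p)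
    (hU : U ≤ eventuallyOrthogonal S) {E X Y : T} {j : ℤ} {p : E ⟶ Y} (hp : IsPrecover S G U j p)
    (hX : G j X) (hY : IsConcentrated S j Y) (f : X ⟶ Y) (hf : U.trW.Q.map f = 0) :
    ∃ g, f = g ≫ p := by
  obtain ⟨Y', t, w, hT⟩ := distinguished_cocone_triangle p
  refine distTriang_exists_lift₂ hT f ?_
  apply (trW_Q_map_bijective happ hU (lt_add_one j) hX (hp.isConcentrated hT hY)).1
  rw [Functor.map_comp, hf, zero_comp, Functor.map_zero]

variable {k : Type*} [Field k] [Linear k T]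

lemma finite_hom_trW_Q (happ : ∀ j Y, ∃ (E : T) (p : E ⟶ Y), IsPrecover S G U j p)
    (hU : U ≤ eventuallyOrthogonal S)
    (hfin : ∀ n Y, (∀ E, S n E → ∀ f : E ⟶ Y, f = 0) → ∀ X, G n X → Module.Finite k (X ⟶ Y))
    {X Y : T} {n j : ℤ} (hX : G n X) (hY : IsConcentrated S j Y) :
    Module.Finite k (U.trW.Q.obj X ⟶ U.trW.Q.obj Y) := by
  -- This many steps place `Y'` in a degree larger than `n`: the bijectivity range is reached, and
  -- maps from `S n` to `Y'` vanish, as `hfin` requires.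
  obtain ⟨Y', t, ht, hY', -⟩ := exists_isConcentrated happ hY (n + 1 - j).toNat
  have hlt : n < j + (n + 1 - j).toNat := by lia
  have hb := trW_Q_map_bijective happ hU hlt hX hY'
  have : Module.Finite k (X ⟶ Y') := hfin n Y' (hY' n (by lia)) X hX
  have := Localization.inverts U.trW.Q U.trW _ ht
  have : Module.Finite k (U.trW.Q.obj X ⟶ U.trW.Q.obj Y') :=
    Module.Finite.of_surjective (Functor.mapLinearMap k U.trW.Q) hb.2
  exact finite_hom_of_iso k (Iso.refl _) (asIso (U.trW.Q.map t)).symm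

/-- Dévissage in each variable: the objects with finite-dimensional `Hom` from, or to, a fixed
object in all degrees form a thick subcategory. The target is treated first, then the source. -/
theorem homFinite_trW_localization
    (happ : ∀ j Y, ∃ (E : T) (p : E ⟶ Y), IsPrecover S G U j p)
    (hU : U ≤ eventuallyOrthogonal S)
    (hfin : ∀ n Y, (∀ E, S n E → ∀ f : E ⟶ Y, f = 0) → ∀ X, G n X → Module.Finite k (X ⟶ Y))
    (hG : ∀ n X, G 0 X → G n (X⟦n⟧)) (hSG : ∀ n X, G n X → IsConcentrated S n X)
    (hgen : ∀ X, (G 0).triangEnvelope X) : HomFinite k U.trW.Localization := by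
  have h₁ (X : T) (n : ℤ) (hX : G n X) (Y : T) :
      finiteHomFrom k (U.trW.Q.obj X) (U.trW.Q.obj Y) := by
    refine (ObjectProperty.triangEnvelope_le_iff (P := G 0)
      (Q := (finiteHomFrom k (U.trW.Q.obj X)).inverseImage U.trW.Q)).2 (fun Z hZ a => ?_) Y (hgen Y)
    have := finite_hom_trW_Q happ hU hfin hX (hSG a _ (hG a Z hZ))
    exact finite_hom_of_iso k (Y := U.trW.Q.obj (Z⟦a⟧)) (Iso.refl _)
      ((U.trW.Q.commShiftIso a).app Z)
  have h₂ (Y X : T) : finiteHomTo k (U.trW.Q.obj Y) (U.trW.Q.obj X) := by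
    refine (ObjectProperty.triangEnvelope_le_iff (P := G 0)
      (Q := (finiteHomTo k (U.trW.Q.obj Y)).inverseImage U.trW.Q)).2 (fun Z hZ a => ?_) X (hgen X)
    have := h₁ (Z⟦a⟧) a (hG a Z hZ) Y 0
    exact finite_hom_of_iso k (X := U.trW.Q.obj (Z⟦a⟧)) (Y := (U.trW.Q.obj Y)⟦(0 : ℤ)⟧)
      ((U.trW.Q.commShiftIso a).app Z) ((shiftFunctorZero U.trW.Localization ℤ).app _)
  intro X Y
  have := Localization.essSurj U.trW.Q U.trW
  have := h₂ (U.trW.Q.objPreimage Y) (U.trW.Q.objPreimage X) 0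
  exact finite_hom_of_iso k (X := (U.trW.Q.obj (U.trW.Q.objPreimage X))⟦(0 : ℤ)⟧)
    ((shiftFunctorZero U.trW.Localization ℤ).app _ ≪≫ U.trW.Q.objObjPreimageIso X)
    (U.trW.Q.objObjPreimageIso Y)

end VerdierHom

end

section

open Pretriangulated Triangulated ZeroObject

/-! ### Precovers and quotients for families of shifted objects -/

section ShiftFamilies

variable {T : Type*} [Category* T] [Preadditive T] [HasZeroObject T] [HasShift T ℤ]
  [∀ n : ℤ, (shiftFunctor T n).Additive] [Pretriangulated T]
  {σ τ : Type*} (E : τ → T) (G : σ → T)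

/-- The objects isomorphic to some `E t⟦n⟧`. -/
def shiftsOf (n : ℤ) : ObjectProperty T := fun X => ∃ t, Nonempty (X ≅ (E t)⟦n⟧)

lemma shiftsOf_shift (n a : ℤ) (X : T) (h : shiftsOf E n X) : shiftsOf E (n + a) (X⟦a⟧) := by
  obtain ⟨t, ⟨e⟩⟩ := h
  exact ⟨t, ⟨(shiftFunctor T a).mapIso e ≪≫ ((shiftFunctorAdd T n a).app (E t)).symm⟩⟩

variable {E G}

lemma eq_zero_of_shiftsOf {n j : ℤ} (hn : n ≠ j) {C : T}
    (h : ∀ (a : ℤ), a ≠ 0 → ∀ t, ∀ f : E t ⟶ C⟦a⟧, f = 0) {X : T} (hX : shiftsOf E n X)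
    (f : X ⟶ C⟦j⟧) : f = 0 := by
  obtain ⟨t, ⟨e⟩⟩ := hX
  rw [← cancel_epi e.inv, comp_zero]
  refine eq_zero_of_shift n (-n) (by simp) (fun g => ?_) _
  rw [← cancel_mono ((shiftFunctorAdd' T j (-n) (j + -n) rfl).inv.app C), zero_comp]
  exact h (j + -n) (by lia) t _

/-- Finitely many maps through which all others factor assemble to a precover. The degree conditions
hold because shifts of the `E t` by different amounts do not see each other, nor do those of `G s`
see those of `E t`. -/
lemma isPrecover_biproduct {U : ObjectProperty T} [U.IsTriangulated] [U.IsClosedUnderIsomorphisms]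
    (hU : ∀ t, U (E t)) {Y : T} (j : ℤ)
    (hE : ∀ a : ℤ, a ≠ 0 → ∀ t t', ∀ f : E t ⟶ (E t')⟦a⟧, f = 0)
    (hG : ∀ a : ℤ, a ≠ 0 → ∀ s t, ∀ f : G s ⟶ (E t)⟦a⟧, f = 0)
    {n : ℕ} (t : Fin n → τ) (x : ∀ i, (E (t i))⟦j⟧ ⟶ Y)
    (hx : ∀ t' (f : (E t')⟦j⟧ ⟶ Y), ∃ g : ∀ i, (E t')⟦j⟧ ⟶ (E (t i))⟦j⟧, f = ∑ i, g i ≫ x i) :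
    IsPrecover (shiftsOf E) (shiftsOf G) U j (biproduct.desc x) where
  mem := U.prop_of_iso (biproduct.isoProduct _).symm (U.prop_pi _ fun i => U.le_shift j _ (hU _))
  exists_lift X := by
    rintro ⟨t', ⟨e⟩⟩ f
    obtain ⟨g, hg⟩ := hx t' (e.inv ≫ f)
    refine ⟨e.hom ≫ biproduct.lift g, ?_⟩
    rw [Category.assoc, biproduct.lift_desc, ← hg, Iso.hom_inv_id_assoc]
  eq_zero m hm X hX f := by
    refine biproduct.hom_ext _ _ fun i => ?_
    rw [zero_comp]
    rcases hX with hX | hX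
    · exact eq_zero_of_shiftsOf hm (fun a ha t' g => hE a ha t' _ g) hX _
    · exact eq_zero_of_shiftsOf hm (fun a ha t' g => hG a ha t' _ g) hX _
  eq_zero' m hm X hX f := by
    -- The shift of the biproduct is not literally a biproduct, so `f` is split into components by
    -- the shifted projections and inclusions.
    have h1 : f = ∑ i, (f ≫ (biproduct.π (fun i => (E (t i))⟦j⟧) i)⟦(1 : ℤ)⟧') ≫
        (biproduct.ι (fun i => (E (t i))⟦j⟧) i)⟦(1 : ℤ)⟧' := by
      simp only [Category.assoc, ← Functor.map_comp, ← Preadditive.comp_sum, ← Functor.map_sum,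
        biproduct.total]
      simp
    rw [h1]
    refine Finset.sum_eq_zero fun i _ => ?_
    have : ∀ g : X ⟶ (E (t i))⟦j⟧⟦(1 : ℤ)⟧, g = 0 := fun g => by
      rw [← cancel_mono ((shiftFunctorAdd T j 1).inv.app (E (t i))), zero_comp]
      rcases hX with hX | hX
      · exact eq_zero_of_shiftsOf hm (fun a ha t' g => hE a ha t' _ g) hX _
      · exact eq_zero_of_shiftsOf hm (fun a ha t' g => hG a ha t' _ g) hX _
    rw [this (f ≫ _), zero_comp]

lemma exists_isPrecover {U : ObjectProperty T} [U.IsTriangulated] [U.IsClosedUnderIsomorphisms]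
    (hU : ∀ t, U (E t))
    (hE : ∀ a : ℤ, a ≠ 0 → ∀ t t', ∀ f : E t ⟶ (E t')⟦a⟧, f = 0)
    (hG : ∀ a : ℤ, a ≠ 0 → ∀ s t, ∀ f : G s ⟶ (E t)⟦a⟧, f = 0)
    (happ : ∀ Y : T, ∃ (n : ℕ) (t : Fin n → τ) (x : ∀ i, E (t i) ⟶ Y),
      ∀ t' (f : E t' ⟶ Y), ∃ g : ∀ i, E t' ⟶ E (t i), f = ∑ i, g i ≫ x i) (j : ℤ) (Y : T) :
    ∃ (X : T) (p : X ⟶ Y), IsPrecover (shiftsOf E) (shiftsOf G) U j p := by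
  -- Degree `j` maps to `Y` are degree `0` maps to `Y⟦-j⟧`.
  obtain ⟨n, t, x, hx⟩ := happ (Y⟦-j⟧)
  let e : Y⟦-j⟧⟦j⟧ ≅ Y := (shiftFunctorCompIsoId T (-j) j (by simp)).app Y
  refine ⟨_, _, isPrecover_biproduct hU j hE hG t (fun i => (x i)⟦j⟧' ≫ e.hom) fun t' f => ?_⟩
  obtain ⟨f', hf'⟩ := (shiftFunctor T j).map_surjective (f ≫ e.inv)
  obtain ⟨g, rfl⟩ := hx t' f'
  refine ⟨fun i => (g i)⟦j⟧', ?_⟩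
  rw [← cancel_mono e.inv, ← hf', Functor.map_sum, Preadditive.sum_comp]
  simp

variable [IsTriangulated T] (S : ObjectProperty T) [S.Nonempty]

/-- The group of morphisms `X ⟶ Y` that are sums of morphisms that factor through some `E t`. -/
def factorsThrough {C : Type*} [Category* C] [Preadditive C] {τ : Type*} (E : τ → C) (X Y : C) :
    AddSubgroup (X ⟶ Y) :=
  AddSubgroup.closure {f | ∃ (t : τ) (g : X ⟶ E t) (x : E t ⟶ Y), f = g ≫ x}

variable {k : Type*} [Field k] [Linear k T]

lemma triangEnvelope_le_eventuallyOrthogonal (hS : ∀ X, S X ↔ ∃ t, X = E t) :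
    S.triangEnvelope ≤ eventuallyOrthogonal (shiftsOf E) := by
  have := isTriangulated_eventuallyOrthogonal (S := shiftsOf E) (shiftsOf_shift E)
  refine S.triangEnvelope_le_iff.2 fun X hX => ?_
  obtain ⟨t, rfl⟩ := (hS X).1 hX
  -- The bound is `1` because `E t` itself is an object of degree `0`.
  exact ⟨1, fun j hj Y hY f => hY 0 (by lia) _ ⟨t, ⟨((shiftFunctorZero T ℤ).app _).symm⟩⟩ f⟩

lemma isConcentrated_shift (hEG : ∀ a : ℤ, a ≠ 0 → ∀ t s, ∀ f : E t ⟶ (G s)⟦a⟧, f = 0) (n : ℤ)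
    (X : T) (hX : shiftsOf G n X) : IsConcentrated (shiftsOf E) n X := by
  obtain ⟨s, ⟨e⟩⟩ := hX
  intro m hm Y hY f
  rw [← cancel_mono e.hom, zero_comp]
  exact eq_zero_of_shiftsOf hm (fun a ha t g => hEG a ha t s g) hY _

theorem homFinite_verdierQuotient [∀ n : ℤ, (shiftFunctor T n).Linear k]
    (hS : ∀ X, S X ↔ ∃ t, X = E t)
    (hE : ∀ a : ℤ, a ≠ 0 → ∀ t t', ∀ f : E t ⟶ (E t')⟦a⟧, f = 0)
    (hGE : ∀ a : ℤ, a ≠ 0 → ∀ s t, ∀ f : G s ⟶ (E t)⟦a⟧, f = 0)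
    (hEG : ∀ a : ℤ, a ≠ 0 → ∀ t s, ∀ f : E t ⟶ (G s)⟦a⟧, f = 0)
    (happ : ∀ Y : T, ∃ (n : ℕ) (t : Fin n → τ) (x : ∀ i, E (t i) ⟶ Y),
      ∀ t' (f : E t' ⟶ Y), ∃ g : ∀ i, E t' ⟶ E (t i), f = ∑ i, g i ≫ x i)
    (hfin : ∀ Y : T, (∀ t (f : E t ⟶ Y), f = 0) → ∀ s, Module.Finite k (G s ⟶ Y))
    (hgen : ∀ X : T, (ObjectProperty.ofObj G).triangEnvelope X) :
    HomFinite k (VerdierQuotient S) := by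
  refine homFinite_trW_localization (S := shiftsOf E) (G := shiftsOf G)
    (exists_isPrecover (fun t => S.le_triangEnvelope _ ((hS _).2 ⟨t, rfl⟩)) hE hGE happ)
    (triangEnvelope_le_eventuallyOrthogonal S hS) (fun n Y hY X hX => ?_)
    (fun n X hX => by simpa using shiftsOf_shift G 0 n X hX) (isConcentrated_shift hEG)
    (fun X => ObjectProperty.monotone_triangEnvelope ?_ X (hgen X))
  · obtain ⟨s, ⟨e⟩⟩ := hX
    have h0 := hfin (Y⟦-n⟧) (fun t f => by
      apply (shiftFunctor T n).map_injective
      rw [← cancel_mono ((shiftFunctorCompIsoId T (-n) n (by simp)).hom.app Y), Functor.map_zero,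
        zero_comp]
      exact hY _ ⟨t, ⟨Iso.refl _⟩⟩ _) s
    have : Module.Finite k ((G s)⟦n⟧⟦-n⟧ ⟶ Y⟦-n⟧) := finite_hom_of_iso k (X := G s)
      ((shiftFunctorCompIsoId T n (-n) (by simp)).symm.app (G s)) (Iso.refl (Y⟦-n⟧))
    have : Module.Finite k ((G s)⟦n⟧ ⟶ Y) := Module.Finite.of_injective
      ((shiftFunctor T (-n)).mapLinearMap k (X := (G s)⟦n⟧) (Y := Y))
      (shiftFunctor T (-n)).map_injective
    exact finite_hom_of_iso k e.symm (Iso.refl Y)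
  · rintro _ ⟨s⟩
    exact ⟨s, ⟨((shiftFunctorZero T ℤ).app _).symm⟩⟩

theorem toVerdierQuotient_map_surjective (hS : ∀ X, S X ↔ ∃ t, X = E t)
    (hE : ∀ a : ℤ, a ≠ 0 → ∀ t t', ∀ f : E t ⟶ (E t')⟦a⟧, f = 0)
    (hGE : ∀ a : ℤ, a ≠ 0 → ∀ s t, ∀ f : G s ⟶ (E t)⟦a⟧, f = 0)
    (hEG : ∀ a : ℤ, a ≠ 0 → ∀ t s, ∀ f : E t ⟶ (G s)⟦a⟧, f = 0)
    (happ : ∀ Y : T, ∃ (n : ℕ) (t : Fin n → τ) (x : ∀ i, E (t i) ⟶ Y),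
      ∀ t' (f : E t' ⟶ Y), ∃ g : ∀ i, E t' ⟶ E (t i), f = ∑ i, g i ≫ x i) (s s' : σ) :
    Function.Surjective ((toVerdierQuotient S).map : (G s ⟶ G s') → _) :=
  trW_Q_map_surjective (S := shiftsOf E) (G := shiftsOf G) (j := 0)
    (exists_isPrecover (fun t => S.le_triangEnvelope _ ((hS _).2 ⟨t, rfl⟩)) hE hGE happ)
    (triangEnvelope_le_eventuallyOrthogonal S hS) ⟨s, ⟨((shiftFunctorZero T ℤ).app _).symm⟩⟩
    (isConcentrated_shift hEG 0 _ ⟨s', ⟨((shiftFunctorZero T ℤ).app _).symm⟩⟩)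

/-- A map killed by the quotient factors through a precover, a finite biproduct of the `E t`, so it
is a sum of maps through single `E t`. Conversely, each `E t` becomes zero. -/
theorem toVerdierQuotient_map_eq_zero_iff (hS : ∀ X, S X ↔ ∃ t, X = E t)
    (hE : ∀ a : ℤ, a ≠ 0 → ∀ t t', ∀ f : E t ⟶ (E t')⟦a⟧, f = 0)
    (hGE : ∀ a : ℤ, a ≠ 0 → ∀ s t, ∀ f : G s ⟶ (E t)⟦a⟧, f = 0)
    (hEG : ∀ a : ℤ, a ≠ 0 → ∀ t s, ∀ f : E t ⟶ (G s)⟦a⟧, f = 0)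
    (happ : ∀ Y : T, ∃ (n : ℕ) (t : Fin n → τ) (x : ∀ i, E (t i) ⟶ Y),
      ∀ t' (f : E t' ⟶ Y), ∃ g : ∀ i, E t' ⟶ E (t i), f = ∑ i, g i ≫ x i) {s s' : σ}
    (f : G s ⟶ G s') :
    (toVerdierQuotient S).map f = 0 ↔ f ∈ factorsThrough E (G s) (G s') := by
  have hU : ∀ t, S.triangEnvelope (E t) := fun t => S.le_triangEnvelope _ ((hS _).2 ⟨t, rfl⟩)
  constructor
  · intro hf
    obtain ⟨n, t, x, hx⟩ := happ (G s')
    let e (t) := (shiftFunctorZero T ℤ).app (E t)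
    have hp := isPrecover_biproduct hU 0 hE hGE t (fun i => (e _).hom ≫ x i) (fun t' f => by
      obtain ⟨g, hg⟩ := hx t' ((e _).inv ≫ f)
      refine ⟨fun i => (e _).hom ≫ g i ≫ (e _).inv, ?_⟩
      rw [← cancel_epi (e t').inv, hg, Preadditive.comp_sum]
      simp)
    obtain ⟨g, rfl⟩ := trW_Q_map_eq_zero (S := shiftsOf E) (G := shiftsOf G) (j := 0)
      (exists_isPrecover hU hE hGE happ)
      (triangEnvelope_le_eventuallyOrthogonal S hS) hp
      ⟨s, ⟨((shiftFunctorZero T ℤ).app _).symm⟩⟩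
      (isConcentrated_shift hEG 0 _ ⟨s', ⟨((shiftFunctorZero T ℤ).app _).symm⟩⟩) f hf
    rw [biproduct.desc_eq, Preadditive.comp_sum]
    refine sum_mem fun i _ => AddSubgroup.subset_closure
      ⟨t i, g ≫ biproduct.π _ i ≫ (e _).hom, x i, ?_⟩
    simp
  · intro hf
    induction hf using AddSubgroup.closure_induction with
    | mem f hf =>
      obtain ⟨t, g, x, rfl⟩ := hf
      rw [Functor.map_comp]
      have h0 : IsZero ((toVerdierQuotient S).obj (E t)) := by
        have ht : S.triangEnvelope.trW (0 : E t ⟶ 0) :=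
          ObjectProperty.trW.mk' _ (contractible_distinguished (E t)) (hU t)
        have := Localization.inverts (toVerdierQuotient S) S.triangEnvelope.trW _ ht
        exact ((toVerdierQuotient S).map_isZero (isZero_zero T)).of_iso
          (asIso ((toVerdierQuotient S).map (0 : E t ⟶ 0)))
      rw [h0.eq_of_src ((toVerdierQuotient S).map x) 0, comp_zero]
    | zero => exact Functor.map_zero ..
    | add f g _ _ hf hg => rw [Functor.map_add, hf, hg, add_zero]
    | neg f _ hf => rw [Functor.map_neg, hf, neg_zero]

end ShiftFamilies

end

/-! ### Full triangulated subcategories and maps from projectives in derived categories -/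

section

open Pretriangulated Triangulated ZeroObject

section FullSubcategory

variable {C : Type*} [Category* C] [Preadditive C] [HasZeroObject C] [HasShift C ℤ]
  [∀ n : ℤ, (shiftFunctor C n).Additive] [Pretriangulated C] (Q : ObjectProperty C)
  [Q.IsTriangulated]

lemma exists_distTriang_fullSubcategory {X Y Z : Q.FullSubcategory} (f : X.obj ⟶ Y.obj)
    (g : Y.obj ⟶ Z.obj) (h : Z.obj ⟶ X.obj⟦(1 : ℤ)⟧) (hT : Triangle.mk f g h ∈ distTriang C) :
    ∃ (f' : X ⟶ Y) (g' : Y ⟶ Z) (h' : Z ⟶ X⟦(1 : ℤ)⟧),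
      Triangle.mk f' g' h' ∈ distTriang Q.FullSubcategory ∧ f'.hom = f ∧ g'.hom = g := by
  refine ⟨Q.homMk f, Q.homMk g, Q.homMk (h ≫ (Q.ι.commShiftIso (1 : ℤ)).inv.app X), ?_, rfl, rfl⟩
  refine isomorphic_distinguished _ hT _ (Triangle.isoMk _ _ (Iso.refl _) (Iso.refl _)
    (Iso.refl _) ?_ ?_ ?_)
  · exact (Category.comp_id _).trans (Category.id_comp _).symm
  · exact (Category.comp_id _).trans (Category.id_comp _).symm
  · change ((h ≫ (Q.ι.commShiftIso (1 : ℤ)).inv.app X) ≫ (Q.ι.commShiftIso (1 : ℤ)).hom.app X) ≫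
      (shiftFunctor C (1 : ℤ)).map (𝟙 X.obj) = 𝟙 Z.obj ≫ h
    have h1 : (Q.ι.commShiftIso (1 : ℤ)).inv.app X ≫ (Q.ι.commShiftIso (1 : ℤ)).hom.app X = 𝟙 _ :=
      Iso.inv_hom_id_app _ X
    refine (congrArg (((h ≫ (Q.ι.commShiftIso (1 : ℤ)).inv.app X) ≫
      (Q.ι.commShiftIso (1 : ℤ)).hom.app X) ≫ ·) ((shiftFunctor C (1 : ℤ)).map_id X.obj)).trans ?_
    exact (Category.comp_id _).trans ((Category.assoc _ _ _).trans ((congrArg (h ≫ ·) h1).trans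
      ((Category.comp_id _).trans (Category.id_comp _).symm)))

instance {k : Type*} [Field k] [Linear k C] [∀ n : ℤ, (shiftFunctor C n).Linear k] (n : ℤ) :
    (shiftFunctor Q.FullSubcategory n).Linear k where
  map_smul f r := by
    apply Q.ι.map_injective
    rw [Q.ι.map_smul, ← cancel_mono ((Q.ι.commShiftIso n).hom.app _), Linear.smul_comp,
      Q.ι.commShiftIso_hom_naturality, Q.ι.commShiftIso_hom_naturality, Functor.map_smul,
      Functor.map_smul, Linear.comp_smul]

end FullSubcategory

section Derived

variable {A : Type*} [Category* A] [Abelian A]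

open DerivedCategory DerivedCategory.TStructure

lemma single_hom_eq_zero_of_isLE {X : A} [Projective X] {Y : DerivedCategory A} (n : ℤ) (hn : n < 0)
    [t.IsLE Y n] (f : (singleFunctor A 0).obj X ⟶ Y) : f = 0 := by
  obtain ⟨K, _, ⟨e⟩⟩ := exists_iso_Q_obj_of_isLE Y n
  rw [← cancel_mono e.hom, ← cancel_epi ((singleFunctorIsoCompQ A 0).inv.app X), zero_comp,
    comp_zero]
  exact from_singleFunctor_obj_eq_zero_of_projective _ n hn

/-- For `a < 0` this is the orthogonality of the t-structure; for `a > 0` it is the vanishing of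
positive `Ext` from a projective. -/
lemma single_hom_shift_eq_zero {X Y : A} [Projective X] {a : ℤ} (ha : a ≠ 0)
    (f : (singleFunctor A 0).obj X ⟶ ((singleFunctor A 0).obj Y)⟦a⟧) : f = 0 := by
  rcases lt_or_gt_of_ne ha with h | h
  · have := t.isGE_shift ((singleFunctor A 0).obj Y) 0 a (-a)
    exact t.zero f 0 (-a)
  · have := t.isLE_shift ((singleFunctor A 0).obj Y) 0 a (-a)
    exact single_hom_eq_zero_of_isLE (-a) (by lia) f

variable (P : ObjectProperty A) [P.IsSerreClass]

/-- In the long exact cohomology sequence, each cohomology object of `B` is zero or a subobject of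
that of `Y`, and each one of `C` is zero or a quotient. A Serre class contains both. -/
lemma boundedWith_of_truncation {B Y C : DerivedCategory A} {f : B ⟶ Y} {g : Y ⟶ C}
    {h : C ⟶ B⟦(1 : ℤ)⟧} (hT : Triangle.mk f g h ∈ distTriang _) (n₀ n₁ : ℤ) (hn : n₀ + 1 = n₁)
    (hB : t.IsLE B n₀) (hC : t.IsGE C n₁) (hY : boundedWith P Y) :
    boundedWith P B ∧ boundedWith P C := by
  obtain ⟨h₁, h₃⟩ := ObjectProperty.mem_of_hasInductedTStructure t.bounded t _ hT n₀ n₁ hn hB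
    hY.1 hC
  refine ⟨⟨h₁, fun n => ?_⟩, ⟨h₃, fun n => ?_⟩⟩
  · by_cases hh : n ≤ n₀
    · have : Mono ((homologyFunctor A n).map f) :=
        (HomologySequence.mono_homologyMap_mor₁_iff _ hT (n - 1) n (by lia)).2
          ((isZero_of_isGE C n₁ (n - 1) (by lia)).eq_of_src _ _)
      exact P.prop_of_mono ((homologyFunctor A n).map f) (hY.2 n)
    · exact P.prop_of_isZero (isZero_of_isLE B n₀ n (by lia))
  · by_cases hh : n₁ ≤ n
    · have : Epi ((homologyFunctor A n).map g) :=
        (HomologySequence.epi_homologyMap_mor₂_iff _ hT n (n + 1) (by lia)).2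
          ((isZero_of_isLE B n₀ (n + 1) (by lia)).eq_of_tgt _ _)
      exact P.prop_of_epi ((homologyFunctor A n).map g) (hY.2 n)
    · exact P.prop_of_isZero (isZero_of_isGE C n₁ n (by lia))

lemma prop_of_boundedWith_single {X : A} (n : ℤ)
    (h : boundedWith P ((singleFunctor A n).obj X)) : P X :=
  P.prop_of_iso ((singleFunctorCompHomologyFunctorIso A n).app X) (h.2 n)

instance : (boundedWith P).IsClosedUnderIsomorphisms := by
  unfold boundedWith; infer_instance

/-- Maps from projective objects to a complex are computed by its cohomology in degree `0`. -/
lemma exists_single_zigzag {Y : DerivedCategory A} (hY : boundedWith P Y) :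
    ∃ (X : A) (_ : P X) (Z : DerivedCategory A) (a : Y ⟶ Z) (b : (singleFunctor A 0).obj X ⟶ Z),
      ∀ (F : A) [Projective F],
        (Function.Bijective fun f : (singleFunctor A 0).obj F ⟶ Y => f ≫ a) ∧
        (Function.Bijective fun f : F ⟶ X => (singleFunctor A 0).map f ≫ b) := by
  -- Here `Z` is the truncation of `Y` to degrees `≥ 0`. Projectives in degree `0` have no maps to
  -- `B` or `B⟦1⟧`, so composition with `a` is bijective.
  obtain ⟨B, Z, hB, hZ, i, a, w, hT⟩ := t.exists_triangle Y (-1) 0 (by lia)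
  rw [t.le_iff_isLE] at hB
  rw [t.ge_iff_isGE] at hZ
  obtain ⟨-, hZP⟩ := boundedWith_of_truncation P hT (-1) 0 (by lia) hB hZ hY
  -- Truncating `Z` to degrees `≤ 0` leaves only the cohomology in degree `0`. Maps from degree `0`
  -- to `C` and `C⟦-1⟧` vanish, so composition with `b` is bijective.
  obtain ⟨B', C, hB', hC, b, c, w', hT'⟩ := t.exists_triangle Z 0 1 (by lia)
  rw [t.le_iff_isLE] at hB'
  rw [t.ge_iff_isGE] at hC
  obtain ⟨hBP, -⟩ := boundedWith_of_truncation P hT' 0 1 (by lia) hB' hC hZP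
  have hC' := t.isGE_shift C 1 (-1) 2
  have hC'' : t.IsGE (C⟦(-1 : ℤ)⟧) 0 := t.isGE_of_ge _ 0 2
  have hB0 : t.IsGE B' 0 := t.isGE₂ _ (inv_rot_of_distTriang _ hT') 0 hC'' hZ
  obtain ⟨X, ⟨e⟩⟩ := exists_iso_singleFunctor_obj_of_isGE_of_isLE B' 0
  refine ⟨X, prop_of_boundedWith_single P 0 ((boundedWith P).prop_of_iso e hBP), Z, a, e.inv ≫ b,
    fun F _ => ⟨⟨fun f g hfg => ?_, fun f => ?_⟩, ⟨fun f g hfg => ?_, fun f => ?_⟩⟩⟩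
  · obtain ⟨q, hq⟩ := distTriang_exists_lift₂ hT (f - g)
      (by rw [Preadditive.sub_comp, sub_eq_zero]; exact hfg)
    rw [← sub_eq_zero, hq, single_hom_eq_zero_of_isLE (-1) (by lia) q, zero_comp]
  · have := t.isLE_shift B (-1) 1 (-2)
    obtain ⟨g, rfl⟩ := distTriang_exists_lift₃ hT f
      (single_hom_eq_zero_of_isLE (-2) (by lia) _)
    exact ⟨g, rfl⟩
  · apply (singleFunctor A 0).map_injective
    have h0 : ((singleFunctor A 0).map (f - g) ≫ e.inv) ≫ b = 0 := by
      rw [Functor.map_sub, Category.assoc, Preadditive.sub_comp, sub_eq_zero]; exact hfg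
    obtain ⟨q, hq⟩ := Triangle.coyoneda_exact₂ _ (inv_rot_of_distTriang _ hT') _ h0
    rw [← sub_eq_zero, ← Functor.map_sub, ← cancel_mono e.inv, zero_comp]
    refine hq.trans ?_
    rw [t.zero (Y := C⟦(-1 : ℤ)⟧) q 0 2]
    exact zero_comp
  · obtain ⟨g, rfl⟩ := distTriang_exists_lift₂ hT' f (t.zero _ 0 1)
    obtain ⟨f, hf⟩ := (singleFunctor A 0).map_surjective (g ≫ e.hom)
    exact ⟨f, by simp [hf]⟩

end Derived

end

/-! ### Bounded derived categories with cohomology in a Serre class -/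

section

open Pretriangulated Triangulated ZeroObject

/-- Fullness lifts each factorization, and faithfulness identifies the lifted sum with `f`. -/
lemma map_mem_factorsThrough_iff {C D : Type*} [Category* C] [Category* D] [Preadditive C]
    [Preadditive D] (F : C ⥤ D) [F.Additive] [F.Full] [F.Faithful] {τ : Type*} (E : τ → C) {X Y : C}
    (f : X ⟶ Y) : F.map f ∈ factorsThrough (fun t => F.obj (E t)) (F.obj X) (F.obj Y) ↔
      f ∈ factorsThrough E X Y := by
  constructor
  · intro h
    have key : ∀ y ∈ factorsThrough (fun t => F.obj (E t)) (F.obj X) (F.obj Y),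
        ∃ g ∈ factorsThrough E X Y, F.map g = y := fun y hy => by
      induction hy using AddSubgroup.closure_induction with
      | mem y hy =>
        obtain ⟨t, g, x, rfl⟩ := hy
        obtain ⟨g, rfl⟩ := F.map_surjective g
        obtain ⟨x, rfl⟩ := F.map_surjective x
        exact ⟨g ≫ x, AddSubgroup.subset_closure ⟨t, g, x, rfl⟩, F.map_comp g x⟩
      | zero => exact ⟨0, zero_mem _, F.map_zero _ _⟩
      | add y y' _ _ hy hy' =>
        obtain ⟨g, hg, rfl⟩ := hy
        obtain ⟨g', hg', rfl⟩ := hy'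
        exact ⟨g + g', add_mem hg hg', F.map_add⟩
      | neg y _ hy =>
        obtain ⟨g, hg, rfl⟩ := hy
        exact ⟨-g, neg_mem hg, F.map_neg⟩
    obtain ⟨g, hg, hgf⟩ := key _ h
    exact F.map_injective hgf ▸ hg
  · intro h
    induction h using AddSubgroup.closure_induction with
    | mem f hf =>
      obtain ⟨t, g, x, rfl⟩ := hf
      exact AddSubgroup.subset_closure ⟨t, F.map g, F.map x, F.map_comp g x⟩
    | zero => rw [F.map_zero]; exact zero_mem _
    | add f g _ _ hf hg => rw [F.map_add]; exact add_mem hf hg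
    | neg f _ hf => rw [F.map_neg]; exact neg_mem hf

lemma projective_biproduct {C : Type*} [Category* C] [Preadditive C] {ι : Type*} {g : ι → C}
    [HasBiproduct g] (h : ∀ i, Projective (g i)) : Projective (⨁ g) where
  factors f e _ :=
    ⟨biproduct.desc fun i => Projective.factorThru (biproduct.ι g i ≫ f) e, by ext; simp⟩

section Derived

variable {A : Type*} [Category* A] [Abelian A] (P : ObjectProperty A) [P.IsSerreClass]

attribute [local instance] Abelian.hasFiniteBiproducts

instance : P.IsClosedUnderBinaryProducts where
  limitsOfShape_le := by
    rintro X ⟨p⟩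
    have e := IsLimit.conePointUniqueUpToIso (prodIsProd _ _)
      ((IsLimit.postcomposeHomEquiv (diagramIsoPair p.diag) _).2 p.isLimit)
    exact P.prop_of_iso ((biprod.isoProd _ _) ≪≫ e) (P.prop_X₂_of_shortExact
      (ShortComplex.Splitting.ofHasBinaryBiproduct _ _).shortExact
      (p.prop_diag_obj (.mk .left)) (p.prop_diag_obj (.mk .right)))

instance : P.IsClosedUnderFiniteProducts := .mk'

open DerivedCategory DerivedCategory.TStructure

instance : (stalk P).Full := by unfold stalk; infer_instance

instance : (stalk P).Faithful := by unfold stalk; infer_instance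

instance : (stalk P).Additive where
  map_add {X Y f g} := by
    apply (boundedWith P).ι.map_injective
    exact (P.ι ⋙ singleFunctor A 0).map_add (f := f) (g := g)

instance {k : Type*} [Field k] [Linear k A] : (stalk P).Linear k where
  map_smul {X Y} f r := by
    apply (boundedWith P).ι.map_injective
    exact CategoryTheory.Functor.map_smul (P.ι ⋙ singleFunctor A 0) r f

variable {P}

/-- Induction on the cohomological amplitude: truncation splits off the top cohomology, which is a
shifted stalk complex. -/
lemma prop_of_stalk (W : ObjectProperty (boundedWith P).FullSubcategory) [W.IsTriangulated]
    [W.IsClosedUnderIsomorphisms] (hW : ∀ X, W ((stalk P).obj X))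
    (Y : (boundedWith P).FullSubcategory) : W Y := by
  -- The number `n` bounds the length of the interval from `a` to `b`; for `n = 0` the interval is
  -- empty and `Y` is zero.
  suffices H : ∀ (n : ℕ) (a b : ℤ) (_ : b < a + n) (Y : (boundedWith P).FullSubcategory)
      (_ : t.IsGE Y.obj a) (_ : t.IsLE Y.obj b), W Y by
    obtain ⟨⟨a, ha⟩, ⟨b, hb⟩⟩ := Y.2.1
    exact H (b + 1 - a).toNat a b (by lia) Y ha hb
  intro n
  induction n with
  | zero =>
    intro a b hab Y _ _
    have h0 := t.isZero Y.obj b a (by simpa using hab)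
    refine W.prop_of_isZero ?_
    rw [IsZero.iff_id_eq_zero]
    apply (boundedWith P).ι.map_injective
    exact h0.eq_of_src _ _
  | succ n ih =>
    intro a b hab Y hYa hYb
    obtain ⟨B, C, hB, hC, f, g, h, hT⟩ := t.exists_triangle Y.obj (b - 1) b (by lia)
    rw [t.le_iff_isLE] at hB
    rw [t.ge_iff_isGE] at hC
    obtain ⟨hBP, hCP⟩ := boundedWith_of_truncation P hT (b - 1) b (by lia) hB hC Y.2
    obtain ⟨f', g', h', hT', -, -⟩ := exists_distTriang_fullSubcategory (boundedWith P)
      (X := ⟨B, hBP⟩) (Z := ⟨C, hCP⟩) f g h hT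
    by_cases hba : b < a
    · exact ih a b (by lia) Y hYa hYb
    refine W.ext_of_isTriangulatedClosed₂ _ hT' ?_ ?_
    -- `B` lies between `C⟦-1⟧` and `Y`, so the lower bound `a` survives the truncation; in the
    -- second case `C` lies between `Y` and `B⟦1⟧`, so it is concentrated in degree `b`.
    · have hC' := t.isGE_shift C b (-1) (b + 1)
      have hC'' : t.IsGE (C⟦(-1 : ℤ)⟧) a := t.isGE_of_ge _ a (b + 1)
      have hBa : t.IsGE B a := t.isGE₂ _ (inv_rot_of_distTriang _ hT) a hC'' hYa
      exact ih a (b - 1) (by lia) ⟨B, hBP⟩ hBa hB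
    · have hB' := t.isLE_shift B (b - 1) 1 (b - 2)
      have hB'' : t.IsLE (B⟦(1 : ℤ)⟧) b := t.isLE_of_le _ (b - 2) b
      have hCb : t.IsLE C b := t.isLE₂ _ (rot_of_distTriang _ hT) b hYb hB''
      obtain ⟨X, ⟨e⟩⟩ := exists_iso_singleFunctor_obj_of_isGE_of_isLE C b
      have hX := prop_of_boundedWith_single P b ((boundedWith P).prop_of_iso e hCP)
      have e' : C ≅ ((singleFunctor A 0).obj X)⟦-b⟧ :=
        e ≪≫ (((singleFunctors A).shiftIso (-b) b 0 (by lia)).app X).symm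
      exact W.prop_of_iso ((boundedWith P).ι.preimageIso
        (X := ((stalk P).obj ⟨X, hX⟩)⟦-b⟧) (Y := ⟨C, hCP⟩)
        (((boundedWith P).ι.commShiftIso (-b)).app _ ≪≫ e'.symm)) (W.le_shift (-b) _ (hW ⟨X, hX⟩))

/-- Induction along syzygies: `X` is the cone of the inclusion of the kernel of a projective cover
in `W`. A projective `X` splits off its cover. -/
lemma prop_stalk_of_hasProjectiveDimensionLT (W : ObjectProperty (boundedWith P).FullSubcategory)
    [W.IsTriangulated] [W.IsStableUnderRetracts]
    (hW : ∀ X : P.FullSubcategory, ∃ (F : P.FullSubcategory) (p : F ⟶ X), Projective F.obj ∧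
      Epi p.hom ∧ W ((stalk P).obj F)) (n : ℕ) (X : P.FullSubcategory)
    [HasProjectiveDimensionLT X.obj (n + 1)] : W ((stalk P).obj X) := by
  induction n generalizing X with
  | zero =>
    obtain ⟨F, p, hF, hp, hWF⟩ := hW X
    have : Projective X.obj := projective_iff_hasProjectiveDimensionLT_one.2 (by assumption)
    refine W.prop_of_retract (Retract.map ⟨P.homMk (Projective.factorThru (𝟙 X.obj) p.hom), p, ?_⟩
      (stalk P)) hWF
    ext
    exact Projective.factorThru_comp (𝟙 X.obj) p.hom
  | succ n ih =>
    obtain ⟨F, p, hF, hp, hWF⟩ := hW X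
    let S : ShortComplex A := ShortComplex.mk (kernel.ι p.hom) p.hom (kernel.condition p.hom)
    have hS : S.ShortExact :=
      { exact := ShortComplex.exact_of_f_is_kernel _ (kernelIsKernel p.hom) }
    have hK : P (kernel p.hom) := P.prop_of_mono (kernel.ι p.hom) F.2
    have : HasProjectiveDimensionLT (kernel p.hom) (n + 1) :=
      hS.hasProjectiveDimensionLT_X₁ (n + 1)
        (hasProjectiveDimensionLT_of_ge F.obj 1 (n + 1) (by lia)) (by assumption)
    obtain ⟨f', g', h', hT', -, -⟩ := exists_distTriang_fullSubcategory (boundedWith P)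
      (X := (stalk P).obj ⟨_, hK⟩) (Y := (stalk P).obj F) (Z := (stalk P).obj X) _ _ _
      hS.singleTriangle_distinguished
    exact W.ext_of_isTriangulatedClosed₃ _ hT' (ih ⟨_, hK⟩) hWF

lemma prop_stalk_biproduct (W : ObjectProperty (boundedWith P).FullSubcategory)
    [W.IsTriangulated] [W.IsClosedUnderIsomorphisms] {n : ℕ} (G : Fin n → P.FullSubcategory)
    (hG : ∀ i, W ((stalk P).obj (G i))) :
    ∃ h : P (⨁ fun i => (G i).obj), W ((stalk P).obj ⟨_, h⟩) := by
  have h : P (⨁ fun i => (G i).obj) :=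
    P.prop_of_iso (biproduct.isoProduct _).symm (P.prop_pi _ fun i => (G i).2)
  refine ⟨h, W.prop_of_iso (?_ : (⨁ fun i => (stalk P).obj (G i)) ≅ _)
    (W.prop_of_iso (biproduct.isoProduct _).symm (W.prop_pi _ hG))⟩
  exact (boundedWith P).ι.preimageIso ((boundedWith P).ι.mapBiproduct _ ≪≫
    ((singleFunctor A 0).mapBiproduct fun i => (G i).obj).symm)

variable {τ σ : Type*} (k : Type*) [Field k] [Linear k A]

/-- Conditions on families `E` and `G` of projective objects in a Serre class `P`, under which the
quotient of the bounded derived category by the thick subcategory generated by `E` is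
controlled by the objects `G`. -/
structure IsQuotientSetting (E : τ → P.FullSubcategory) (G : σ → P.FullSubcategory) : Prop where
  projective_E : ∀ t, Projective (E t).obj
  projective_G : ∀ s, Projective (G s).obj
  exists_epi : ∀ X, P X → ∃ (n : ℕ) (s : Fin n → σ) (x : ∀ i, (G (s i)).obj ⟶ X),
    Epi (biproduct.desc x)
  exists_precover : ∀ X, P X → ∃ (n : ℕ) (t : Fin n → τ) (x : ∀ i, (E (t i)).obj ⟶ X),
    ∀ t' (f : (E t').obj ⟶ X), ∃ g : ∀ i, (E t').obj ⟶ (E (t i)).obj, f = ∑ i, g i ≫ x i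
  finite_hom : ∀ X, P X → (∀ t (f : (E t).obj ⟶ X), f = 0) →
    ∀ s, Module.Finite k ((G s).obj ⟶ X)
  finite_projectiveDimension : ∀ X, P X → ∃ n, HasProjectiveDimensionLT X n

namespace IsQuotientSetting

variable {k} {E : τ → P.FullSubcategory} {G : σ → P.FullSubcategory}

lemma stalk_hom_shift_eq_zero {X Y : P.FullSubcategory} (hX : Projective X.obj) {a : ℤ}
    (ha : a ≠ 0) (f : (stalk P).obj X ⟶ ((stalk P).obj Y)⟦a⟧) : f = 0 := by
  apply (boundedWith P).ι.map_injective
  rw [← cancel_mono (((boundedWith P).ι.commShiftIso a).hom.app _), Functor.map_zero, zero_comp]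
  exact @single_hom_shift_eq_zero _ _ _ X.obj Y.obj hX a ha _

/-- Maps from `E t` to `Y` are maps to the degree `0` cohomology, naturally in `E t`, so a precover
of that object transports along the zigzag. -/
lemma exists_precover_stalk (H : IsQuotientSetting k E G)
    (Y : (boundedWith P).FullSubcategory) :
    ∃ (n : ℕ) (t : Fin n → τ) (x : ∀ i, (stalk P).obj (E (t i)) ⟶ Y),
      ∀ t' (f : (stalk P).obj (E t') ⟶ Y),
        ∃ g : ∀ i, (stalk P).obj (E t') ⟶ (stalk P).obj (E (t i)), f = ∑ i, g i ≫ x i := by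
  obtain ⟨X, hX, Z, a, b, hab⟩ := exists_single_zigzag P Y.2
  obtain ⟨n, t, x, hx⟩ := H.exists_precover X hX
  have := H.projective_E
  choose y hy using fun i => (hab (E (t i)).obj).1.2 ((singleFunctor A 0).map (x i) ≫ b)
  refine ⟨n, t, fun i => (boundedWith P).homMk (y i), fun t' f => ?_⟩
  obtain ⟨f', hf'⟩ := (hab (E t').obj).2.2 (f.hom ≫ a)
  obtain ⟨g, hg⟩ := hx t' f'
  refine ⟨fun i => (stalk P).map (P.homMk (g i)), ?_⟩
  apply (boundedWith P).ι.map_injective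
  apply (hab (E t').obj).1.1
  dsimp only at hy hf' ⊢
  refine hf'.symm.trans ?_
  rw [hg, Functor.map_sum, Functor.map_sum, Preadditive.sum_comp]
  refine Eq.trans ?_ (Preadditive.sum_comp _ _ _).symm
  refine Finset.sum_congr rfl fun i _ => ?_
  rw [Functor.map_comp, Category.assoc, ← hy i]
  exact (Category.assoc _ _ _).symm

lemma finite_hom_stalk (H : IsQuotientSetting k E G) (Y : (boundedWith P).FullSubcategory)
    (hY : ∀ t (f : (stalk P).obj (E t) ⟶ Y), f = 0) (s : σ) :
    Module.Finite k ((stalk P).obj (G s) ⟶ Y) := by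
  obtain ⟨X, hX, Z, a, b, hab⟩ := exists_single_zigzag P Y.2
  have := H.projective_E
  have := H.projective_G
  have : Module.Finite k (P.ι.obj (G s) ⟶ X) := H.finite_hom X hX (fun t f => by
    obtain ⟨g, hg⟩ := (hab (E t).obj).1.2 ((singleFunctor A 0).map f ≫ b)
    have h0 : g = 0 := congrArg (fun q => q.hom) (hY t ((boundedWith P).homMk g))
    apply (hab (E t).obj).2.1
    simp only [← hg, h0, Functor.map_zero, zero_comp]) s
  have : Module.Finite k ((boundedWith P).ι.obj ((stalk P).obj (G s)) ⟶ Z) :=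
    Module.Finite.of_surjective (Linear.rightComp k _ b ∘ₗ (singleFunctor A 0).mapLinearMap k)
      (hab (G s).obj).2.2
  exact Module.Finite.of_injective (Linear.rightComp k _ a ∘ₗ
    (boundedWith P).ι.mapLinearMap k (X := (stalk P).obj (G s)) (Y := Y))
    ((hab (G s).obj).1.1.comp (boundedWith P).ι.map_injective)

/-- Finite sums of the `G s` cover every object of `P`. Finite projective dimension then yields all
stalks, and truncation yields all bounded complexes. -/
lemma triangEnvelope_stalk (H : IsQuotientSetting k E G) [Nonempty σ]
    (Y : (boundedWith P).FullSubcategory) :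
    (ObjectProperty.ofObj fun s => (stalk P).obj (G s)).triangEnvelope Y := by
  have : (ObjectProperty.ofObj fun s => (stalk P).obj (G s)).Nonempty :=
    ⟨_, ⟨Classical.arbitrary σ⟩⟩
  refine prop_of_stalk _ (fun X => ?_) Y
  obtain ⟨n, hn⟩ := H.finite_projectiveDimension X.obj X.2
  have := hasProjectiveDimensionLT_of_ge X.obj n (n + 1) (by lia)
  refine prop_stalk_of_hasProjectiveDimensionLT _ (fun X => ?_) n X
  obtain ⟨m, s, x, hx⟩ := H.exists_epi X.obj X.2
  obtain ⟨hP, hW⟩ := prop_stalk_biproduct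
    (ObjectProperty.ofObj fun s => (stalk P).obj (G s)).triangEnvelope (fun i => G (s i))
    fun i => ObjectProperty.le_triangEnvelope _ _ ⟨s i⟩
  exact ⟨⟨_, hP⟩, P.homMk (biproduct.desc x),
    projective_biproduct fun i => H.projective_G (s i), hx, hW⟩

theorem homFinite (H : IsQuotientSetting k E G)
    (S : ObjectProperty (boundedWith P).FullSubcategory) [S.Nonempty]
    (hS : ∀ X, S X ↔ ∃ t, X = (stalk P).obj (E t)) [Nonempty σ] : HomFinite k (VerdierQuotient S) :=
  homFinite_verdierQuotient (E := fun t => (stalk P).obj (E t)) (G := fun s => (stalk P).obj (G s))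
    S hS (fun _ ha _ _ f => stalk_hom_shift_eq_zero (H.projective_E _) ha f)
    (fun _ ha _ _ f => stalk_hom_shift_eq_zero (H.projective_G _) ha f)
    (fun _ ha _ _ f => stalk_hom_shift_eq_zero (H.projective_E _) ha f)
    H.exists_precover_stalk H.finite_hom_stalk H.triangEnvelope_stalk

theorem map_surjective (H : IsQuotientSetting k E G)
    (S : ObjectProperty (boundedWith P).FullSubcategory) [S.Nonempty]
    (hS : ∀ X, S X ↔ ∃ t, X = (stalk P).obj (E t)) (s s' : σ) : Function.Surjective
    (fun f : G s ⟶ G s' => (toVerdierQuotient S).map ((stalk P).map f)) :=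
  (toVerdierQuotient_map_surjective (E := fun t => (stalk P).obj (E t))
    (G := fun s => (stalk P).obj (G s)) S hS
    (fun _ ha _ _ f => stalk_hom_shift_eq_zero (H.projective_E _) ha f)
    (fun _ ha _ _ f => stalk_hom_shift_eq_zero (H.projective_G _) ha f)
    (fun _ ha _ _ f => stalk_hom_shift_eq_zero (H.projective_E _) ha f)
    H.exists_precover_stalk s s').comp (stalk P).map_surjective

theorem map_eq_zero_iff (H : IsQuotientSetting k E G)
    (S : ObjectProperty (boundedWith P).FullSubcategory) [S.Nonempty]
    (hS : ∀ X, S X ↔ ∃ t, X = (stalk P).obj (E t)) {s s' : σ} (f : G s ⟶ G s') :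
    (toVerdierQuotient S).map ((stalk P).map f) = 0 ↔ f ∈ factorsThrough E (G s) (G s') :=
  (toVerdierQuotient_map_eq_zero_iff (E := fun t => (stalk P).obj (E t))
    (G := fun s => (stalk P).obj (G s)) S hS
    (fun _ ha _ _ f => stalk_hom_shift_eq_zero (H.projective_E _) ha f)
    (fun _ ha _ _ f => stalk_hom_shift_eq_zero (H.projective_G _) ha f)
    (fun _ ha _ _ f => stalk_hom_shift_eq_zero (H.projective_E _) ha f)
    H.exists_precover_stalk ((stalk P).map f)).trans (map_mem_factorsThrough_iff (stalk P) E f)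

end IsQuotientSetting

end Derived

end

/-! ### The two-sided ideal of an idempotent -/

section TwoSided

variable {Λ : Type u} [Ring Λ] {e : Λ}

lemma twoSided_induction {p : Λ → Prop} (zero : p 0) (add : ∀ x y, p x → p y → p (x + y))
    (mul : ∀ b c, p (b * e * c)) {a : Λ} (ha : a ∈ twoSided e) : p a := by
  -- Strengthened so that the hypothesis is stable under multiplication on both sides.
  have key : ∀ b c, p (b * a * c) := by
    replace ha := TwoSidedIdeal.mem_asIdeal.1 ha
    induction ha using TwoSidedIdeal.span_induction with
    | mem x hx => obtain rfl := hx; exact mul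
    | zero => simpa using zero
    | add x y _ _ hx hy =>
      exact fun b c => by rw [mul_add, add_mul]; exact add _ _ (hx b c) (hy b c)
    | neg x _ hx => exact fun b c => by simpa using hx (-b) c
    | left_absorb a x _ hx => exact fun b c => by simpa [mul_assoc] using hx (b * a) c
    | right_absorb a x _ hx => exact fun b c => by simpa [mul_assoc] using hx b (a * c)
  simpa using key 1 1

lemma mem_twoSided_self : e ∈ twoSided e :=
  TwoSidedIdeal.mem_asIdeal.2 (TwoSidedIdeal.subset_span rfl)

lemma mul_mem_twoSided (b c : Λ) : b * e * c ∈ twoSided e :=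
  Ideal.mul_mem_right _ _ (Ideal.mul_mem_left _ _ mem_twoSided_self)

lemma smul_eq_zero_of_mem_twoSided {X : Type*} [AddCommGroup X] [Module Λ X]
    (h : ∀ x : X, e • x = 0) {a : Λ} (ha : a ∈ twoSided e) (x : X) : a • x = 0 := by
  refine twoSided_induction (p := fun a => a • x = 0) (zero_smul _ _) (fun a b ha hb => ?_)
    (fun b c => ?_) ha
  · rw [add_smul, ha, hb, add_zero]
  · rw [mul_smul, mul_smul, h, smul_zero]

end TwoSided

/-! ### The quotient for ungraded modules -/

section Modules

variable {Λ : Type u} [Ring Λ]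

lemma mul_eq_of_mem_span {e : Λ} (he : e * e = e) {z : Λ} (hz : z ∈ Ideal.span {e}) :
    z * e = z := by
  obtain ⟨b, rfl⟩ := Ideal.mem_span_singleton'.1 hz
  rw [mul_assoc, he]

lemma projective_span_singleton {e : Λ} (he : e * e = e) :
    Module.Projective Λ (Ideal.span {e} : Ideal Λ) :=
  .of_split (Ideal.span {e}).subtype
    ((LinearMap.toSpanSingleton Λ Λ e).codRestrict _ fun x =>
      Ideal.mul_mem_left _ x (Ideal.mem_span_singleton_self e))
    (by ext z; exact mul_eq_of_mem_span he z.2)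

variable [IsNoetherianRing Λ]

variable (Λ) in
/-- The left module `Λ`, as a finitely generated module. -/
abbrev regularFG : (ModuleCat.isFG.{u} Λ).FullSubcategory :=
  ⟨.of Λ Λ, (inferInstance : Module.Finite Λ Λ)⟩

/-- The left module `Λe`, as a finitely generated module. -/
abbrev leftIdealFG (e : Λ) : (ModuleCat.isFG.{u} Λ).FullSubcategory :=
  ⟨.of Λ (Ideal.span {e} : Ideal Λ), (inferInstance : Module.Finite Λ (Ideal.span {e}))⟩

lemma exists_precover_leftIdeal {e : Λ} (he : e * e = e) (X : Type u) [AddCommGroup X] [Module Λ X]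
    [Module.Finite Λ X] : ∃ (n : ℕ) (x : Fin n → (Ideal.span {e} : Ideal Λ) →ₗ[Λ] X),
      ∀ f : (Ideal.span {e} : Ideal Λ) →ₗ[Λ] X,
        ∃ g : Fin n → (Ideal.span {e} : Ideal Λ) →ₗ[Λ] (Ideal.span {e} : Ideal Λ),
          f = ∑ i, x i ∘ₗ g i := by
  -- Maps from `Λe` to `X` correspond to elements of `eX`. The submodule generated by `eX` is
  -- finitely generated because `Λ` is noetherian, and its generators can be chosen in `eX`, so that
  -- each one is such a map.
  obtain ⟨t, htT, ht⟩ := (Submodule.fg_span_iff_fg_span_finset_subset (R := Λ)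
    (Set.range fun x : X => e • x)).1 (IsNoetherian.noetherian _)
  let y : Fin t.card → X := fun i => t.equivFin.symm i
  have hy : ∀ i, e • y i = y i := fun i => by
    obtain ⟨z, hz⟩ := htT (t.equivFin.symm i).2
    dsimp only [y]
    rw [← hz, smul_smul, he]
  have hr : Set.range y = t := by
    ext z
    exact ⟨by rintro ⟨i, rfl⟩; exact (t.equivFin.symm i).2,
      fun hz => ⟨t.equivFin ⟨z, hz⟩, by simp [y]⟩⟩
  refine ⟨t.card, fun i => LinearMap.toSpanSingleton Λ X (y i) ∘ₗ (Ideal.span {e}).subtype,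
    fun f => ?_⟩
  let e' : (Ideal.span {e} : Ideal Λ) := ⟨e, Ideal.mem_span_singleton_self e⟩
  have hf : f e' ∈ Submodule.span Λ (Set.range y) := by
    rw [hr, ← ht]
    refine Submodule.subset_span ⟨f e', ?_⟩
    exact (map_smul f e e').symm.trans (congrArg f (Subtype.ext he))
  obtain ⟨a, ha⟩ := (Submodule.mem_span_range_iff_exists_fun Λ).1 hf
  -- Replacing `a i` by `a i * e` gives a map into `Λe`; nothing changes on `y i`, which is fixed by
  -- `e`.
  refine ⟨fun i => (LinearMap.toSpanSingleton Λ Λ (a i * e) ∘ₗ (Ideal.span {e}).subtype).codRestrict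
    _ fun z => Ideal.mul_mem_left _ _ (Ideal.mul_mem_left _ _ (Ideal.mem_span_singleton_self e)),
    ?_⟩
  ext z
  have hz : f z = (z : Λ) • f e' := by
    rw [← map_smul]
    exact congrArg f (Subtype.ext (mul_eq_of_mem_span he z.2).symm)
  rw [hz, ← ha, LinearMap.sum_apply, Finset.smul_sum]
  refine Finset.sum_congr rfl fun i _ => ?_
  change _ = ((z : Λ) * (a i * e)) • y i
  rw [mul_smul, mul_smul, hy]

variable {k : Type u} [Field k] [Algebra k Λ]

-- A module killed by `e` is a module over `Λ/ΛeΛ`. With generators `x i`, it is spanned over `k` by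
-- the finite-dimensional spaces `F · x i`.
open scoped ModuleCat in
lemma finite_hom_of_smul_eq_zero {e : Λ} (hfin : ∃ F : Submodule k Λ, Module.Finite k F ∧
    ∀ a, ∃ f ∈ F, a - f ∈ twoSided e) (X : ModuleCat.{u} Λ) [Module.Finite Λ X]
    (hX : ∀ x : X, e • x = 0) : Module.Finite k (ModuleCat.of Λ Λ ⟶ X) := by
  obtain ⟨F, hF, h⟩ := hfin
  obtain ⟨n, x, hx⟩ := Module.Finite.exists_fin (R := Λ) (M := X)
  let Φ : (Fin n → F) →ₗ[k] (ModuleCat.of Λ Λ ⟶ X) :=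
    { toFun := fun c => ModuleCat.ofHom (LinearMap.toSpanSingleton Λ X (∑ i, (c i : Λ) • x i))
      map_add' := fun c c' => by
        ext
        simp [add_smul, Finset.sum_add_distrib]
      map_smul' := fun r c => by
        ext
        simp only [ModuleCat.hom_ofHom, LinearMap.toSpanSingleton_apply, one_smul, RingHom.id_apply,
          Pi.smul_apply, Submodule.coe_smul]
        exact (Finset.sum_congr rfl fun i _ => smul_assoc r (c i : Λ) (x i)).trans
          (Finset.smul_sum.symm.trans
            (congrArg (fun z : X => r • z) (one_smul Λ (∑ i, (c i : Λ) • x i)).symm)) }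
  refine Module.Finite.of_surjective Φ fun f => ?_
  have hf : f.hom 1 ∈ Submodule.span Λ (Set.range x) := hx ▸ trivial
  obtain ⟨a, ha⟩ := (Submodule.mem_span_range_iff_exists_fun Λ).1 hf
  choose b hb hab using fun i => h (a i)
  refine ⟨fun i => ⟨b i, hb i⟩, ?_⟩
  ext
  refine Eq.trans ?_ ha
  refine (one_smul _ _).trans (Finset.sum_congr rfl fun i _ => ?_)
  rw [eq_comm, ← sub_eq_zero, ← sub_smul]
  exact smul_eq_zero_of_mem_twoSided hX (hab i) _

variable (k) in
lemma isQuotientSetting_module {e : Λ} (he : e * e = e) (hfin : ∃ F : Submodule k Λ,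
    Module.Finite k F ∧ ∀ a, ∃ f ∈ F, a - f ∈ twoSided e) (hΛ : HasFiniteGlobalDimension Λ) :
    IsQuotientSetting k (fun _ : Unit => leftIdealFG e) (fun _ : Unit => regularFG Λ) where
  projective_E _ := (IsProjective.iff_projective _).1 (projective_span_singleton he)
  projective_G _ := (IsProjective.iff_projective _).1 (inferInstance : Module.Projective Λ Λ)
  exists_epi X (hX : Module.Finite Λ X) := by
    obtain ⟨n, x, hx⟩ := Module.Finite.exists_fin (R := Λ) (M := X)
    refine ⟨n, fun _ => (), fun i => ModuleCat.ofHom (LinearMap.toSpanSingleton Λ X (x i)), ?_⟩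
    refine Preadditive.epi_of_cancel_zero _ fun g hg => ?_
    ext : 1
    refine LinearMap.ext_on hx ?_
    rintro _ ⟨i, rfl⟩
    have h : ModuleCat.ofHom (LinearMap.toSpanSingleton Λ X (x i)) ≫ g = 0 := by
      rw [← biproduct.ι_desc (fun i => ModuleCat.ofHom (LinearMap.toSpanSingleton Λ X (x i))) i,
        Category.assoc]
      exact (congrArg (fun q => biproduct.ι (fun _ => ModuleCat.of Λ Λ) i ≫ q) hg).trans comp_zero
    have h1 : g.hom ((1 : Λ) • x i) = 0 := congrArg (fun q => q.hom (1 : Λ)) h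
    rwa [one_smul] at h1
  exists_precover X (hX : Module.Finite Λ X) := by
    obtain ⟨n, x, hx⟩ := exists_precover_leftIdeal he X
    refine ⟨n, fun _ => (), fun i => ModuleCat.ofHom (x i), fun _ f => ?_⟩
    obtain ⟨g, hg⟩ := hx f.hom
    refine ⟨fun i => ModuleCat.ofHom (g i), ?_⟩
    ext : 1
    exact hg.trans (ModuleCat.hom_sum (fun i => ModuleCat.ofHom (g i) ≫ ModuleCat.ofHom (x i))
      Finset.univ).symm
  finite_hom X (hX : Module.Finite Λ X) h _ := by
    refine finite_hom_of_smul_eq_zero hfin X fun x => ?_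
    -- The map `z ↦ zx` from `Λe` vanishes; at `z = e` this reads `ex = 0`.
    have := h () (ModuleCat.ofHom (LinearMap.toSpanSingleton Λ X x ∘ₗ (Ideal.span {e}).subtype))
    exact congrArg (fun q => q.hom (⟨e, Ideal.mem_span_singleton_self e⟩ : Ideal.span {e})) this
  finite_projectiveDimension X _ := hΛ.imp' (· + 1) fun d h => h X

/-- Right multiplication by `a`, as an endomorphism of the finitely generated module `Λ`. -/
def rightMulFG (a : Λ) : regularFG Λ ⟶ regularFG Λ :=
  ObjectProperty.homMk (ModuleCat.ofHom (LinearMap.toSpanSingleton Λ Λ a))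

lemma rightMulFG_apply_one (f : regularFG Λ ⟶ regularFG Λ) :
    rightMulFG (f.hom.hom (1 : Λ)) = f := by
  apply ObjectProperty.hom_ext
  apply ModuleCat.hom_ext
  refine LinearMap.ext_ring ?_
  exact one_mul _

lemma rightMulFG_ext {f g : regularFG Λ ⟶ regularFG Λ} (h : f.hom.hom (1 : Λ) = g.hom.hom (1 : Λ)) :
    f = g := by
  rw [← rightMulFG_apply_one f, h, rightMulFG_apply_one]

lemma rightMulFG_one_apply (a : Λ) : (rightMulFG a).hom.hom (1 : Λ) = a := one_mul a

lemma rightMulFG_add (a b : Λ) : rightMulFG (a + b) = rightMulFG a + rightMulFG b :=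
  rightMulFG_ext (mul_add (1 : Λ) a b)

lemma rightMulFG_zero : rightMulFG (0 : Λ) = 0 :=
  rightMulFG_ext (mul_zero (1 : Λ))

lemma rightMulFG_smul (r : k) (a : Λ) : rightMulFG (r • a) = r • rightMulFG a := by
  refine rightMulFG_ext ?_
  rw [rightMulFG_one_apply]
  change r • a = algebraMap k Λ r • ((1 : Λ) * a)
  rw [one_mul, algebraMap_smul]

lemma rightMulFG_mul (a b : Λ) : rightMulFG (a * b) = rightMulFG a ≫ rightMulFG b :=
  rightMulFG_ext (mul_assoc (1 : Λ) a b).symm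

lemma rightMulFG_one : rightMulFG (1 : Λ) = 𝟙 _ :=
  rightMulFG_ext (one_mul (1 : Λ))

/-- A map `x` from `Λe` to `Λ` sends `z = ze` to `z * e * x(e)`, so maps through `Λe` are right
multiplications by elements of `ΛeΛ`. Conversely, right multiplication by `b * e * c` factors as `b
* e` followed by `c`. -/
lemma rightMulFG_mem_factorsThrough_iff {e : Λ} (he : e * e = e) (a : Λ) :
    rightMulFG a ∈ factorsThrough (fun _ : Unit => leftIdealFG e) (regularFG Λ) (regularFG Λ) ↔
      a ∈ twoSided e := by
  constructor
  · intro h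
    have key : ∀ f ∈ factorsThrough (fun _ : Unit => leftIdealFG e) (regularFG Λ) (regularFG Λ),
        f.hom.hom (1 : Λ) ∈ twoSided e := fun f hf => by
      induction hf using AddSubgroup.closure_induction with
      | mem f hf =>
        obtain ⟨-, g, x, rfl⟩ := hf
        let x' : (Ideal.span {e} : Ideal Λ) →ₗ[Λ] Λ := x.hom.hom
        let e' : (Ideal.span {e} : Ideal Λ) := ⟨e, Ideal.mem_span_singleton_self e⟩
        have h1 : ∀ z : (Ideal.span {e} : Ideal Λ), x' z ∈ twoSided e := fun z => by
          have h2 : z = ((z : Λ) * e) • e' := Subtype.ext (by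
            change (z : Λ) = z * e * e
            rw [mul_eq_of_mem_span he z.2, mul_eq_of_mem_span he z.2])
          rw [h2, map_smul]
          exact mul_mem_twoSided _ _
        exact h1 (g.hom.hom (1 : Λ))
      | zero => exact zero_mem (twoSided e)
      | add f g _ _ hf hg => exact add_mem hf hg
      | neg f _ hf => exact neg_mem hf
    exact rightMulFG_one_apply a ▸ key _ h
  · intro h
    refine twoSided_induction (p := fun a => rightMulFG a ∈ factorsThrough
        (fun _ : Unit => leftIdealFG e) (regularFG Λ) (regularFG Λ)) ?_ ?_ ?_ h
    · rw [rightMulFG_zero]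
      exact zero_mem _
    · intro x y hx hy
      rw [rightMulFG_add]
      exact add_mem hx hy
    · intro b c
      refine AddSubgroup.subset_closure ⟨(), ObjectProperty.homMk (ModuleCat.ofHom
        ((LinearMap.toSpanSingleton Λ Λ (b * e)).codRestrict (Ideal.span {e}) fun z =>
          Ideal.mul_mem_left _ _ (Ideal.mul_mem_left _ _ (Ideal.mem_span_singleton_self e)))),
        ObjectProperty.homMk (ModuleCat.ofHom
          (LinearMap.toSpanSingleton Λ Λ c ∘ₗ (Ideal.span {e}).subtype)), rightMulFG_ext ?_⟩
      change (1 : Λ) * (b * e * c) = 1 * (b * e) * c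
      simp only [one_mul]

lemma rightMul_add (a b : Λ) : rightMul (a + b) = rightMul a + rightMul b :=
  (congrArg (stalk (ModuleCat.isFG.{u} Λ)).map (rightMulFG_add a b)).trans
    (stalk (ModuleCat.isFG.{u} Λ)).map_add

lemma rightMul_smul (r : k) (a : Λ) : rightMul (r • a) = r • rightMul a :=
  (congrArg (stalk (ModuleCat.isFG.{u} Λ)).map (rightMulFG_smul r a)).trans
    (CategoryTheory.Functor.map_smul (stalk (ModuleCat.isFG.{u} Λ)) r (rightMulFG a))

lemma rightMul_mul (a b : Λ) : rightMul (a * b) = rightMul a ≫ rightMul b :=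
  (congrArg (stalk (ModuleCat.isFG.{u} Λ)).map (rightMulFG_mul a b)).trans
    ((stalk (ModuleCat.isFG.{u} Λ)).map_comp _ _)

lemma rightMul_one : rightMul (1 : Λ) = 𝟙 _ :=
  (congrArg (stalk (ModuleCat.isFG.{u} Λ)).map rightMulFG_one).trans
    ((stalk (ModuleCat.isFG.{u} Λ)).map_id _)

variable (k) in
/-- Right multiplication induces an algebra map to the opposite endomorphism algebra of `Λ` in the
Verdier quotient. -/
def rightMulAlgHom (e : Λ) :
    Λ →ₐ[k] (End ((toDbfQuotient e).obj (regularObj Λ)))ᵐᵒᵖ :=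
  .ofLinearMap
    { toFun := fun a => .op ((toDbfQuotient e).map (rightMul a))
      map_add' := fun a b => by
        rw [rightMul_add, CategoryTheory.Functor.map_add]
        rfl
      map_smul' := fun r a => by
        rw [rightMul_smul, CategoryTheory.Functor.map_smul]
        rfl }
    (by
      change MulOpposite.op ((toDbfQuotient e).map (rightMul (1 : Λ))) = _
      rw [rightMul_one, CategoryTheory.Functor.map_id]
      rfl)
    (fun a b => by
      change MulOpposite.op ((toDbfQuotient e).map (rightMul (a * b))) = _
      rw [rightMul_mul, CategoryTheory.Functor.map_comp]
      rfl)

theorem exists_algEquiv_end {e : Λ} (he : e * e = e) (hfin : ∃ F : Submodule k Λ,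
    Module.Finite k F ∧ ∀ a, ∃ f ∈ F, a - f ∈ twoSided e) (hΛ : HasFiniteGlobalDimension Λ) :
    HomFinite k (DbfQuotient e) ∧
      ∃ φ : (Λ ⧸ twoSided e) ≃ₐ[k] (End ((toDbfQuotient e).obj (regularObj Λ)))ᵐᵒᵖ,
        ∀ a : Λ, φ (Ideal.Quotient.mk _ a) = .op ((toDbfQuotient e).map (rightMul a)) := by
  have H := isQuotientSetting_module k he hfin hΛ
  have hS : ∀ X, ObjectProperty.singleton (leftIdealObj e) X ↔ ∃ _ : Unit,
      X = (stalk (ModuleCat.isFG.{u} Λ)).obj (leftIdealFG e) := fun X => by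
    rw [ObjectProperty.singleton_iff]
    exact ⟨fun h => ⟨(), h.symm⟩, fun ⟨_, h⟩ => h.symm⟩
  refine ⟨H.homFinite _ hS, ?_⟩
  have hsurj := H.map_surjective _ hS () ()
  have hker : ∀ a : Λ, (toDbfQuotient e).map (rightMul a) = 0 ↔ a ∈ twoSided e := fun a =>
    (H.map_eq_zero_iff _ hS (s := ()) (s' := ()) (rightMulFG a)).trans
      (rightMulFG_mem_factorsThrough_iff he a)
  refine ⟨.ofBijective (Ideal.Quotient.liftₐ (twoSided e) (rightMulAlgHom k e) fun a ha => ?_)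
    ⟨?_, ?_⟩, fun a => ?_⟩
  · exact congrArg MulOpposite.op ((hker a).2 ha)
  · rw [injective_iff_map_eq_zero]
    intro x hx
    obtain ⟨a, rfl⟩ := Ideal.Quotient.mk_surjective x
    exact Ideal.Quotient.eq_zero_iff_mem.2 ((hker a).1 (congrArg MulOpposite.unop hx))
  · intro f
    obtain ⟨g, hg⟩ := hsurj f.unop
    refine ⟨Ideal.Quotient.mk _ (g.hom.hom (1 : Λ)), MulOpposite.unop_injective ?_⟩
    refine Eq.trans ?_ hg
    exact congrArg (fun q => (toDbfQuotient e).map ((stalk (ModuleCat.isFG.{u} Λ)).map q))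
      (rightMulFG_apply_one g)
  · rfl

end Modules

/-! ### Graded modules and their underlying modules -/

namespace GrMod

variable {k Λ : Type u} [Field k] [Ring Λ] [Algebra k Λ]
  {𝒜 : ℤ → Submodule k Λ} [GradedAlgebra 𝒜]

section Elements

/-- The map `I(n) → X` that sends `z` to `zy`. -/
def ofElem (I : Ideal Λ) {n j₀ : ℤ} (hn : n + j₀ = 0) {X : GrMod 𝒜} (y : X.X j₀) :
    ofLeftIdeal 𝒜 I n ⟶ X :=
  ofApp (M := ofLeftIdeal 𝒜 I n)
    (fun j =>
      { toFun := fun z => X.act (i := j + n) (by lia) ⟨z.1, z.2.1⟩ y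
        map_add' := fun z z' => by
          rw [← LinearMap.add_apply, ← map_add]
          rfl
        map_smul' := fun r z => by
          rw [RingHom.id_apply, ← LinearMap.smul_apply, ← map_smul]
          rfl })
    fun i j m h a z => by
      dsimp only [LinearMap.coe_mk, AddHom.coe_mk]
      rw [← X.mul_act (i := i) (j := j + n) (l := j₀) (m := j) (n := m) (by lia) h (by lia)]
      refine X.act_congr ?_ _ _ ?_ y
      · lia
      · rfl

lemma ofElem_app (I : Ideal Λ) {n j₀ : ℤ} (hn : n + j₀ = 0) {X : GrMod 𝒜} (y : X.X j₀) (j : ℤ)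
    (z : (ofLeftIdeal 𝒜 I n).X j) :
    app (ofElem I hn y) j z = X.act (i := j + n) (by lia) ⟨z.1, z.2.1⟩ y := rfl

lemma ofElem_comp (I : Ideal Λ) {n j₀ : ℤ} (hn : n + j₀ = 0) {X Y : GrMod 𝒜} (y : X.X j₀)
    (f : X ⟶ Y) : ofElem I hn y ≫ f = ofElem I hn (app f j₀ y) :=
  hom_ext fun j z => by rw [comp_app, ofElem_app, ofElem_app, map_act]

lemma ofElem_sum (I : Ideal Λ) {n j₀ : ℤ} (hn : n + j₀ = 0) {X : GrMod 𝒜} {ι : Type*}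
    (s : Finset ι) (y : ι → X.X j₀) :
    ofElem I hn (∑ i ∈ s, y i) = ∑ i ∈ s, ofElem I hn (y i) :=
  map_sum (AddMonoidHom.mk' (fun y : X.X j₀ => ofElem I hn y) fun y y' =>
    hom_ext fun j z => map_add (X.act (i := j + n) (n := j) (by lia) ⟨z.1, z.2.1⟩) y y') y s

variable {I : Ideal Λ} {e : Λ} (he : e ∈ 𝒜 0) (heI : e ∈ I)

/-- The generator `e` of `I = Λe`, as an element of `I(n)`. -/
def gen {n j₀ : ℤ} (hn : n + j₀ = 0) : (ofLeftIdeal 𝒜 I n).X j₀ :=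
  ⟨e, by rw [add_comm, hn]; exact he, heI⟩

lemma ofElem_app_gen (hI : ∀ z ∈ I, z * e = z) {n j₀ : ℤ} (hn : n + j₀ = 0)
    {X : GrMod 𝒜} (f : ofLeftIdeal 𝒜 I n ⟶ X) :
    ofElem I hn (app f j₀ (gen he heI hn)) = f :=
  hom_ext fun j z => by
    rw [ofElem_app, ← map_act]
    exact congrArg _ (Subtype.ext (hI _ z.2.2))

lemma app_ofElem_gen {n j₀ : ℤ} (hn : n + j₀ = 0) {X : GrMod 𝒜} (y : X.X j₀) :
    app (ofElem I hn y) j₀ (gen he heI hn) = X.act (zero_add j₀) ⟨e, he⟩ y := by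
  rw [ofElem_app]
  refine X.act_congr ?_ _ _ ?_ y
  · lia
  · rfl

lemma act_app_gen (hI : ∀ z ∈ I, z * e = z) {n j₀ : ℤ} (hn : n + j₀ = 0)
    {X : GrMod 𝒜} (f : ofLeftIdeal 𝒜 I n ⟶ X) :
    X.act (zero_add j₀) ⟨e, he⟩ (app f j₀ (gen he heI hn)) = app f j₀ (gen he heI hn) := by
  rw [← map_act]
  exact congrArg _ (Subtype.ext (hI e heI))

lemma hom_ext_gen (hI : ∀ z ∈ I, z * e = z) {n j₀ : ℤ} (hn : n + j₀ = 0)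
    {X : GrMod 𝒜} {f g : ofLeftIdeal 𝒜 I n ⟶ X}
    (h : app f j₀ (gen he heI hn) = app g j₀ (gen he heI hn)) : f = g := by
  rw [← ofElem_app_gen he heI hI hn f, h, ofElem_app_gen he heI hI hn g]

/-- A map from `(Λe)(n)` is determined by the image of the generator in degree `-n`. To lift the
map, one lifts this image, and `ofElem` inserts the factor `e` again. -/
lemma projective_ofLeftIdeal (he : e ∈ 𝒜 0) (heI : e ∈ I) (hI : ∀ z ∈ I, z * e = z)
    (n : ℤ) : Projective (ofLeftIdeal 𝒜 I n) where
  factors {X Y} f p _ := by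
    have hn := add_neg_cancel n
    obtain ⟨y, hy⟩ := surjective_of_epi p (-n) (app f (-n) (gen he heI hn))
    refine ⟨ofElem I hn y, hom_ext_gen he heI hI hn ?_⟩
    rw [comp_app, app_ofElem_gen, map_act, hy, act_app_gen he heI hI]

end Elements

lemma projective_regular (n : ℤ) : Projective (regular 𝒜 n) :=
  projective_ofLeftIdeal SetLike.GradedOne.one_mem Submodule.mem_top (fun _ _ => mul_one _) n

section Total

/-- The underlying module of a graded module. -/
def Total (X : GrMod 𝒜) : Type u := DirectSum ℤ X.X

instance (X : GrMod 𝒜) : AddCommGroup X.Total := inferInstanceAs (AddCommGroup (DirectSum ℤ X.X))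

instance (X : GrMod 𝒜) : Module k X.Total := inferInstanceAs (Module k (DirectSum ℤ X.X))

/-- The inclusion of the part of degree `j`. -/
def of (X : GrMod 𝒜) (j : ℤ) : X.X j →ₗ[k] X.Total := DirectSum.lof k ℤ X.X j

/-- The projection to the part of degree `j`. -/
def comp (X : GrMod 𝒜) (j : ℤ) : X.Total →ₗ[k] X.X j := DirectSum.component k ℤ X.X j

lemma comp_of_self (X : GrMod 𝒜) (j : ℤ) (x : X.X j) : X.comp j (X.of j x) = x :=
  DirectSum.component.lof_self k j x

lemma comp_of_ne (X : GrMod 𝒜) {i j : ℤ} (h : i ≠ j) (x : X.X i) : X.comp j (X.of i x) = 0 :=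
  DirectSum.of_eq_of_ne _ _ _ h.symm

lemma total_induction {X : GrMod 𝒜} {p : X.Total → Prop} (zero : p 0)
    (of : ∀ j x, p (X.of j x)) (add : ∀ x y, p x → p y → p (x + y)) (x : X.Total) : p x :=
  DirectSum.induction_on x zero of add

lemma total_ext {X : GrMod 𝒜} {x y : X.Total} (h : ∀ j, X.comp j x = X.comp j y) : x = y :=
  DFinsupp.ext h

lemma exists_eq_sum (X : GrMod 𝒜) (x : X.Total) :
    ∃ s : Finset ℤ, x = ∑ j ∈ s, X.of j (X.comp j x) := by
  classical
  exact ⟨DFinsupp.support x, (DirectSum.sum_support_of x).symm⟩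

/-- The linear map from the underlying module with given homogeneous parts. -/
def desc (X : GrMod 𝒜) {V : Type*} [AddCommGroup V] [Module k V] (f : ∀ j, X.X j →ₗ[k] V) :
    X.Total →ₗ[k] V :=
  DirectSum.toModule k ℤ V f

lemma desc_of (X : GrMod 𝒜) {V : Type*} [AddCommGroup V] [Module k V] (f : ∀ j, X.X j →ₗ[k] V)
    (j : ℤ) (x : X.X j) : X.desc f (X.of j x) = f j x :=
  DirectSum.toModule_lof k j x

lemma linearMap_ext {X : GrMod 𝒜} {V : Type*} [AddCommGroup V] [Module k V]
    {f g : X.Total →ₗ[k] V} (h : ∀ j x, f (X.of j x) = g (X.of j x)) : f = g :=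
  DirectSum.linearMap_ext k fun j => LinearMap.ext (h j)

/-- The action of a homogeneous element. -/
def homogeneousAct (X : GrMod 𝒜) (i : ℤ) : 𝒜 i →ₗ[k] X.Total →ₗ[k] X.Total where
  toFun a := X.desc fun j => X.of (i + j) ∘ₗ X.act rfl a
  map_add' a b := linearMap_ext fun j x => by simp [desc_of]
  map_smul' r a := linearMap_ext fun j x => by simp [desc_of]

lemma homogeneousAct_of (X : GrMod 𝒜) (i j : ℤ) (a : 𝒜 i) (x : X.X j) :
    X.homogeneousAct i a (X.of j x) = X.of (i + j) (X.act rfl a x) :=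
  X.desc_of _ j x

/-- The action of the algebra, as a linear map. -/
def totalAct (X : GrMod 𝒜) : Λ →ₗ[k] X.Total →ₗ[k] X.Total :=
  DirectSum.toModule k ℤ _ X.homogeneousAct ∘ₗ (DirectSum.decomposeLinearEquiv 𝒜).toLinearMap

lemma totalAct_of (X : GrMod 𝒜) {i j n : ℤ} (h : i + j = n) (a : 𝒜 i) (x : X.X j) :
    X.totalAct a (X.of j x) = X.of n (X.act h a x) := by
  subst h
  simp [totalAct, homogeneousAct_of]

instance (X : GrMod 𝒜) : Module Λ X.Total where
  smul a x := X.totalAct a x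
  one_smul x := by
    change X.totalAct 1 x = x
    refine total_induction (p := fun x => X.totalAct 1 x = x) (map_zero _) (fun j x => ?_)
      (fun x y hx hy => by rw [map_add, hx, hy]) x
    exact (X.totalAct_of (zero_add j) ⟨1, SetLike.GradedOne.one_mem⟩ x).trans
      (congrArg _ (X.one_act x))
  mul_smul a b x := by
    change X.totalAct (a * b) x = X.totalAct a (X.totalAct b x)
    refine total_induction (p := fun x => X.totalAct (a * b) x = X.totalAct a (X.totalAct b x))
      (by simp) (fun l x => ?_) (fun x y hx hy => by simp only [map_add, hx, hy]) x
    induction a using DirectSum.Decomposition.inductionOn 𝒜 with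
    | zero => simp
    | @homogeneous i a =>
      induction b using DirectSum.Decomposition.inductionOn 𝒜 with
      | zero => simp
      | @homogeneous j b =>
        rw [X.totalAct_of (rfl : j + l = j + l), X.totalAct_of (rfl : i + (j + l) = i + (j + l)),
          ← X.mul_act _ _ (by lia)]
        exact X.totalAct_of (by lia) ⟨(a : Λ) * b, SetLike.GradedMul.mul_mem a.2 b.2⟩ x
      | add b b' hb hb' => simp only [mul_add, map_add, LinearMap.add_apply, hb, hb']
    | add a a' ha ha' => simp only [add_mul, map_add, LinearMap.add_apply, ha, ha']
  smul_zero a := map_zero _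
  smul_add a := map_add _
  add_smul a b x := by
    change X.totalAct (a + b) x = X.totalAct a x + X.totalAct b x
    rw [map_add, LinearMap.add_apply]
  zero_smul x := by
    change X.totalAct 0 x = 0
    rw [map_zero, LinearMap.zero_apply]

lemma smul_def (X : GrMod 𝒜) (a : Λ) (x : X.Total) : a • x = X.totalAct a x := rfl

lemma smul_of (X : GrMod 𝒜) {i j n : ℤ} (h : i + j = n) (a : 𝒜 i) (x : X.X j) :
    (a : Λ) • X.of j x = X.of n (X.act h a x) := X.totalAct_of h a x

lemma algebraMap_smul_of (X : GrMod 𝒜) (r : k) (x : X.Total) : algebraMap k Λ r • x = r • x := by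
  rw [Algebra.algebraMap_eq_smul_one, smul_def, map_smul, LinearMap.smul_apply, ← smul_def,
    one_smul]

lemma comp_smul_of (X : GrMod 𝒜) {i j n : ℤ} (h : i + j = n) (a : Λ) (x : X.X j) :
    X.comp n (a • X.of j x) = X.act h (DirectSum.decompose 𝒜 a i) x := by
  induction a using DirectSum.Decomposition.inductionOn 𝒜 with
  | zero => simp
  | @homogeneous i' a =>
    rw [X.smul_of rfl]
    by_cases hi : i' = i
    · subst hi
      subst h
      rw [comp_of_self]
      simp
    · rw [comp_of_ne _ (by lia), DirectSum.decompose_coe, DirectSum.of_eq_of_ne _ _ _ (Ne.symm hi),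
        map_zero, LinearMap.zero_apply]
  | add a a' ha ha' =>
    rw [add_smul, map_add, ha, ha', DirectSum.decompose_add, DirectSum.add_apply, map_add,
      LinearMap.add_apply]

lemma comp_smul (X : GrMod 𝒜) {i j n : ℤ} (h : i + j = n) (a : 𝒜 i) (x : X.Total) :
    X.comp n ((a : Λ) • x) = X.act h a (X.comp j x) := by
  refine total_induction (p := fun x => X.comp n ((a : Λ) • x) = X.act h a (X.comp j x))
    (by simp) (fun l x => ?_) (fun x y hx hy => by simp only [smul_add, map_add, hx, hy]) x
  by_cases hl : l = j
  · subst hl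
    rw [X.smul_of h, comp_of_self, comp_of_self]
  · rw [X.smul_of rfl, comp_of_ne _ (by lia), comp_of_ne _ hl, map_zero]

/-- The linear map between underlying modules. -/
def totalMap {X Y : GrMod 𝒜} (f : X ⟶ Y) : X.Total →ₗ[Λ] Y.Total where
  toFun := X.desc fun j => Y.of j ∘ₗ app f j
  map_add' := map_add _
  map_smul' a x := by
    rw [RingHom.id_apply]
    refine total_induction (p := fun x => X.desc (fun j => Y.of j ∘ₗ app f j) (a • x) =
      a • X.desc (fun j => Y.of j ∘ₗ app f j) x) (by simp) (fun j x => ?_)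
      (fun x y hx hy => by simp only [smul_add, map_add, hx, hy]) x
    induction a using DirectSum.Decomposition.inductionOn 𝒜 with
    | zero => simp
    | @homogeneous i a =>
      rw [X.smul_of rfl, desc_of, desc_of, LinearMap.comp_apply, LinearMap.comp_apply,
        map_act, Y.smul_of rfl]
    | add a a' ha ha' => simp only [add_smul, map_add, ha, ha']

lemma totalMap_of {X Y : GrMod 𝒜} (f : X ⟶ Y) (j : ℤ) (x : X.X j) :
    totalMap f (X.of j x) = Y.of j (app f j x) :=
  X.desc_of _ j x

lemma comp_totalMap {X Y : GrMod 𝒜} (f : X ⟶ Y) (j : ℤ) (x : X.Total) :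
    Y.comp j (totalMap f x) = app f j (X.comp j x) := by
  refine total_induction (p := fun x => Y.comp j (totalMap f x) = app f j (X.comp j x))
    (by simp) (fun l x => ?_) (fun x y hx hy => by simp only [map_add, hx, hy]) x
  rw [totalMap_of]
  by_cases h : l = j
  · subst h
    rw [comp_of_self, comp_of_self]
  · rw [comp_of_ne _ h, comp_of_ne _ h, map_zero]

lemma totalMap_id (X : GrMod 𝒜) : totalMap (𝟙 X) = LinearMap.id :=
  LinearMap.ext fun x => total_ext fun j => comp_totalMap (𝟙 X) j x

lemma totalMap_comp {X Y Z : GrMod 𝒜} (f : X ⟶ Y) (g : Y ⟶ Z) :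
    totalMap (f ≫ g) = totalMap g ∘ₗ totalMap f :=
  LinearMap.ext fun x => total_ext fun j => by
    rw [LinearMap.comp_apply, comp_totalMap, comp_totalMap, comp_totalMap, comp_app]

lemma totalMap_add {X Y : GrMod 𝒜} (f g : X ⟶ Y) :
    totalMap (f + g) = totalMap f + totalMap g :=
  LinearMap.ext fun x => total_ext fun j => by
    rw [LinearMap.add_apply, map_add, comp_totalMap, comp_totalMap, comp_totalMap]
    rfl

variable (𝒜) in
/-- The functor that forgets the grading. -/
def totalFunctor : GrMod 𝒜 ⥤ ModuleCat.{u} Λ where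
  obj X := ModuleCat.of Λ X.Total
  map f := ModuleCat.ofHom (totalMap f)
  map_id X := by rw [totalMap_id]; rfl
  map_comp f g := by rw [totalMap_comp]; rfl

instance : (totalFunctor 𝒜).Additive where
  map_add {_ _ f g} := congrArg ModuleCat.ofHom (totalMap_add f g)

end Total

end GrMod

namespace GrMod

variable {k Λ : Type u} [Field k] [Ring Λ] [Algebra k Λ]
  {𝒜 : ℤ → Submodule k Λ} [GradedAlgebra 𝒜]

lemma finite_total {X : GrMod 𝒜} (hX : isFG 𝒜 X) : Module.Finite Λ X.Total := by
  obtain ⟨ι, _, d, x, h⟩ := hX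
  refine .of_fg_top (Submodule.fg_def.2
    ⟨Set.range fun s => X.of (d s) (x s), Set.finite_range _, ?_⟩)
  rw [eq_top_iff]
  rintro y -
  refine total_induction (p := fun y => y ∈ Submodule.span Λ
    (Set.range fun s => X.of (d s) (x s))) (zero_mem _) (fun j y => ?_) (fun _ _ => add_mem) y
  obtain ⟨a, rfl⟩ := h j y
  rw [map_sum]
  refine Submodule.sum_mem _ fun s _ => ?_
  rw [← X.smul_of]
  exact Submodule.smul_mem _ _ (Submodule.subset_span ⟨s, rfl⟩)

lemma exists_fin_generators {X : GrMod 𝒜} (hX : isFG 𝒜 X) :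
    ∃ (n : ℕ) (d : Fin n → ℤ) (x : ∀ s, X.X (d s)), ∀ (Z : GrMod 𝒜) (g : X ⟶ Z),
      (∀ s, app g _ (x s) = 0) → g = 0 := by
  obtain ⟨ι, _, d, x, h⟩ := hX
  let φ := (Fintype.equivFin ι).symm
  refine ⟨Fintype.card ι, fun s => d (φ s), fun s => x (φ s), fun Z g hg => hom_ext fun j y => ?_⟩
  obtain ⟨a, rfl⟩ := h j y
  rw [map_sum]
  refine Finset.sum_eq_zero fun s _ => ?_
  rw [map_act]
  have : app g _ (x s) = 0 := by
    obtain ⟨t, rfl⟩ := φ.surjective s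
    exact hg t
  rw [this, map_zero]

/-- The argument takes place in the underlying module, where the homogeneous elements fixed by `e`
generate a finitely generated submodule. Taking homogeneous components of the coefficients restores
the grading. -/
lemma exists_precover_generators [IsNoetherianRing Λ] {X : GrMod 𝒜} (hX : isFG 𝒜 X) {e : Λ}
    (he : e ∈ 𝒜 0) :
    ∃ (n : ℕ) (d : Fin n → ℤ) (x : ∀ s, X.X (d s)),
      (∀ s, X.act (zero_add _) ⟨e, he⟩ (x s) = x s) ∧
      ∀ (j : ℤ) (y : X.X j), X.act (zero_add _) ⟨e, he⟩ y = y →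
        ∃ a : ∀ s, 𝒜 (j - d s), y = ∑ s, X.act (sub_add_cancel j (d s)) (a s) (x s) := by
  have := finite_total hX
  obtain ⟨t, htT, ht⟩ := (Submodule.fg_span_iff_fg_span_finset_subset (R := Λ)
    {v : X.Total | ∃ (j : ℤ) (y : X.X j), X.act (zero_add _) ⟨e, he⟩ y = y ∧ v = X.of j y}).1
    (IsNoetherian.noetherian _)
  choose d y hey hy using fun i : t => htT i.2
  let φ := t.equivFin.symm
  refine ⟨t.card, fun i => d (φ i), fun i => y (φ i), fun i => hey (φ i), fun j z hz => ?_⟩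
  have hz : X.of j z ∈ Submodule.span Λ (Set.range fun i => X.of (d (φ i)) (y (φ i))) := by
    have hr : (Set.range fun i => X.of (d (φ i)) (y (φ i))) = t := by
      ext v
      constructor
      · rintro ⟨i, rfl⟩
        dsimp only
        rw [← hy]
        exact (φ i).2
      · intro hv
        refine ⟨φ.symm ⟨v, hv⟩, ?_⟩
        dsimp only
        rw [← hy, φ.apply_symm_apply]
    rw [hr, ← ht]
    exact Submodule.subset_span ⟨j, z, hz, rfl⟩
  obtain ⟨c, hc⟩ := (Submodule.mem_span_range_iff_exists_fun Λ).1 hz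
  refine ⟨fun i => DirectSum.decompose 𝒜 (c i) (j - d (φ i)), ?_⟩
  rw [← X.comp_of_self j z, ← hc, map_sum]
  exact Finset.sum_congr rfl fun i _ => X.comp_smul_of _ _ _

/-- Forgetting the grading embeds this space into the morphisms from `Λ` to the underlying module,
which are finite dimensional by the ungraded case. -/
lemma finite_hom_regular [IsNoetherianRing Λ] {X : GrMod 𝒜} (hX : isFG 𝒜 X) {e : Λ}
    (he : e ∈ 𝒜 0) (hfin : ∃ F : Submodule k Λ, Module.Finite k F ∧
      ∀ a, ∃ f ∈ F, a - f ∈ twoSided e)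
    (h0 : ∀ (j : ℤ) (y : X.X j), X.act (zero_add _) ⟨e, he⟩ y = 0) (s : ℤ) :
    Module.Finite k (regular 𝒜 s ⟶ X) := by
  have := finite_total hX
  have : Module.Finite k (ModuleCat.of Λ Λ ⟶ ModuleCat.of Λ X.Total) := by
    refine finite_hom_of_smul_eq_zero hfin _ fun x => ?_
    refine total_induction (p := fun x : X.Total => e • x = 0) (smul_zero _) (fun j y => ?_)
      (fun x y hx hy => by rw [smul_add, hx, hy, add_zero]) x
    refine (X.smul_of (zero_add j) ⟨e, he⟩ y).trans ?_
    rw [h0, map_zero]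
  let γ : (regular 𝒜 s).X (-s) := gen SetLike.GradedOne.one_mem Submodule.mem_top
    (add_neg_cancel s)
  let Φ : (regular 𝒜 s ⟶ X) →ₗ[k] (ModuleCat.of Λ Λ ⟶ ModuleCat.of Λ X.Total) :=
    { toFun := fun f => ModuleCat.ofHom (LinearMap.toSpanSingleton Λ X.Total
        (X.of (-s) (app f (-s) γ)))
      map_add' := fun f g => by
        apply ModuleCat.hom_ext
        refine LinearMap.ext_ring ?_
        change (1 : Λ) • X.of (-s) (app f (-s) γ + app g (-s) γ) =
          (1 : Λ) • X.of (-s) (app f (-s) γ) + (1 : Λ) • X.of (-s) (app g (-s) γ)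
        rw [map_add, smul_add]
      map_smul' := fun r f => by
        apply ModuleCat.hom_ext
        refine LinearMap.ext_ring ?_
        change (1 : Λ) • X.of (-s) (r • app f (-s) γ) =
          algebraMap k Λ r • (1 : Λ) • X.of (-s) (app f (-s) γ)
        rw [one_smul, one_smul, map_smul, algebraMap_smul_of] }
  refine Module.Finite.of_injective Φ fun f g hfg => ?_
  refine hom_ext_gen SetLike.GradedOne.one_mem Submodule.mem_top (fun _ _ => mul_one _)
    (add_neg_cancel s) ?_
  have h1 : (1 : Λ) • X.of (-s) (app f (-s) γ) = (1 : Λ) • X.of (-s) (app g (-s) γ) :=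
    congrArg (fun q => q.hom (1 : Λ)) hfg
  rw [one_smul, one_smul] at h1
  have h2 := congrArg (X.comp (-s)) h1
  rwa [comp_of_self, comp_of_self] at h2

section ProjectiveDimension

/-- The inclusion of the homogeneous parts of `Λ(n)` into `Λ`. -/
def regularVal (n j : ℤ) : (regular 𝒜 n).X j →ₗ[k] Λ := Submodule.subtype _

lemma projective_total_regular (n : ℤ) : Module.Projective Λ (regular 𝒜 n).Total := by
  let i : (regular 𝒜 n).Total →ₗ[Λ] Λ :=
    { toFun := (regular 𝒜 n).desc fun j => regularVal n j
      map_add' := map_add _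
      map_smul' := fun a x => by
        rw [RingHom.id_apply]
        refine total_induction (p := fun x => (regular 𝒜 n).desc
          (fun j => regularVal n j) (a • x) =
          a • (regular 𝒜 n).desc (fun j => regularVal n j) x)
          (by simp) (fun j x => ?_) (fun x y hx hy => by simp only [smul_add, map_add, hx, hy]) x
        induction a using DirectSum.Decomposition.inductionOn 𝒜 with
        | zero => simp
        | @homogeneous i a =>
          rw [smul_of _ rfl, desc_of, desc_of]
          rfl
        | add a a' ha ha' => simp only [add_smul, map_add, ha, ha'] }
  -- The underlying module of `Λ(n)` is a retract of `Λ`: the inverse direction sends `1` to the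
  -- generator in degree `-n`.
  refine .of_split i (LinearMap.toSpanSingleton Λ _ ((regular 𝒜 n).of (-n)
    (gen SetLike.GradedOne.one_mem Submodule.mem_top (add_neg_cancel n))))
    (LinearMap.ext fun x => ?_)
  refine total_induction (p := fun x => i x • ((regular 𝒜 n).of (-n)
    (gen SetLike.GradedOne.one_mem Submodule.mem_top (add_neg_cancel n))) = x) (by simp)
    (fun j x => ?_) (fun x y hx hy => by simp only [add_smul, map_add, hx, hy]) x
  have h1 : i ((regular 𝒜 n).of j x) = x.1 := desc_of _ _ j x
  rw [h1]
  refine (smul_of _ (i := j + n) (n := j) (by lia) ⟨x.1, x.2.1⟩ _).trans (congrArg _ ?_)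
  exact Subtype.ext (mul_one x.1)

/-- The degree-preserving part of an ungraded section of `p` is still a section of `p`, so `X` is a
retract of `F`. -/
lemma projective_of_projective_total {X F : GrMod 𝒜} (p : F ⟶ X) [Epi p] [Projective F]
    [Module.Projective Λ X.Total] : Projective X := by
  obtain ⟨s, hs⟩ := Module.projective_lifting_property (totalMap p) LinearMap.id (fun x =>
    total_induction (p := fun x => ∃ y, totalMap p y = x) ⟨0, map_zero _⟩ (fun j x => by
      obtain ⟨y, rfl⟩ := surjective_of_epi p j x
      exact ⟨F.of j y, totalMap_of p j y⟩)
      (fun x y ⟨x', hx⟩ ⟨y', hy⟩ => ⟨x' + y', by rw [map_add, hx, hy]⟩) x)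
  let s₀ : X ⟶ F := ofApp (fun j =>
    { toFun := fun x => F.comp j (s (X.of j x))
      map_add' := fun x y => by simp only [map_add]
      map_smul' := fun r x => by
        rw [map_smul, ← X.algebraMap_smul_of, map_smul, F.algebraMap_smul_of, map_smul,
          RingHom.id_apply] })
    fun i j n h a x => by
      dsimp only [LinearMap.coe_mk, AddHom.coe_mk]
      rw [← X.smul_of, map_smul, F.comp_smul h]
  have hsp : s₀ ≫ p = 𝟙 X := hom_ext fun j x => ?_
  · exact Retract.projective (Y := F) ⟨s₀, p, hsp⟩
  rw [comp_app, id_app]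
  change app p j (F.comp j (s (X.of j x))) = x
  rw [← comp_totalMap, ← LinearMap.comp_apply, hs, LinearMap.id_apply, comp_of_self]

lemma shortExact_total {X F : GrMod 𝒜} (p : F ⟶ X) [Epi p] :
    (ShortComplex.mk (ModuleCat.ofHom (totalMap (kerι p))) (ModuleCat.ofHom (totalMap p))
      (by rw [← ModuleCat.ofHom_comp, ← totalMap_comp, kerι_comp]
          exact (totalFunctor 𝒜).map_zero _ _)).ShortExact := by
  refine ShortComplex.ShortExact.mk' ?_ ?_ ?_
  · rw [ShortComplex.moduleCat_exact_iff]
    intro (x : F.Total) (hx : totalMap p x = 0)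
    obtain ⟨s, hs⟩ := F.exists_eq_sum x
    have h : ∀ j, app p j (F.comp j x) = 0 := fun j => by
      rw [← comp_totalMap, hx, map_zero]
    refine ⟨∑ j ∈ s, (ker p).of j (⟨F.comp j x, h j⟩ : LinearMap.ker (app p j)), ?_⟩
    refine (map_sum (totalMap (kerι p)) _ _).trans (Eq.trans ?_ hs.symm)
    exact Finset.sum_congr rfl fun j _ => totalMap_of (kerι p) j _
  · rw [ModuleCat.mono_iff_injective]
    refine (injective_iff_map_eq_zero (totalMap (kerι p))).2 fun x hx => total_ext fun j => ?_
    have := congrArg (F.comp j) hx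
    rw [comp_totalMap, map_zero] at this
    rw [map_zero]
    exact Subtype.ext this
  · rw [ModuleCat.epi_iff_surjective]
    exact fun x => total_induction (p := fun x => ∃ y, totalMap p y = x) ⟨0, map_zero _⟩
      (fun j x => by
        obtain ⟨y, rfl⟩ := surjective_of_epi p j x
        exact ⟨F.of j y, totalMap_of p j y⟩)
      (fun x y ⟨x', hx⟩ ⟨y', hy⟩ => ⟨x' + y', by rw [map_add, hx, hy]⟩) x

end ProjectiveDimension

end GrMod

/-! ### The quotient for graded modules -/

namespace GrMod

variable {k Λ : Type u} [Field k] [Ring Λ] [Algebra k Λ]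
  {𝒜 : ℤ → Submodule k Λ} [GradedAlgebra 𝒜]

attribute [local instance] Abelian.hasFiniteBiproducts

lemma exists_epi_regular {X : GrMod 𝒜} (hX : isFG 𝒜 X) :
    ∃ (n : ℕ) (d : Fin n → ℤ) (x : ∀ i, regular 𝒜 (d i) ⟶ X), Epi (biproduct.desc x) := by
  obtain ⟨n, d, x, h⟩ := exists_fin_generators hX
  refine ⟨n, fun i => -d i, fun i => ofElem _ (neg_add_cancel (d i)) (x i), ?_⟩
  refine Preadditive.epi_of_cancel_zero _ fun {Z} g hg => h Z g fun i => ?_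
  have h0 : ofElem ⊤ (neg_add_cancel (d i)) (x i) ≫ g = 0 := by
    refine Eq.trans ?_ ((congrArg (fun q => biproduct.ι (fun i => regular 𝒜 (-d i)) i ≫ q) hg).trans
      comp_zero)
    exact (congrArg (· ≫ g) (biproduct.ι_desc (fun i => (ofElem ⊤ (neg_add_cancel (d i)) (x i) :
      regular 𝒜 (-d i) ⟶ X)) i)).symm.trans (Category.assoc _ _ _)
  have h1 := congrArg (fun q => app q (d i) (gen SetLike.GradedOne.one_mem Submodule.mem_top
    (neg_add_cancel (d i)))) h0
  rw [ofElem_comp] at h1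
  exact (one_act _ _).symm.trans ((app_ofElem_gen _ _ _ _).symm.trans h1)

variable [IsNoetherianRing Λ]

/-- Graded syzygies are also syzygies of the underlying modules, so induction along a cover by sums
of `Λ(n)` reduces to the projective case. -/
lemma hasProjectiveDimensionLT_of_total (n : ℕ) {X : GrMod 𝒜} (hX : isFG 𝒜 X)
    (h : HasProjectiveDimensionLT (ModuleCat.of Λ X.Total) (n + 1)) :
    HasProjectiveDimensionLT X (n + 1) := by
  induction n generalizing X with
  | zero =>
    obtain ⟨n, d, x, hx⟩ := exists_epi_regular hX
    have := projective_biproduct fun i => projective_regular (𝒜 := 𝒜) (d i)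
    have : Module.Projective Λ X.Total := (IsProjective.iff_projective _).2
      (projective_iff_hasProjectiveDimensionLT_one.2 h)
    exact projective_iff_hasProjectiveDimensionLT_one.1
      (projective_of_projective_total (biproduct.desc x))
  | succ n ih =>
    obtain ⟨m, d, x, hx⟩ := exists_epi_regular hX
    have hF := projective_biproduct fun i => projective_regular (𝒜 := 𝒜) (d i)
    have hF' : Projective (ModuleCat.of Λ (⨁ fun i => regular 𝒜 (d i)).Total) :=
      Projective.of_iso ((totalFunctor 𝒜).mapBiproduct fun i => regular 𝒜 (d i)).symm
        (projective_biproduct fun i =>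
          (IsProjective.iff_projective _).1 (projective_total_regular (d i)))
    have hFG : isFG 𝒜 (⨁ fun i => regular 𝒜 (d i)) :=
      (isFG 𝒜).prop_of_iso (biproduct.isoProduct _).symm
        ((isFG 𝒜).prop_pi _ fun i => isFG_regular (d i))
    let p := biproduct.desc x
    have hmono : Mono (kerι p) := Fork.IsLimit.mono (kerIsLimit p)
    have hS : (ShortComplex.mk (kerι p) p (kerι_comp p)).ShortExact :=
      { exact := ShortComplex.exact_of_f_is_kernel _ (kerIsLimit p)
        mono_f := hmono
        epi_g := hx }
    have hK := ih (isFG_of_mono (kerι p) hFG)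
      ((shortExact_total p).hasProjectiveDimensionLT_X₁ (n + 1)
        (hasProjectiveDimensionLT_of_ge _ 1 (n + 1) (by lia)) h)
    exact hS.hasProjectiveDimensionLT_X₃ (n + 1) hK
        (hasProjectiveDimensionLT_of_ge _ 1 (n + 2) (by lia))

variable {e : Λ} (he : e ∈ 𝒜 0) (hee : e * e = e)

/-- `Λ(n)` as a finitely generated graded module. -/
abbrev regularFG (𝒜 : ℤ → Submodule k Λ) [GradedAlgebra 𝒜] (n : ℤ) : (isFG 𝒜).FullSubcategory :=
  ⟨regular 𝒜 n, isFG_regular n⟩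

/-- `(Λe)(n)` as a finitely generated graded module. -/
abbrev leftIdealFG (n : ℤ) : (isFG 𝒜).FullSubcategory :=
  ⟨ofLeftIdeal 𝒜 (Ideal.span {e}) n, isFG_ofLeftIdeal e he hee n⟩

lemma isQuotientSetting (hfin : ∃ F : Submodule k Λ, Module.Finite k F ∧
      ∀ a, ∃ f ∈ F, a - f ∈ twoSided e) (hΛ : HasFiniteGlobalDimension Λ) :
    IsQuotientSetting k (leftIdealFG he hee) (regularFG 𝒜) where
  projective_E n := projective_ofLeftIdeal he (Ideal.mem_span_singleton_self e)
    (fun _ => mul_eq_of_mem_span hee) n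
  projective_G n := projective_regular n
  exists_epi X hX := exists_epi_regular hX
  exists_precover X hX := by
    obtain ⟨n, d, x, hex, hx⟩ := exists_precover_generators hX he
    refine ⟨n, fun i => -d i, fun i => ofElem _ (neg_add_cancel (d i)) (x i), fun t f => ?_⟩
    have heI := Ideal.mem_span_singleton_self e
    have hI := fun z => mul_eq_of_mem_span hee (z := z)
    obtain ⟨a, ha⟩ := hx (-t) (app f (-t) (gen he heI (add_neg_cancel t)))
      (act_app_gen he heI hI _ f)
    -- The coefficient `a i * e` lies in `Λe` and acts on `x i` like `a i`, since `e` fixes `x i`.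
    refine ⟨fun i => ofElem _ (add_neg_cancel t) (X := ofLeftIdeal 𝒜 (Ideal.span {e}) (-d i))
      ⟨a i * e, ?_, Ideal.mul_mem_left _ _ heI⟩, ?_⟩
    · have := SetLike.GradedMul.mul_mem (a i).2 he
      exact (congrArg (fun j => (a i : Λ) * e ∈ 𝒜 j) (by lia)).mp this
    rw [← ofElem_app_gen he heI hI (add_neg_cancel t) f, ha, ofElem_sum]
    refine Finset.sum_congr rfl fun i _ => ?_
    refine Eq.trans (congrArg _ ?_) (ofElem_comp _ _ _ _).symm
    refine Eq.trans ?_ (ofElem_app _ _ _ _ _).symm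
    conv_lhs => rw [← hex i, ← X.mul_act (zero_add _) (sub_add_cancel (-t) (d i)) (by lia)]
    refine X.act_congr ?_ _ _ ?_ _
    · lia
    · rfl
  finite_hom X hX h s := by
    refine finite_hom_regular hX he hfin (fun j y => ?_) s
    have := congrArg (fun q => app q j (gen he (Ideal.mem_span_singleton_self e)
      (neg_add_cancel j))) (h (-j) (ofElem _ (neg_add_cancel j) y))
    exact (app_ofElem_gen _ _ _ _).symm.trans this
  finite_projectiveDimension X hX := by
    obtain ⟨d, hd⟩ := hΛ
    exact ⟨d + 1, hasProjectiveDimensionLT_of_total d hX (hd _)⟩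

/-- Right multiplication by `a`, as a map of finitely generated graded modules. -/
abbrev rightMulFG {n : ℤ} (a : 𝒜 n) : regularFG 𝒜 0 ⟶ regularFG 𝒜 n :=
  ObjectProperty.homMk (rightMul a)

/-- The element that a morphism `Λ → Λ(n)` multiplies by. -/
def valOne {n : ℤ} (f : regularFG 𝒜 0 ⟶ regularFG 𝒜 n) : 𝒜 n :=
  ⟨(app f.hom 0 (gen SetLike.GradedOne.one_mem Submodule.mem_top (add_zero 0))).1, by
    have := (app f.hom 0 (gen SetLike.GradedOne.one_mem Submodule.mem_top (add_zero 0))).2.1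
    exact (congrArg (fun j => (app f.hom 0 (gen SetLike.GradedOne.one_mem Submodule.mem_top
      (add_zero 0))).1 ∈ 𝒜 j) (zero_add n)).mp this⟩

lemma valOne_rightMulFG {n : ℤ} (a : 𝒜 n) : valOne (rightMulFG a) = a :=
  Subtype.ext (one_mul _)

lemma rightMulFG_ext {n : ℤ} {f g : regularFG 𝒜 0 ⟶ regularFG 𝒜 n}
    (h : (valOne f : Λ) = valOne g) : f = g := by
  apply ObjectProperty.hom_ext
  exact hom_ext_gen SetLike.GradedOne.one_mem Submodule.mem_top (fun _ _ => mul_one _)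
    (add_zero 0) (Subtype.ext h)

lemma rightMulFG_valOne {n : ℤ} (f : regularFG 𝒜 0 ⟶ regularFG 𝒜 n) : rightMulFG (valOne f) = f :=
  rightMulFG_ext (congrArg _ (valOne_rightMulFG _))

lemma rightMulFG_add {n : ℤ} (a b : 𝒜 n) : rightMulFG (a + b) = rightMulFG a + rightMulFG b :=
  rightMulFG_ext (mul_add (1 : Λ) a b)

lemma rightMulFG_zero {n : ℤ} : rightMulFG (0 : 𝒜 n) = 0 :=
  rightMulFG_ext (mul_zero (1 : Λ))

lemma valOne_mem_of_factorsThrough {n : ℤ} {f : regularFG 𝒜 0 ⟶ regularFG 𝒜 n}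
    (hf : f ∈ factorsThrough (leftIdealFG he hee) (regularFG 𝒜 0) (regularFG 𝒜 n)) :
    (valOne f : Λ) ∈ twoSided e := by
  induction hf using AddSubgroup.closure_induction with
  | mem f hf =>
    obtain ⟨t, g, x, rfl⟩ := hf
    have heI := Ideal.mem_span_singleton_self e
    have hI := fun z => mul_eq_of_mem_span hee (z := z)
    have key : ∀ (j : ℤ) (z : (ofLeftIdeal 𝒜 (Ideal.span {e}) t).X j),
        (app x.hom j z).1 ∈ twoSided e := fun j z => by
      have h1 := congrArg (fun q => app q j z)
        (ofElem_app_gen he heI hI (add_neg_cancel t) x.hom)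
      have h2 : (app x.hom j z).1 = z.1 *
        (app x.hom (-t) (gen he heI (add_neg_cancel t))).1 := (congrArg Subtype.val h1).symm
      rw [h2, ← hI z.1 z.2.2]
      exact mul_mem_twoSided _ _
    exact key _ _
  | zero => exact zero_mem (twoSided e)
  | add f g _ _ hf hg => exact add_mem hf hg
  | neg f _ hf => exact neg_mem hf

/-- Formulated for components of arbitrary elements, so that it is additive in `a` and reduces to `b
* e * c` with `b` and `c` homogeneous, although the summands of a homogeneous element need not be
homogeneous. -/
lemma rightMulFG_mem_factorsThrough {n : ℤ} (a : Λ) (ha : a ∈ twoSided e) :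
    rightMulFG (DirectSum.decompose 𝒜 a n) ∈
      factorsThrough (leftIdealFG he hee) (regularFG 𝒜 0) (regularFG 𝒜 n) := by
  refine twoSided_induction (p := fun a => rightMulFG (DirectSum.decompose 𝒜 a n) ∈
      factorsThrough (leftIdealFG he hee) (regularFG 𝒜 0) (regularFG 𝒜 n)) ?_ ?_ ?_ ha
  · rw [DirectSum.decompose_zero, DirectSum.zero_apply, rightMulFG_zero]
    exact zero_mem _
  · intro x y hx hy
    rw [DirectSum.decompose_add, DirectSum.add_apply, rightMulFG_add]
    exact add_mem hx hy
  · intro b c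
    induction b using DirectSum.Decomposition.inductionOn 𝒜 with
    | zero =>
      rw [zero_mul, zero_mul, DirectSum.decompose_zero, DirectSum.zero_apply, rightMulFG_zero]
      exact zero_mem _
    | add b b' hb hb' =>
      rw [add_mul, add_mul, DirectSum.decompose_add, DirectSum.add_apply, rightMulFG_add]
      exact add_mem hb hb'
    | @homogeneous i b =>
    induction c using DirectSum.Decomposition.inductionOn 𝒜 with
    | zero =>
      rw [mul_zero, DirectSum.decompose_zero, DirectSum.zero_apply, rightMulFG_zero]
      exact zero_mem _
    | add c c' hc hc' =>
      rw [mul_add, DirectSum.decompose_add, DirectSum.add_apply, rightMulFG_add]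
      exact add_mem hc hc'
    | @homogeneous j c =>
    have hbe : (b : Λ) * e ∈ 𝒜 i := by
      have := SetLike.GradedMul.mul_mem b.2 he
      exact (congrArg (fun j => (b : Λ) * e ∈ 𝒜 j) (add_zero i)).mp this
    have hbec : (b : Λ) * e * c ∈ 𝒜 (i + j) := SetLike.GradedMul.mul_mem hbe c.2
    by_cases h : i + j = n
    · subst h
      have heI := Ideal.mem_span_singleton_self e
      -- Right multiplication by `b * e` and then by `c`, through the twist `(Λe)(i)`.
      refine AddSubgroup.subset_closure ⟨i, ObjectProperty.homMk (ofElem ⊤ (add_zero 0)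
        (X := ofLeftIdeal 𝒜 (Ideal.span {e}) i) ⟨(b : Λ) * e, ?_, Ideal.mul_mem_left _ _ heI⟩),
        ObjectProperty.homMk (ofElem (Ideal.span {e}) (add_neg_cancel i) (X := regular 𝒜 (i + j))
          ⟨(c : Λ), ?_, trivial⟩), rightMulFG_ext ?_⟩
      · exact (congrArg (fun j => (b : Λ) * e ∈ 𝒜 j) (zero_add i)).mpr hbe
      · exact (congrArg (fun j => (c : Λ) ∈ 𝒜 j) (by lia : j = -i + (i + j))).mp c.2
      · rw [valOne_rightMulFG, DirectSum.decompose_of_mem_same 𝒜 hbec]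
        change (b : Λ) * e * c = 1 * (b * e) * c
        rw [one_mul]
    · have h0 : DirectSum.decompose 𝒜 ((b : Λ) * e * c) n = 0 :=
        Subtype.ext (DirectSum.decompose_of_mem_ne 𝒜 hbec h)
      rw [h0, rightMulFG_zero]
      exact zero_mem _

lemma rightMulFG_mem_factorsThrough_iff {n : ℤ} (a : 𝒜 n) :
    rightMulFG a ∈ factorsThrough (leftIdealFG he hee) (regularFG 𝒜 0) (regularFG 𝒜 n) ↔
      (a : Λ) ∈ twoSided e := by
  refine ⟨fun h => ?_, fun h => ?_⟩
  · have := valOne_mem_of_factorsThrough he hee h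
    rwa [valOne_rightMulFG] at this
  · have := rightMulFG_mem_factorsThrough (𝒜 := 𝒜) (n := n) he hee (a : Λ) h
    rwa [DirectSum.decompose_coe, DirectSum.of_eq_same] at this

end GrMod

section

variable {k Λ : Type u} [Field k] [Ring Λ] [Algebra k Λ] [IsNoetherianRing Λ]
  {𝒜 : ℤ → Submodule k Λ} [GradedAlgebra 𝒜] {e : Λ} (he : e ∈ 𝒜 0) (hee : e * e = e)

theorem graded_quotient (hfin : ∃ F : Submodule k Λ, Module.Finite k F ∧
      ∀ a, ∃ f ∈ F, a - f ∈ twoSided e) (hΛ : HasFiniteGlobalDimension Λ) :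
    HomFinite k (VerdierQuotient (.ofObj (leftIdealGr e he hee))) ∧
      ∀ n : ℤ,
        Function.Surjective (fun a : 𝒜 n =>
          (toVerdierQuotient (.ofObj (leftIdealGr e he hee))).map (rightMulGr a)) ∧
        ∀ a : 𝒜 n, (toVerdierQuotient (.ofObj (leftIdealGr e he hee))).map (rightMulGr a) = 0 ↔
          (a : Λ) ∈ twoSided e := by
  have H := GrMod.isQuotientSetting he hee hfin hΛ
  have hS : ∀ X, ObjectProperty.ofObj (leftIdealGr e he hee) X ↔ ∃ n,
      X = (stalk (GrMod.isFG 𝒜)).obj (GrMod.leftIdealFG he hee n) := fun X => by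
    rw [ObjectProperty.ofObj_iff]
    exact ⟨fun ⟨n, h⟩ => ⟨n, h.symm⟩, fun ⟨n, h⟩ => ⟨n, h.symm⟩⟩
  have : (ObjectProperty.ofObj (leftIdealGr e he hee)).Nonempty := ⟨_, ⟨(0 : ℤ)⟩⟩
  refine ⟨H.homFinite _ hS, fun n => ⟨fun f => ?_, fun a => ?_⟩⟩
  · obtain ⟨g, hg⟩ := H.map_surjective _ hS 0 n f
    refine ⟨GrMod.valOne g, Eq.trans ?_ hg⟩
    exact congrArg (fun q => (toVerdierQuotient (.ofObj (leftIdealGr e he hee))).map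
      ((stalk (GrMod.isFG 𝒜)).map q)) (GrMod.rightMulFG_valOne g)
  · exact (H.map_eq_zero_iff _ hS (s := 0) (s' := n) (GrMod.rightMulFG a)).trans
      (GrMod.rightMulFG_mem_factorsThrough_iff he hee a)

end

/-! ### Regular local rings -/

section RegularLocalRing

open IsLocalRing

variable {A : Type u} [CommRing A]

lemma quotient_isLocalRing [IsLocalRing A] {x : A} (hx : x ∈ maximalIdeal A) :
    IsLocalRing (A ⧸ Ideal.span {x}) := by
  have : Nontrivial (A ⧸ Ideal.span {x}) := Ideal.Quotient.nontrivial_iff.2 fun h =>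
    (maximalIdeal.isMaximal A).ne_top (top_le_iff.1 (h ▸ (Ideal.span_singleton_le_iff_mem _).2 hx))
  exact IsLocalRing.of_surjective' (Ideal.Quotient.mk _) Ideal.Quotient.mk_surjective

/-- Write `x` in a minimal generating set of the maximal ideal. As `x ∉ 𝔪²`, some coefficient is a
unit, and the corresponding generator becomes redundant modulo `x`. -/
lemma spanFinrank_maximalIdeal_quotient_lt [IsLocalRing A] [IsNoetherianRing A] {x : A}
    (hx : x ∈ maximalIdeal A) (hx2 : x ∉ maximalIdeal A ^ 2) [IsLocalRing (A ⧸ Ideal.span {x})] :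
    (maximalIdeal (A ⧸ Ideal.span {x})).spanFinrank + 1 ≤ (maximalIdeal A).spanFinrank := by
  classical
  obtain ⟨s, hs, hspan⟩ := Submodule.FG.exists_span_finset_card_eq_spanFinrank
    (IsNoetherian.noetherian (maximalIdeal A))
  have hs' : ∀ z ∈ s, z ∈ maximalIdeal A := fun z hz => hspan ▸ Submodule.subset_span hz
  obtain ⟨f, -, hf⟩ := Submodule.mem_span_finset.1 (hspan ▸ hx : x ∈ Submodule.span A (s : Set A))
  obtain ⟨z, hz, hfz⟩ : ∃ z ∈ s, IsUnit (f z) := by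
    by_contra! h
    refine hx2 (hf ▸ sum_mem fun z hz => ?_)
    rw [pow_two]
    exact Ideal.mul_mem_mul ((mem_maximalIdeal _).2 (h z hz)) (hs' z hz)
  let π := Ideal.Quotient.mk (Ideal.span {x})
  have hmax : maximalIdeal (A ⧸ Ideal.span {x}) ≤ Ideal.span (π '' (s.erase z : Set A)) := by
    rw [← map_maximalIdeal_of_surjective π Ideal.Quotient.mk_surjective, ← hspan,
      Ideal.map_le_iff_le_comap]
    refine Submodule.span_le.2 fun y hy => ?_
    by_cases hyz : y = z
    · subst hyz
      have h1 : π (f y) * π y ∈ Ideal.span (π '' (s.erase y : Set A)) := by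
        have h2 : π (f y * y) = - ∑ a ∈ s.erase y, π (f a * a) := by
          rw [eq_neg_iff_add_eq_zero, ← map_sum, ← map_add,
            Finset.add_sum_erase s (fun a => f a * a) hy]
          exact Ideal.Quotient.eq_zero_iff_mem.2 (hf ▸ Ideal.mem_span_singleton_self _)
        rw [← map_mul, h2]
        refine neg_mem (sum_mem fun a ha => ?_)
        rw [map_mul]
        exact Ideal.mul_mem_left _ _ (Ideal.subset_span ⟨a, ha, rfl⟩)
      exact (Ideal.unit_mul_mem_iff_mem _ (hfz.map π)).1 h1
    · exact Ideal.subset_span ⟨y, by simpa using ⟨hy, hyz⟩, rfl⟩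
  have hmax' : maximalIdeal (A ⧸ Ideal.span {x}) = Ideal.span (π '' (s.erase z : Set A)) := by
    refine le_antisymm hmax (Ideal.span_le.2 ?_)
    rintro _ ⟨y, hy, rfl⟩
    rw [← map_maximalIdeal_of_surjective π Ideal.Quotient.mk_surjective]
    exact Ideal.mem_map_of_mem _ (hs' y (Finset.mem_of_mem_erase hy))
  have hfin : (s.erase z : Set A).Finite := (s.erase z).finite_toSet
  calc (maximalIdeal (A ⧸ Ideal.span {x})).spanFinrank + 1
      ≤ (π '' (s.erase z : Set A)).ncard + 1 := by
        rw [hmax']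
        gcongr
        exact Submodule.spanFinrank_span_le_ncard_of_finite (hfin.image π)
    _ ≤ (s.erase z : Set A).ncard + 1 := by
        gcongr
        exact Set.ncard_image_le hfin
    _ = (maximalIdeal A).spanFinrank := by
        rw [Set.ncard_coe_finset, ← hs, Finset.card_erase_add_one hz]

/-- Modulo `x` the embedding dimension drops by at least one and the Krull dimension by at most one.
Since the latter never exceeds the former, both equal `c`. -/
lemma isRegularLocalRing_quotient [IsRegularLocalRing A] {x : A}
    (hx : x ∈ maximalIdeal A) (hx2 : x ∉ maximalIdeal A ^ 2) {c : ℕ}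
    (hc : ringKrullDim A = (c + 1 : ℕ)) :
    IsRegularLocalRing (A ⧸ Ideal.span {x}) ∧ ringKrullDim (A ⧸ Ideal.span {x}) = c := by
  have := quotient_isLocalRing hx
  have h1 := spanFinrank_maximalIdeal_quotient_lt hx hx2
  have h2 : (maximalIdeal A).spanFinrank = c + 1 := by
    have := IsRegularLocalRing.spanFinrank_maximalIdeal (R := A)
    rw [hc] at this
    exact_mod_cast this
  have h3 : (maximalIdeal (A ⧸ Ideal.span {x})).spanFinrank ≤ c := by lia
  have h4 : (c : WithBot ℕ∞) ≤ ringKrullDim (A ⧸ Ideal.span {x}) := by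
    have h := ringKrullDim_le_ringKrullDim_quotSMulTop_succ hx
    rw [hc, ← Submodule.ideal_span_singleton_smul, smul_eq_mul, Ideal.mul_top] at h
    push_cast at h
    exact ENat.WithBot.add_le_add_one_right_iff.1 h
  have h5 : ((maximalIdeal (A ⧸ Ideal.span {x})).spanFinrank : WithBot ℕ∞) ≤ c := by
    exact_mod_cast h3
  exact ⟨IsRegularLocalRing.of_spanFinrank_maximalIdeal_le _ (h5.trans h4),
    le_antisymm ((ringKrullDim_le_spanFinrank_maximalIdeal _).trans h5) h4⟩

lemma isField_of_ringKrullDim_eq_zero [IsRegularLocalRing A] (h : ringKrullDim A = 0) :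
    IsField A := by
  rw [isField_iff_maximalIdeal_eq]
  refine (Submodule.spanFinrank_eq_zero_iff_eq_bot (IsNoetherian.noetherian _)).1 ?_
  have := IsRegularLocalRing.spanFinrank_maximalIdeal (R := A)
  rw [h] at this
  exact_mod_cast this

/-- Induction on the dimension: for suitable `x` the regular ring `A/(x)` is a domain, so `(x)` is
prime, and a minimal prime below it that avoids `x` must vanish. -/
lemma isDomain_of_ringKrullDim_eq (c : ℕ) : ∀ (A : Type u) [CommRing A]
    [IsRegularLocalRing A], ringKrullDim A = c → IsDomain A := by
  induction c with
  | zero => exact fun A _ _ h => (isField_of_ringKrullDim_eq_zero h).isDomain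
  | succ c ih =>
    intro A _ _ hc
    classical
    have hlt : maximalIdeal A ^ 2 < maximalIdeal A :=
      maximalIdeal_sq_lt_of_ringKrullDim_ne_zero (by
        rw [hc]
        exact_mod_cast (Nat.succ_ne_zero c))
    have hfin := minimalPrimes.finite_of_isNoetherianRing A
    obtain ⟨x, hxm, hx2, hxmin⟩ : ∃ x ∈ maximalIdeal A, x ∉ maximalIdeal A ^ 2 ∧
        ∀ q ∈ minimalPrimes A, x ∉ q := by
      by_contra! h
      have hsub : (maximalIdeal A : Set A) ⊆ ⋃ i ∈ (↑(insert (maximalIdeal A ^ 2)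
          hfin.toFinset) : Set (Ideal A)), ((id i : Ideal A) : Set A) := fun x hx => by
        by_cases hx2 : x ∈ maximalIdeal A ^ 2
        · exact Set.mem_biUnion (by simp) hx2
        · obtain ⟨q, hq, hxq⟩ := h x hx hx2
          exact Set.mem_biUnion (by simp [hq]) hxq
      -- Prime avoidance tolerates two ideals that are not prime; both exceptions are used for `𝔪²`.
      obtain ⟨i, hi, hle⟩ := (Ideal.subset_union_prime (maximalIdeal A ^ 2) (maximalIdeal A ^ 2)
        (fun i hi h _ => by
          rw [Finset.mem_insert, Set.Finite.mem_toFinset] at hi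
          exact (hi.resolve_left h).1.1)).1 hsub
      rw [Finset.mem_insert, Set.Finite.mem_toFinset] at hi
      rcases hi with rfl | hi
      · exact hlt.not_ge hle
      · have h0 : (maximalIdeal A).height = 0 := by
          have := hi.1.1
          rw [← (maximalIdeal.isMaximal A).eq_of_le this.ne_top hle] at hi
          exact Ideal.height_eq_zero_iff.2 hi
        have h1 := maximalIdeal_height_eq_ringKrullDim (R := A)
        rw [h0, hc] at h1
        exact absurd h1 (by exact_mod_cast (Nat.succ_ne_zero c).symm)
    obtain ⟨hreg, hdim⟩ := isRegularLocalRing_quotient hxm hx2 hc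
    have := ih _ hdim
    have hprime : (Ideal.span {x}).IsPrime := (Ideal.Quotient.isDomain_iff_prime _).1 this
    obtain ⟨q, hq, hqx⟩ := Ideal.exists_minimalPrimes_le (bot_le : ⊥ ≤ Ideal.span {x})
    have hqp := hq.1.1
    have hq0 : q = ⊥ := by
      -- An element `z * x` of `q` has `z ∈ q`, because `x ∉ q`. Hence `q ≤ 𝔪q`, and Nakayama's
      -- lemma applies.
      refine Submodule.eq_bot_of_le_smul_of_le_jacobson_bot (maximalIdeal A) q
        (IsNoetherian.noetherian _) (fun y hy => ?_) (maximalIdeal_le_jacobson _)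
      obtain ⟨z, rfl⟩ := Ideal.mem_span_singleton'.1 (hqx hy)
      rw [mul_comm]
      exact Submodule.smul_mem_smul hxm ((hqp.mem_or_mem hy).resolve_right (hxmin q hq))
    rw [hq0] at hqp
    exact IsDomain.of_bot_isPrime A

lemma exists_ringKrullDim_eq (A : Type u) [CommRing A] [IsRegularLocalRing A] :
    ∃ c : ℕ, ringKrullDim A = c :=
  ⟨_, (IsRegularLocalRing.spanFinrank_maximalIdeal (R := A)).symm⟩

lemma isDomain_of_isRegularLocalRing [IsRegularLocalRing A] : IsDomain A :=
  isDomain_of_ringKrullDim_eq _ A (exists_ringKrullDim_eq A).choose_spec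

end RegularLocalRing

/-! ### Projective dimension over regular local rings -/

section ChangeOfRings

variable {A : Type u} [CommRing A]

lemma shortExact_of_linearMap {X Y Z : Type u} [AddCommGroup X] [Module A X] [AddCommGroup Y]
    [Module A Y] [AddCommGroup Z] [Module A Z] (f : X →ₗ[A] Y) (g : Y →ₗ[A] Z)
    (hf : Function.Injective f) (hg : Function.Surjective g) (hfg : Function.Exact f g) :
    (ShortComplex.mk (ModuleCat.ofHom f) (ModuleCat.ofHom g)
      (by ext x; exact hfg.apply_apply_eq_zero x)).ShortExact where
  exact := by
    rw [ShortComplex.moduleCat_exact_iff]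
    exact fun y hy => (hfg y).1 hy
  mono_f := (ModuleCat.mono_iff_injective _).2 hf
  epi_g := (ModuleCat.epi_iff_surjective _).2 hg

/-- If `x` is a regular element of a local ring `A`, then a finite module of projective dimension at
most `n` over `A ⧸ (x)` has projective dimension at most `n + 1` over `A`. -/
lemma hasProjectiveDimensionLE_of_quotient [IsLocalRing A] [IsNoetherianRing A] {x : A}
    (hx : x ∈ IsLocalRing.maximalIdeal A) (hreg : IsSMulRegular A x) (n : ℕ) :
    ∀ (M : Type u) [AddCommGroup M] [Module A M] [Module (A ⧸ Ideal.span {x}) M]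
      [IsScalarTower A (A ⧸ Ideal.span {x}) M] [Module.Finite (A ⧸ Ideal.span {x}) M],
      HasProjectiveDimensionLE (ModuleCat.of (A ⧸ Ideal.span {x}) M) n →
        HasProjectiveDimensionLE (ModuleCat.of A M) (n + 1) := by
  have hloc := quotient_isLocalRing hx
  -- A free `A/(x)`-module is the cokernel of the injective multiplication by `x` on a free
  -- `A`-module.
  have free (M : Type u) [AddCommGroup M] [Module A M] [Module (A ⧸ Ideal.span {x}) M]
      [IsScalarTower A (A ⧸ Ideal.span {x}) M] [Module.Finite (A ⧸ Ideal.span {x}) M]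
      [Module.Free (A ⧸ Ideal.span {x}) M] : HasProjectiveDimensionLE (ModuleCat.of A M) 1 := by
    let ι := Module.Free.ChooseBasisIndex (A ⧸ Ideal.span {x}) M
    let b : Module.Basis ι _ M := Module.Free.chooseBasis (A ⧸ Ideal.span {x}) M
    let φ : (ι → A) →ₗ[A] M := (b.equivFun.symm.toLinearMap.restrictScalars A) ∘ₗ
      LinearMap.pi fun i => (Algebra.linearMap A (A ⧸ Ideal.span {x})) ∘ₗ LinearMap.proj i
    have hφ : Function.Surjective φ := by
      refine b.equivFun.symm.surjective.comp fun v => ?_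
      choose w hw using fun i => Ideal.Quotient.mk_surjective (v i)
      exact ⟨w, funext hw⟩
    have hS := shortExact_of_linearMap (LinearMap.lsmul A (ι → A) x) φ
      (fun v w h => funext fun i => hreg (congrFun h i)) hφ (fun v => by
        constructor
        · intro h
          have h1 := b.equivFun.symm.injective (h.trans (map_zero b.equivFun.symm).symm)
          have h2 (i : ι) : ∃ w, w * x = v i :=
            Ideal.mem_span_singleton'.1 (Ideal.Quotient.eq_zero_iff_mem.1 (congrFun h1 i))
          choose w hw using h2
          exact ⟨w, funext fun i => (mul_comm _ _).trans (hw i)⟩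
        · rintro ⟨w, rfl⟩
          refine (congrArg b.equivFun.symm (funext fun i => ?_)).trans (map_zero b.equivFun.symm)
          exact Ideal.Quotient.eq_zero_iff_mem.2
            (Ideal.mul_mem_right _ _ (Ideal.mem_span_singleton_self x)))
    have hp : Projective (ModuleCat.of A (ι → A)) := (IsProjective.iff_projective _).1 inferInstance
    exact (hS.hasProjectiveDimensionLT_X₃_iff 0 hp).2
      ((projective_iff_hasProjectiveDimensionLT_one).1 hp)
  induction n with
  | zero =>
    intro M _ _ _ _ _ hM
    have : Module.Projective (A ⧸ Ideal.span {x}) M := (IsProjective.iff_projective _).2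
      ((projective_iff_hasProjectiveDimensionLT_one).2 hM)
    have : Module.Free (A ⧸ Ideal.span {x}) M := Module.free_of_flat_of_isLocalRing
    exact free M
  | succ n ih =>
    intro M _ _ _ _ _ hM
    obtain ⟨r, f, hf⟩ := Module.Finite.exists_fin' (A ⧸ Ideal.span {x}) M
    have hp : Projective (ModuleCat.of (A ⧸ Ideal.span {x}) (Fin r → A ⧸ Ideal.span {x})) :=
      (IsProjective.iff_projective _).1 inferInstance
    have hK := ih (LinearMap.ker f)
      (((LinearMap.shortExact_shortComplexKer hf).hasProjectiveDimensionLT_X₃_iff n hp).1 hM)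
    have hS := shortExact_of_linearMap ((LinearMap.ker f).subtype.restrictScalars A)
      (f.restrictScalars A) Subtype.val_injective hf fun y => by simp
    -- The kernel has dimension at most `n + 1` over `A`, and the free cover at most `1`.
    exact hS.hasProjectiveDimensionLT_X₃ (n + 2) hK
      (have := free (Fin r → A ⧸ Ideal.span {x})
       hasProjectiveDimensionLT_of_ge _ 2 _ (by lia))

/-- Finite modules over a regular local ring of dimension `c` have projective dimension at most
`c`. -/
theorem hasProjectiveDimensionLE_of_isRegularLocalRing (c : ℕ) : ∀ (A : Type u) [CommRing A]
    [IsRegularLocalRing A], ringKrullDim A = c → ∀ (M : Type u) [AddCommGroup M] [Module A M]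
    [Module.Finite A M], HasProjectiveDimensionLE (ModuleCat.of A M) c := by
  induction c with
  | zero =>
    intro A _ _ h M _ _ _
    let := (isField_of_ringKrullDim_eq_zero h).toField
    exact (projective_iff_hasProjectiveDimensionLT_one).1
      ((IsProjective.iff_projective _).1 (Module.Projective.of_free (R := A) (P := M)))
  | succ c ih =>
    intro A _ _ hc M _ _ _
    have := isDomain_of_isRegularLocalRing (A := A)
    obtain ⟨x, hx, hx2⟩ := Set.exists_of_ssubset
      (IsLocalRing.maximalIdeal_sq_lt_of_ringKrullDim_ne_zero (R := A) (by
        rw [hc]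
        exact_mod_cast (Nat.succ_ne_zero c)))
    obtain ⟨hreg, hdim⟩ := isRegularLocalRing_quotient hx hx2 hc
    have hx0 : x ≠ 0 := fun h => hx2 (h ▸ zero_mem _)
    obtain ⟨r, f, hf⟩ := Module.Finite.exists_fin' A M
    have hp : Projective (ModuleCat.of A (Fin r → A)) :=
      (IsProjective.iff_projective _).1 inferInstance
    -- The first syzygy lies in a free module over a domain, so `x` is regular on it even if it is
    -- not regular on `M`.
    have hreg : IsSMulRegular (ModuleCat.of A (LinearMap.ker f)) x := fun v w h =>
      Subtype.ext (funext fun i => mul_left_cancel₀ hx0 (congrFun (congrArg Subtype.val h) i))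
    have : Module.Finite (A ⧸ Ideal.span {x}) (QuotSMulTop x (LinearMap.ker f)) :=
      Module.Finite.of_restrictScalars_finite A _ _
    have h1 := hasProjectiveDimensionLE_of_quotient hx
      (fun v w h => mul_left_cancel₀ hx0 h) c (QuotSMulTop x (LinearMap.ker f)) (ih _ hdim _)
    -- Dividing by `x` raises the dimension by exactly one over `A`. This cancels the loss of one in
    -- the change of rings.
    have h2 := ModuleCat.projectiveDimension_quotSMulTop_eq_succ_of_isSMulRegular
      (ModuleCat.of A (LinearMap.ker f)) x hreg hx
    have h3 : HasProjectiveDimensionLE (ModuleCat.of A (LinearMap.ker f)) c := by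
      rw [← projectiveDimension_le_iff] at h1 ⊢
      have h4 := h2.symm.trans_le h1
      push_cast at h4
      exact ENat.WithBot.add_le_add_one_right_iff.1 h4
    exact ((LinearMap.shortExact_shortComplexKer hf).hasProjectiveDimensionLT_X₃_iff c hp).2 h3

end ChangeOfRings

/-! ### Extension groups annihilated by one element of a multiplicative set -/

section ExtTorsion

open Abelian

variable {R : Type u} [CommRing R]

/-- A single element of `S` annihilates `Ext^n(X, Y)`. -/
def ExtTorsion (S : Submonoid R) (X Y : ModuleCat.{u} R) (n : ℕ) : Prop :=
  ∃ s ∈ S, ∀ α : Ext X Y n, s • α = 0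

variable {S : Submonoid R} {X Y : ModuleCat.{u} R} {n : ℕ}

lemma extTorsion_of_le {T : Submonoid R} (hST : S ≤ T) (h : ExtTorsion S X Y n) :
    ExtTorsion T X Y n :=
  let ⟨s, hs, h⟩ := h
  ⟨s, hST hs, h⟩

lemma extTorsion_of_subsingleton (h : Subsingleton (Ext X Y n)) : ExtTorsion S X Y n :=
  ⟨1, one_mem _, fun _ => Subsingleton.elim _ _⟩

lemma smul_eq_mk₀_comp (α : Ext X Y n) (r : R) :
    r • α = (Ext.mk₀ (r • 𝟙 X)).comp α (zero_add n) := by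
  rw [Ext.mk₀_smul, Ext.smul_comp, Ext.mk₀_id_comp]

/-- In the long exact sequence, one element moves a class into the image of a neighbouring group and
a second one kills its preimage; the product kills the class. The contravariant variants below work
in the same way. -/
lemma ExtTorsion.covariant_X₃ {T : ShortComplex (ModuleCat.{u} R)} (hT : T.ShortExact)
    (h₂ : ExtTorsion S X T.X₂ n) (h₁ : ExtTorsion S X T.X₁ (n + 1)) : ExtTorsion S X T.X₃ n := by
  obtain ⟨s, hs, h₂⟩ := h₂
  obtain ⟨t, ht, h₁⟩ := h₁
  refine ⟨s * t, mul_mem hs ht, fun α => ?_⟩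
  obtain ⟨β, hβ⟩ := Ext.covariant_sequence_exact₃ X hT (t • α) rfl
    (by rw [Ext.smul_comp, h₁])
  rw [mul_smul, ← hβ, ← Ext.smul_comp, h₂, Ext.zero_comp]

lemma ExtTorsion.contravariant_X₂ {T : ShortComplex (ModuleCat.{u} R)} (hT : T.ShortExact)
    (h₁ : ExtTorsion S T.X₁ Y n) (h₃ : ExtTorsion S T.X₃ Y n) : ExtTorsion S T.X₂ Y n := by
  obtain ⟨s, hs, h₁⟩ := h₁
  obtain ⟨t, ht, h₃⟩ := h₃
  refine ⟨t * s, mul_mem ht hs, fun α => ?_⟩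
  obtain ⟨β, hβ⟩ := Ext.contravariant_sequence_exact₂ hT Y (s • α)
    (by rw [Ext.comp_smul, h₁])
  rw [mul_smul, ← hβ, ← Ext.comp_smul, h₃, Ext.comp_zero]

lemma ExtTorsion.contravariant_X₁ {T : ShortComplex (ModuleCat.{u} R)} (hT : T.ShortExact)
    (h₂ : ExtTorsion S T.X₂ Y n) (h₃ : ExtTorsion S T.X₃ Y (n + 1)) : ExtTorsion S T.X₁ Y n := by
  obtain ⟨s, hs, h₂⟩ := h₂
  obtain ⟨t, ht, h₃⟩ := h₃
  refine ⟨s * t, mul_mem hs ht, fun α => ?_⟩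
  obtain ⟨β, hβ⟩ := Ext.contravariant_sequence_exact₁ hT Y (t • α) (add_comm 1 n)
    (by rw [Ext.comp_smul, h₃])
  rw [mul_smul, ← hβ, ← Ext.comp_smul, h₂, Ext.comp_zero]

lemma ExtTorsion.of_factor {Y' : ModuleCat.{u} R} (f : Y ⟶ Y') (g : Y' ⟶ Y) {r : R} (hr : r ∈ S)
    (hfg : f ≫ g = r • 𝟙 Y) (h : ExtTorsion S X Y' n) : ExtTorsion S X Y n := by
  obtain ⟨s, hs, h⟩ := h
  refine ⟨s * r, mul_mem hs hr, fun α => ?_⟩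
  rw [mul_smul, Ext.smul_eq_comp_mk₀ α r, ← hfg, ← Ext.mk₀_comp_mk₀,
    ← Ext.comp_assoc_of_second_deg_zero, ← Ext.smul_comp, h, Ext.zero_comp]

lemma ExtTorsion.pi {Y : Type u} [AddCommGroup Y] [Module R Y]
    (h : ExtTorsion S X (ModuleCat.of R Y) n) (r : ℕ) :
    ExtTorsion S X (ModuleCat.of R (Fin r → Y)) n := by
  classical
  obtain ⟨s, hs, h⟩ := h
  refine ⟨s, hs, fun α => ?_⟩
  have hsum : 𝟙 (ModuleCat.of R (Fin r → Y)) = ∑ i : Fin r,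
      ModuleCat.ofHom (LinearMap.proj (R := R) (φ := fun _ : Fin r => Y) i) ≫
        ModuleCat.ofHom (LinearMap.single R (fun _ : Fin r => Y) i) := by
    ext v
    simp [ModuleCat.hom_sum]
  rw [← Ext.comp_mk₀_id α, hsum, Ext.mk₀_sum, Ext.comp_sum, Finset.smul_sum]
  refine Finset.sum_eq_zero fun i _ => ?_
  rw [← Ext.mk₀_comp_mk₀, ← Ext.comp_assoc_of_second_deg_zero, ← Ext.smul_comp, h,
    Ext.zero_comp]

/-- If the localization of a finite module `K` is projective, then multiplication by some element of
`S` on `K` factors through a finite free module. -/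
lemma exists_factor_of_projective_localizedModule [IsNoetherianRing R] (K : ModuleCat.{u} R)
    [Module.Finite R K] (hK : Projective (K.localizedModule S)) :
    ∃ s ∈ S, ∃ (r : ℕ) (f : K →ₗ[R] (Fin r → R)) (g : (Fin r → R) →ₗ[R] K),
      g ∘ₗ f = s • LinearMap.id := by
  have : Module.FinitePresentation R K := Module.finitePresentation_of_finite R K
  obtain ⟨r, g, hg⟩ := Module.Finite.exists_fin' R K
  let ι := K.localizedModuleMkLinearMap S
  let κ := LocalizedModule.mkLinearMap S (Fin r → R)
  let γ := IsLocalizedModule.mapExtendScalars S κ ι (Localization S) g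
  have hγ : Function.Surjective γ := IsLocalizedModule.map_surjective S κ ι g hg
  have hγκ (x : Fin r → R) : γ (κ x) = ι (g x) := IsLocalizedModule.map_apply S κ ι g x
  have : Module.Projective (Localization S) (K.localizedModule S) :=
    (IsProjective.iff_projective _).2 hK
  obtain ⟨σ, hσ⟩ := Module.projective_lifting_property γ LinearMap.id hγ
  -- Clearing denominators turns the section `σ` into a map `f` over `R`, up to the factor `s`.
  obtain ⟨f, s, hf⟩ := Module.FinitePresentation.exists_lift_of_isLocalizedModule S κ
    (σ.restrictScalars R ∘ₗ ι)
  -- The maps `g ∘ f` and `s · id` agree after localization, so they agree up to a further factor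
  -- `t`.
  obtain ⟨t, ht⟩ := Module.Finite.exists_smul_of_comp_eq_of_isLocalizedModule S ι
    (g ∘ₗ f) ((s : R) • LinearMap.id) (LinearMap.ext fun x => by
      have h1 : κ (f x) = (s : R) • σ (ι x) := LinearMap.congr_fun hf x
      have h2 : γ (σ (ι x)) = ι x := LinearMap.congr_fun hσ (ι x)
      have h3 : γ ((s : R) • σ (ι x)) = (s : R) • γ (σ (ι x)) :=
        LinearMap.map_smul_of_tower γ (s : R) _
      change ι (g (f x)) = ι ((s : R) • x)
      rw [← hγκ, h1, h3, h2, map_smul])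
  exact ⟨t * s, mul_mem t.2 s.2, r, f, (t : R) • g, by
    rw [LinearMap.smul_comp, mul_smul]; exact ht⟩

/-- If all `Ext^i(X, R)`, `i ≥ 1`, are `S`-torsion, then so are all `Ext^i(X, K)` for finite modules
`K` whose localization has finite projective dimension. -/
lemma extTorsion_of_localizedModule [IsNoetherianRing R]
    (h : ∀ j, ExtTorsion S X (ModuleCat.of R R) (j + 1)) (c : ℕ) :
    ∀ (K : ModuleCat.{u} R) [Module.Finite R K], HasProjectiveDimensionLE (K.localizedModule S) c →
      ∀ j, ExtTorsion S X K (j + 1) := by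
  induction c with
  | zero =>
    intro K _ hK j
    obtain ⟨s, hs, r, f, g, hfg⟩ := exists_factor_of_projective_localizedModule K
      (projective_iff_hasProjectiveDimensionLT_one.2 hK)
    refine ((h j).pi r).of_factor (ModuleCat.ofHom f) (ModuleCat.ofHom g) hs ?_
    ext x
    exact LinearMap.congr_fun hfg x
  | succ c ih =>
    intro K _ hK j
    obtain ⟨r, f, hf⟩ := Module.Finite.exists_fin' R K
    have hT := LinearMap.shortExact_shortComplexKer hf
    have hp : Projective (ModuleCat.of R (Fin r → R)) :=
      (IsProjective.iff_projective _).1 inferInstance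
    have hTS := hT.map_of_exact (ModuleCat.localizedModuleFunctor S)
    -- Dimension shifting: the syzygy of `K` has localized projective dimension at most `c`, at the
    -- price of one more degree of `Ext`.
    exact ExtTorsion.covariant_X₃ hT ((h j).pi r) (ih (ModuleCat.of R (LinearMap.ker f))
      ((hTS.hasProjectiveDimensionLT_X₃_iff c
        ((ModuleCat.localizedModuleFunctor.{u} S).projective_obj_of_projective hp)).1 hK) (j + 1))

/-- If all `Ext^i(X, R)`, `i ≥ 1`, are `S`-torsion and localizations of finite modules have finite
projective dimension, then multiplication by some element of `S` on `X` factors through a finite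
free module. -/
lemma exists_factor_of_extTorsion [IsNoetherianRing R] (X : ModuleCat.{u} R) [Module.Finite R X]
    (h : ∀ j, ExtTorsion S X (ModuleCat.of R R) (j + 1))
    (hS : ∀ (K : ModuleCat.{u} R) [Module.Finite R K],
      ∃ c, HasProjectiveDimensionLE (K.localizedModule S) c) :
    ∃ s ∈ S, ∃ (r : ℕ) (f : X →ₗ[R] (Fin r → R)) (g : (Fin r → R) →ₗ[R] X),
      g ∘ₗ f = s • LinearMap.id := by
  obtain ⟨r, g, hg⟩ := Module.Finite.exists_fin' R X
  have hT := LinearMap.shortExact_shortComplexKer hg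
  obtain ⟨c, hc⟩ := hS (ModuleCat.of R (LinearMap.ker g))
  obtain ⟨s, hs, h⟩ := extTorsion_of_localizedModule h c _ hc 0
  -- The obstruction to lifting `s · id` along `g` lies in `Ext¹(X, ker g)`, and `s` annihilates it.
  obtain ⟨β, hβ⟩ := Ext.covariant_sequence_exact₃ X hT (s • Ext.mk₀ (𝟙 X)) rfl
    (by rw [Ext.smul_comp]; exact h _)
  obtain ⟨f, rfl⟩ := (Ext.mk₀_bijective _ _).2 β
  rw [Ext.mk₀_comp_mk₀, ← Ext.mk₀_smul] at hβ
  have hfg := (Ext.mk₀_bijective _ _).1 hβ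
  refine ⟨s, hs, r, f.hom, g, ?_⟩
  exact congrArg ModuleCat.Hom.hom hfg

end ExtTorsion

/-! ### Vanishing of extensions into a Gorenstein ring, locally at `m` -/

section Depth

open Abelian Module Pointwise

variable {R : Type u} [CommRing R]

lemma extTorsion_of_annihilator {S : Submonoid R} {X Y : ModuleCat.{u} R} {r : R} (hr : r ∈ S)
    (h : ∀ x : X, r • x = 0) (n : ℕ) : ExtTorsion S X Y n := by
  refine ⟨r, hr, fun α => ?_⟩
  have h0 : r • 𝟙 X = 0 := by
    ext x
    exact h x
  rw [smul_eq_mk₀_comp, h0, Ext.mk₀_zero, Ext.zero_comp]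

variable [IsNoetherianRing R] (m : Ideal R) [m.IsMaximal]

/-- The long exact sequence of multiplication by `x` gives `r · Ext ≤ x · Ext`. Since `r` is
invertible modulo `m`, this means `Ext = m · Ext`, and Nakayama's lemma yields an annihilator
congruent to `1` modulo `m`. -/
lemma ExtTorsion.of_quotSMulTop {m : Ideal R} [m.IsMaximal] {X Y : ModuleCat.{u} R}
    [Module.Finite R X] [Module.Finite R Y] {x : R} (hx : x ∈ m) (hreg : IsSMulRegular X x)
    {n : ℕ} (h : ExtTorsion m.primeCompl (ModuleCat.of R (QuotSMulTop x X)) Y (n + 1)) :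
    ExtTorsion m.primeCompl X Y n := by
  obtain ⟨r, hr, h⟩ := h
  obtain ⟨a, c, hc, ha⟩ := (inferInstance : m.IsMaximal).exists_inv hr
  have key : (⊤ : Submodule R (Ext X Y n)) ≤ m • ⊤ := fun α _ => by
    obtain ⟨β, hβ⟩ : ∃ β : Ext X Y n, (Ext.mk₀ (x • 𝟙 X)).comp β (zero_add n) = r • α :=
      Ext.contravariant_sequence_exact₁ hreg.smulShortComplex_shortExact Y
        (r • α) (add_comm 1 n) ((Ext.comp_smul _ _ _ _).trans (h _))
    have hβ' : x • β = r • α := (smul_eq_mk₀_comp β x).trans hβ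
    have hα : α = c • α + x • a • β := by
      rw [smul_comm x a, hβ', ← mul_smul, ← add_smul, add_comm, ha, one_smul]
    rw [hα]
    exact add_mem (Submodule.smul_mem_smul hc trivial) (Submodule.smul_mem_smul hx trivial)
  obtain ⟨t, ht, ht'⟩ := Submodule.exists_sub_one_mem_and_smul_eq_zero_of_fg_of_le_smul m _
    Module.Finite.fg_top key
  refine ⟨t, fun htm => ?_, fun α => ht' α trivial⟩
  refine (Ideal.ne_top_iff_one m).1 (inferInstance : m.IsMaximal).ne_top ?_
  simpa using sub_mem htm ht

/-- Cutting down `M` by a maximal regular sequence in `m`, one obtains a module of controlled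
projective dimension into which the residue field at `m` embeds. -/
lemma exists_injective_residue (n : ℕ) : ∀ (M : Type u) [AddCommGroup M] [Module R M]
    [Module.Finite R M] (c : ℕ), (⊤ : Submodule R M) ≠ m • ⊤ → supportDim R M ≤ n →
    HasProjectiveDimensionLE (ModuleCat.of R M) c →
    ∃ (L : Type u) (_ : AddCommGroup L) (_ : Module R L) (_ : Module.Finite R L)
      (f : R ⧸ m →ₗ[R] L), Function.Injective f ∧
        HasProjectiveDimensionLE (ModuleCat.of R L) (c + n) := by
  -- If `m` contains no regular element, prime avoidance makes `m` an associated prime of `M`, and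
  -- so `R/m` embeds.
  have main (M : Type u) [AddCommGroup M] [Module R M] [Module.Finite R M] :
      (∃ f : R ⧸ m →ₗ[R] M, Function.Injective f) ∨ ∃ x ∈ m, IsSMulRegular M x := by
    by_contra! h
    have hsub : (m : Set R) ⊆ ⋃ p ∈ associatedPrimes R M, ((id p : Ideal R) : Set R) := by
      simp only [id]
      rw [biUnion_associatedPrimes_eq_compl_regular]
      exact fun x hx => h.2 x hx
    obtain ⟨p, hp, hle⟩ := (m.subset_union_prime_finite (associatedPrimes.finite R M) 0 0
      fun _ h _ _ => h.isPrime).1 hsub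
    obtain rfl := (inferInstance : m.IsMaximal).eq_of_le hp.isPrime.ne_top hle
    obtain ⟨-, f, hf⟩ := (isAssociatedPrime_iff_exists_injective_linearMap ..).1 hp
    exact h.1 f hf
  have quot (M : Type u) [AddCommGroup M] [Module R M] (x : R) (hx : x ∈ m)
      (hM : (⊤ : Submodule R M) ≠ m • ⊤) : (⊤ : Submodule R (QuotSMulTop x M)) ≠ m • ⊤ := by
    intro h
    refine hM (le_antisymm (fun y _ => ?_) le_top)
    have h1 : (Submodule.mkQ (x • (⊤ : Submodule R M))) y ∈
        (m • (⊤ : Submodule R M)).map (Submodule.mkQ (x • (⊤ : Submodule R M))) := by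
      rw [Submodule.map_smul'', Submodule.map_top, Submodule.range_mkQ]
      exact h ▸ Submodule.mem_top
    obtain ⟨z, hz, hzy⟩ := h1
    have h2 := (Submodule.Quotient.eq _).1 hzy.symm
    have h3 : x • (⊤ : Submodule R M) ≤ m • ⊤ := fun w hw => by
      obtain ⟨v, -, rfl⟩ := (Submodule.mem_smul_pointwise_iff_exists ..).1 hw
      exact Submodule.smul_mem_smul hx trivial
    simpa using add_mem (h3 h2) hz
  have step (M : Type u) [AddCommGroup M] [Module R M] [Module.Finite R M] (c : ℕ) (x : R)
      (hreg : IsSMulRegular M x) (hc : HasProjectiveDimensionLE (ModuleCat.of R M) c) :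
      HasProjectiveDimensionLE (ModuleCat.of R (QuotSMulTop x M)) (c + 1) :=
    (IsSMulRegular.smulShortComplex_shortExact (M := ModuleCat.of R M) hreg
      ).hasProjectiveDimensionLT_X₃ (c + 1) hc
      (hasProjectiveDimensionLT_of_ge (ModuleCat.of R M) (c + 1) _ (by lia))
  induction n with
  | zero =>
    intro M _ _ _ c hM hdim hc
    obtain ⟨f, hf⟩ | ⟨x, hx, hreg⟩ := main M
    · exact ⟨M, _, _, inferInstance, f, hf, hc⟩
    -- In dimension `0` a regular element would force `M/xM = 0`, contrary to `M ≠ mM`.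
    · have h1 := (supportDim_quotSMulTop_succ_le_of_notMem_minimalPrimes
        (fun _ => hreg.notMem_of_mem_minimalPrimes)).trans hdim
      have h2 := quot M x hx hM
      rw [Nat.cast_zero, ENat.WithBot.add_one_le_zero_iff, supportDim_eq_bot_iff_subsingleton] at h1
      exact (h2 (Subsingleton.elim _ _)).elim
  | succ n ih =>
    intro M _ _ _ c hM hdim hc
    obtain ⟨f, hf⟩ | ⟨x, hx, hreg⟩ := main M
    · exact ⟨M, _, _, inferInstance, f, hf, have := hc
        hasProjectiveDimensionLT_of_ge _ (c + 1) _ (by lia)⟩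
    · have h1 := (supportDim_quotSMulTop_succ_le_of_notMem_minimalPrimes
        (fun _ => hreg.notMem_of_mem_minimalPrimes)).trans hdim
      push_cast at h1
      obtain ⟨L, _, _, h2, f, hf, hL⟩ := ih (QuotSMulTop x M) (c + 1) (quot M x hx hM)
        (ENat.WithBot.add_le_add_one_right_iff.1 h1) (step M c x hreg hc)
      exact ⟨L, _, _, h2, f, hf, by rwa [add_assoc, add_comm 1 n] at hL⟩

/-- Locally at `m`, the injective dimension of `R` is at most `dim R` if it is finite. -/
lemma extTorsion_of_ringKrullDim_lt {d : ℕ} (hd : ringKrullDim R = d) {b : ℕ}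
    (hb : HasInjectiveDimensionLE (ModuleCat.of R R) b) (j : ℕ) :
    ∀ i, d < i → b < i + j → ∀ (X : Type u) [AddCommGroup X] [Module R X] [Module.Finite R X],
      ExtTorsion m.primeCompl (ModuleCat.of R X) (ModuleCat.of R R) i := by
  obtain ⟨L, _, _, _, f, hf, hL⟩ := exists_injective_residue m d R 0
    (by
      rw [smul_eq_mul, Ideal.mul_top]
      exact (inferInstance : m.IsMaximal).ne_top.symm)
    (by rw [supportDim_self_eq_ringKrullDim, hd])
    (projective_iff_hasProjectiveDimensionLT_one.1
      ((IsProjective.iff_projective _).1 inferInstance))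
  rw [zero_add] at hL
  -- Descending induction on the degree `i`, starting above the injective dimension bound `b`. In
  -- each degree `X` is filtered by modules `R/p`.
  induction j with
  | zero =>
    intro i _ hi X _ _ _
    exact extTorsion_of_subsingleton
      (HasInjectiveDimensionLT.subsingleton (ModuleCat.of R R) (b + 1) i (by lia) _)
  | succ j ih =>
    intro i hi hij X _ _ hX
    have ih' := ih (i + 1) (by lia) (by lia)
    induction hX using IsNoetherianRing.induction_on_isQuotientEquivQuotientPrime R with
    | subsingleton X =>
      exact extTorsion_of_annihilator (one_mem _) (fun x => Subsingleton.elim (α := X) _ _) i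
    | quotient X p e =>
      by_cases hpm : p.1 ≤ m
      · rcases hpm.eq_or_lt with h | h
        -- For `p = m`: `R/m` embeds in `L`, whose projective dimension is less than `i`. The
        -- cokernel only matters in degree `i + 1`.
        · have hinj : Function.Injective
              (f ∘ₗ (Submodule.quotEquivOfEq _ _ h).toLinearMap ∘ₗ e.toLinearMap) :=
            hf.comp ((Submodule.quotEquivOfEq _ _ h).injective.comp e.injective)
          refine ExtTorsion.contravariant_X₁ (shortExact_of_linearMap _ _ hinj
            (Submodule.mkQ_surjective _) (LinearMap.exact_map_mkQ_range _))
            (extTorsion_of_subsingleton ?_) (ih' _)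
          exact HasProjectiveDimensionLT.subsingleton (ModuleCat.of R L) (d + 1) i hi _
        -- For `p < m`: an element of `m` outside `p` is regular on the domain `R/p`, and the
        -- quotient by it only matters in degree `i + 1`.
        · obtain ⟨x, hxm, hxp⟩ := Set.exists_of_ssubset h
          refine ExtTorsion.of_quotSMulTop (X := ModuleCat.of R X) hxm (fun v w hvw => ?_) (ih' _)
          have hp := p.2
          apply e.injective
          have h1 : x • e v = x • e w := by rw [← map_smul, ← map_smul]; exact congrArg e hvw
          rw [Algebra.smul_def, Algebra.smul_def] at h1
          exact mul_left_cancel₀ (fun h0 => hxp (Ideal.Quotient.eq_zero_iff_mem.1 h0)) h1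
      · obtain ⟨r, hrp, hrm⟩ := Set.not_subset.1 hpm
        refine extTorsion_of_annihilator (r := r) hrm (fun x => ?_) i
        apply e.injective
        rw [map_zero]
        refine (map_smul e r x).trans ?_
        rw [Algebra.smul_def, Ideal.Quotient.algebraMap_eq, Ideal.Quotient.eq_zero_iff_mem.2 hrp,
          zero_mul]
    | exact X₁ X₂ X₃ f g hf hg hfg h₁ h₃ =>
      exact ExtTorsion.contravariant_X₂ (shortExact_of_linearMap f g hf hg hfg) h₁ h₃

/-- Dividing by each element of the regular sequence trades one unit of depth for one degree of
`Ext`, until the degree exceeds `d`. -/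
lemma extTorsion_of_isWeaklyRegular {d : ℕ} {m : Ideal R} [m.IsMaximal]
    (hd : ∀ i, d < i → ∀ (X : Type u) [AddCommGroup X] [Module R X] [Module.Finite R X],
      ExtTorsion m.primeCompl (ModuleCat.of R X) (ModuleCat.of R R) i) (rs : List R) :
    (∀ r ∈ rs, r ∈ m) → ∀ (X : Type u) [AddCommGroup X] [Module R X] [Module.Finite R X],
      RingTheory.Sequence.IsWeaklyRegular X rs → ∀ i, d < i + rs.length →
      ExtTorsion m.primeCompl (ModuleCat.of R X) (ModuleCat.of R R) i := by
  induction rs with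
  | nil => exact fun _ X _ _ _ _ i hi => hd i hi X
  | cons x rs ih =>
    intro hm X _ _ _ hX i hi
    rw [RingTheory.Sequence.isWeaklyRegular_cons_iff] at hX
    rw [List.length_cons] at hi
    exact ExtTorsion.of_quotSMulTop (X := ModuleCat.of R X) (hm x (by simp)) hX.1
      (ih (fun r hr => hm r (by simp [hr])) _ hX.2 (i + 1) (by lia))

/-- A maximal Cohen-Macaulay module over a Gorenstein ring has no higher extensions by the ring
locally at `m`. -/
lemma extTorsion_of_isMaximalCohenMacaulay {m : Ideal R} [m.IsMaximal]
    (hGor : IsGorenstein R) (X : Type u) [AddCommGroup X] [Module R X] [Module.Finite R X]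
    (hX : IsMaximalCohenMacaulay m X) (j : ℕ) :
    ExtTorsion m.primeCompl (ModuleCat.of R X) (ModuleCat.of R R) (j + 1) := by
  obtain ⟨rs, hrs, hreg, hlen⟩ := hX
  obtain ⟨-, b, hb⟩ := hGor
  refine extTorsion_of_isWeaklyRegular (d := rs.length) (fun i hi => ?_) rs hrs X hreg.1 (j + 1)
    (by lia)
  exact extTorsion_of_ringKrullDim_lt m hlen.symm hb (b + 1) i hi (by lia)

end Depth

/-! ### Local freeness on the punctured spectrum -/

section IsolatedSingularity

variable {R : Type u} [CommRing R]

lemma exists_hasProjectiveDimensionLE_localizedModule (p : Ideal R) [p.IsPrime]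
    (hp : IsRegularLocalRing (Localization.AtPrime p)) (K : ModuleCat.{u} R) [Module.Finite R K] :
    ∃ c, HasProjectiveDimensionLE (K.localizedModule p.primeCompl) c := by
  obtain ⟨c, hc⟩ := exists_ringKrullDim_eq (Localization.AtPrime p)
  have : Module.Finite (Localization.AtPrime p) (K.localizedModule p.primeCompl) :=
    Module.Finite.of_isLocalizedModule p.primeCompl (K.localizedModuleMkLinearMap p.primeCompl)
  exact ⟨c, hasProjectiveDimensionLE_of_isRegularLocalRing c (Localization.AtPrime p) hc
    (K.localizedModule p.primeCompl)⟩

/-- On the punctured spectrum of a Gorenstein isolated singularity maximal Cohen-Macaulay modules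
are locally free. -/
lemma exists_factor_of_isMaximalCohenMacaulay [IsNoetherianRing R] {m : Ideal R} [m.IsMaximal]
    (hGor : IsGorenstein R) (hsing : IsIsolatedSingularity m) (X : Type u)
    [AddCommGroup X] [Module R X]
    [Module.Finite R X] (hX : IsMaximalCohenMacaulay m X) (p : Ideal R) [hp : p.IsPrime]
    (hpm : p < m) :
    ∃ s ∉ p, ∃ (r : ℕ) (f : X →ₗ[R] (Fin r → R)) (g : (Fin r → R) →ₗ[R] X),
      g ∘ₗ f = s • LinearMap.id :=
  exists_factor_of_extTorsion (S := p.primeCompl) (ModuleCat.of R X)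
    (fun j => extTorsion_of_le (S := m.primeCompl) (fun _ hs h => hs (hpm.le h))
      (extTorsion_of_isMaximalCohenMacaulay hGor X hX j))
    fun K _ => exists_hasProjectiveDimensionLE_localizedModule p (hsing p hpm.ne) K

end IsolatedSingularity

/-! ### Finite-dimensional quotients by powers of `m` -/

section FiniteDimensional

variable {k R : Type u} [Field k] [CommRing R] [Algebra k R] [IsNoetherianRing R]

/-- Each layer `mˢX/mˢ⁺¹X` is spanned over `k` by finitely many generators of `mˢX`, as `k` surjects
onto `R/m`. -/
lemma exists_finite_sub_mem_pow_smul {m : Ideal R} (hk : Function.Surjective (algebraMap k (R ⧸ m)))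
    (X : Type u) [AddCommGroup X] [Module k X] [Module R X] [IsScalarTower k R X]
    [Module.Finite R X] (s : ℕ) :
    ∃ F : Submodule k X, Module.Finite k F ∧
      ∀ x, ∃ f ∈ F, x - f ∈ m ^ s • (⊤ : Submodule R X) := by
  classical
  induction s with
  | zero => exact ⟨⊥, inferInstance, fun x => ⟨0, zero_mem _, by simp⟩⟩
  | succ s ih =>
    obtain ⟨F, hF, h⟩ := ih
    obtain ⟨G, hG⟩ := IsNoetherian.noetherian (m ^ s • (⊤ : Submodule R X))
    refine ⟨F ⊔ Submodule.span k G, inferInstance, fun x => ?_⟩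
    obtain ⟨f, hf, hxf⟩ := h x
    rw [← hG] at hxf
    obtain ⟨c, -, hc⟩ := Submodule.mem_span_finset.1 hxf
    choose a ha using fun r : R => hk (Ideal.Quotient.mk m r)
    have ha' (r : R) : r - algebraMap k R (a r) ∈ m := by
      rw [← Ideal.Quotient.eq_zero_iff_mem, map_sub, sub_eq_zero]
      exact (ha r).symm
    refine ⟨f + ∑ g ∈ G, a (c g) • g, add_mem (Submodule.mem_sup_left hf)
      (Submodule.mem_sup_right (sum_mem fun g hg =>
        Submodule.smul_mem _ _ (Submodule.subset_span hg))), ?_⟩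
    rw [← sub_sub, ← hc, ← Finset.sum_sub_distrib, pow_succ', mul_smul, ← hG]
    refine sum_mem fun g hg => ?_
    rw [← algebraMap_smul R (a (c g)) g, ← sub_smul]
    exact Submodule.smul_mem_smul (ha' _) (Submodule.subset_span hg)

lemma exists_pow_le_of_forall_isPrime {m J : Ideal R}
    (h : ∀ p : Ideal R, p.IsPrime → J ≤ p → m ≤ p) : ∃ s, m ^ s ≤ J := by
  refine Ideal.exists_pow_le_of_le_radical_of_fg ?_ (IsNoetherian.noetherian m)
  rw [Ideal.radical_eq_sInf]
  exact le_sInf fun p hp => h p hp.2 hp.1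

end FiniteDimensional

/-! ### Finite-dimensionality of `Λ/Λe₀Λ` -/

section EndAlg

variable {k R : Type u} [Field k] [CommRing R] [Algebra k R] {l : ℕ} {N : Fin l → Type u}
  [∀ i, AddCommGroup (N i)] [∀ i, Module k (N i)] [∀ i, Module R (N i)]
  [∀ i, IsScalarTower k R (N i)]

/-- The projection of `R ⊕ ⨁ N i` onto the summand `N i`. -/
def summandProj (R : Type u) [CommRing R] [∀ i, Module R (N i)] (i : Fin l) : EndAlg N R :=
  LinearMap.inr R R (∀ i, N i) ∘ₗ LinearMap.single R N i ∘ₗ LinearMap.proj i ∘ₗ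
    LinearMap.snd R R (∀ i, N i)

lemma e₀_add_sum_summandProj : e₀ N R + ∑ i, summandProj R i = 1 := by
  refine LinearMap.ext fun x => ?_
  refine Prod.ext ?_ (funext fun i => ?_)
  · simp [e₀, summandProj, LinearMap.sum_apply, Prod.fst_sum]
  · simp [e₀, summandProj, LinearMap.sum_apply, Prod.snd_sum, Finset.sum_apply,
      Finset.sum_pi_single]

/-- Splitting the free module into copies of `R` writes `s · id` on `N i` as a sum of maps through
`R`, and each of these passes through `e₀`. -/
lemma smul_summandProj_mem {s : R} {i : Fin l} {r : ℕ} (f : N i →ₗ[R] (Fin r → R))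
    (g : (Fin r → R) →ₗ[R] N i) (hfg : g ∘ₗ f = s • LinearMap.id) :
    s • summandProj R i ∈ twoSided (e₀ N R) := by
  have key : s • summandProj R i = ∑ t : Fin r,
      (LinearMap.inr R R (∀ i, N i) ∘ₗ LinearMap.single R N i ∘ₗ
        LinearMap.toSpanSingleton R (N i) (g (Pi.single t 1)) ∘ₗ
          LinearMap.fst R R (∀ i, N i) : EndAlg N R) * e₀ N R *
        (LinearMap.inl R R (∀ i, N i) ∘ₗ LinearMap.proj t ∘ₗ f ∘ₗ LinearMap.proj i ∘ₗ
          LinearMap.snd R R (∀ i, N i) : EndAlg N R) := by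
    refine LinearMap.ext fun x => ?_
    have h1 : s • x.2 i = ∑ t, f (x.2 i) t • g (Pi.single t 1) := by
      have h2 : g (f (x.2 i)) = s • x.2 i := LinearMap.congr_fun hfg (x.2 i)
      rw [← h2]
      conv_lhs => rw [pi_eq_sum_univ' (f (x.2 i))]
      rw [map_sum]
      refine Finset.sum_congr rfl fun t _ => ?_
      rw [map_smul]
    rw [LinearMap.sum_apply]
    refine ((map_smul (LinearMap.inr R R (∀ i, N i) ∘ₗ LinearMap.single R N i) s
      (x.2 i)).symm.trans (congrArg _ h1)).trans ?_
    rw [map_sum]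
    rfl
  rw [key]
  exact sum_mem fun t _ => mul_mem_twoSided _ _

variable (N) in
/-- The ideal of all `r : R` with `r · 1 ∈ Λe₀Λ`. -/
def scalarIdeal (R : Type u) [CommRing R] [∀ i, Module R (N i)] : Ideal R :=
  (twoSided (e₀ N R)).comap (algebraMap R (EndAlg N R))

/-- The identity is the sum of the projections onto the summands. A product of elements outside `p`,
one for each `N i`, moves all of them into `Λe₀Λ` and stays outside the prime `p`. -/
lemma exists_mem_scalarIdeal [IsNoetherianRing R] [∀ i, Module.Finite R (N i)]
    {m : Ideal R} [m.IsMaximal] (hGor : IsGorenstein R) (hsing : IsIsolatedSingularity m)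
    (hN : ∀ i, IsMaximalCohenMacaulay m (N i)) (p : Ideal R) [hp : p.IsPrime] (hpm : p < m) :
    ∃ s ∉ p, s ∈ scalarIdeal N R := by
  choose s hs r f g hfg using fun i =>
    exists_factor_of_isMaximalCohenMacaulay hGor hsing (N i) (hN i) p hpm
  have smul_mem (a : R) {x : EndAlg N R} (hx : x ∈ twoSided (e₀ N R)) :
      a • x ∈ twoSided (e₀ N R) := by
    rw [Algebra.smul_def]
    exact Ideal.mul_mem_left _ _ hx
  refine ⟨∏ i, s i, fun h => ?_, ?_⟩
  · obtain ⟨i, -, hi⟩ := hp.prod_mem_iff.1 h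
    exact hs i hi
  · change algebraMap R (EndAlg N R) _ ∈ twoSided (e₀ N R)
    rw [Algebra.algebraMap_eq_smul_one, ← e₀_add_sum_summandProj, smul_add, Finset.smul_sum]
    refine add_mem (smul_mem _ mem_twoSided_self) (sum_mem fun i _ => ?_)
    rw [← Finset.prod_erase_mul Finset.univ s (Finset.mem_univ i), mul_smul]
    exact smul_mem _ (smul_summandProj_mem (f i) (g i) (hfg i))

/-- If every prime over the scalar ideal contains `m`, this ideal contains some `mˢ`. Then `mˢΛ ≤
Λe₀Λ`, and `Λ/mˢΛ` is finite dimensional. -/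
lemma exists_finite_sub_mem_twoSided [IsNoetherianRing R] [∀ i, Module.Finite R (N i)]
    {m : Ideal R} (hk : Function.Surjective (algebraMap k (R ⧸ m)))
    (h : ∀ p : Ideal R, p.IsPrime → scalarIdeal N R ≤ p → m ≤ p) :
    ∃ F : Submodule k (EndAlg N R), Module.Finite k F ∧
      ∀ a, ∃ f ∈ F, a - f ∈ twoSided (e₀ N R) := by
  obtain ⟨s, hs⟩ := exists_pow_le_of_forall_isPrime h
  obtain ⟨F, hF, hF'⟩ := exists_finite_sub_mem_pow_smul hk (EndAlg N R) s
  refine ⟨F, hF, fun a => ?_⟩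
  obtain ⟨f, hf, haf⟩ := hF' a
  refine ⟨f, hf, ?_⟩
  generalize a - f = x at haf
  induction haf using Submodule.smul_induction_on' with
  | smul r hr x hx =>
    rw [Algebra.smul_def]
    exact Ideal.mul_mem_right _ _ (hs hr)
  | add x hx y hy h₁ h₂ => exact add_mem h₁ h₂

lemma twoSided_isHomogeneous {Λ : Type u} [Ring Λ] [Algebra k Λ] (𝒜 : ℤ → Submodule k Λ)
    [GradedAlgebra 𝒜] {e : Λ} (he : e ∈ 𝒜 0) : (twoSided e).IsHomogeneous 𝒜 := by
  -- As a left ideal, `ΛeΛ` is generated by the products `e * c` with `c` homogeneous, and these are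
  -- homogeneous because `e` has degree `0`.
  have key : twoSided e = Ideal.span {x | ∃ (i : ℤ) (c : 𝒜 i), x = e * c} := by
    refine le_antisymm (fun x hx => ?_) (Ideal.span_le.2 ?_)
    · refine twoSided_induction (p := fun x => x ∈ Ideal.span _) (zero_mem _)
        (fun x y => add_mem) (fun b c => ?_) hx
      induction c using DirectSum.Decomposition.inductionOn 𝒜 with
      | zero => rw [mul_zero]; exact zero_mem _
      | @homogeneous i c =>
        rw [mul_assoc]
        exact Ideal.mul_mem_left _ _ (Ideal.subset_span ⟨i, c, rfl⟩)
      | add x y hx hy => rw [mul_add]; exact add_mem hx hy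
    · rintro _ ⟨i, c, rfl⟩
      exact Ideal.mul_mem_right _ _ mem_twoSided_self
  rw [key]
  refine Ideal.homogeneous_span 𝒜 _ ?_
  rintro _ ⟨i, c, rfl⟩
  exact ⟨0 + i, SetLike.GradedMul.mul_mem he c.2⟩

/-- Scalars of degree `i` act as endomorphisms of degree `i`, so `R → Λ` commutes with taking
components, and the preimage of a homogeneous ideal is homogeneous. -/
lemma scalarIdeal_isHomogeneous (𝓡 : ℤ → Submodule k R) [GradedAlgebra 𝓡]
    (𝒩 : ∀ i, ℤ → Submodule k (N i)) [∀ i, DirectSum.Decomposition (𝒩 i)]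
    [∀ i, SetLike.GradedSMul 𝓡 (𝒩 i)] [∀ i, Module.Finite R (N i)] :
    (scalarIdeal N R).IsHomogeneous 𝓡 := by
  have hmem {i : ℤ} {r : R} (hr : r ∈ 𝓡 i) :
      algebraMap R (EndAlg N R) r ∈ endAlgGrading 𝓡 𝒩 i := fun j x hx =>
    SetLike.GradedSMul.smul_mem hr hx
  have hcomp (r : R) (n : ℤ) :
      (DirectSum.decompose (endAlgGrading 𝓡 𝒩) (algebraMap R (EndAlg N R) r) n : EndAlg N R) =
        algebraMap R (EndAlg N R) (DirectSum.decompose 𝓡 r n : R) := by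
    induction r using DirectSum.Decomposition.inductionOn 𝓡 with
    | zero => simp
    | @homogeneous i r =>
      by_cases hin : i = n
      · subst hin
        rw [DirectSum.decompose_of_mem_same _ (hmem r.2), DirectSum.decompose_of_mem_same _ r.2]
      · rw [DirectSum.decompose_of_mem_ne _ (hmem r.2) hin,
          DirectSum.decompose_of_mem_ne _ r.2 hin, map_zero]
    | add x y hx hy => simp [DirectSum.decompose_add, hx, hy]
  intro n r hr
  have := twoSided_isHomogeneous (endAlgGrading 𝓡 𝒩) (e₀_mem 𝓡 𝒩) n hr
  rw [hcomp] at this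
  exact this

end EndAlg

end NCResolution

end

/-! ### The main theorem -/

open NCResolution in
theorem proposition5p1p4 {k R : Type u} [Field k] [CommRing R] [Algebra k R]
    [IsNoetherianRing R] (m : Ideal R) [m.IsMaximal]
    (hk : Function.Bijective (algebraMap k (R ⧸ m)))
    (hGor : IsGorenstein R) (hsing : IsIsolatedSingularity m)
    {l : ℕ} (N : Fin l → Type u) [∀ i, AddCommGroup (N i)] [∀ i, Module k (N i)]
    [∀ i, Module R (N i)] [∀ i, IsScalarTower k R (N i)] [∀ i, Module.Finite R (N i)]
    (hN : ∀ i, IsMaximalCohenMacaulay m (N i))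
    (hΛ : HasFiniteGlobalDimension (EndAlg N R)) :
    -- the complete case
    (IsCompleteSetting N m →
      HomFinite k (DbfQuotient (e₀ N R)) ∧
      ∃ φ : (EndAlg N R ⧸ twoSided (e₀ N R)) ≃ₐ[k]
          (End ((toDbfQuotient (e₀ N R)).obj (regularObj (EndAlg N R))))ᵐᵒᵖ,
        ∀ a : EndAlg N R, φ (Ideal.Quotient.mk _ a) =
          .op ((toDbfQuotient (e₀ N R)).map (rightMul a))) ∧
    -- the graded case
    (∀ (𝓡 : ℤ → Submodule k R) [GradedAlgebra 𝓡] (𝒩 : ∀ i, ℤ → Submodule k (N i))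
        [∀ i, DirectSum.Decomposition (𝒩 i)] [∀ i, SetLike.GradedSMul 𝓡 (𝒩 i)],
      IsGradedSetting 𝓡 𝒩 m →
      -- for ungraded modules
      (HomFinite k (DbfQuotient (e₀ N R)) ∧
        ∃ φ : (EndAlg N R ⧸ twoSided (e₀ N R)) ≃ₐ[k]
            (End ((toDbfQuotient (e₀ N R)).obj (regularObj (EndAlg N R))))ᵐᵒᵖ,
          ∀ a : EndAlg N R, φ (Ideal.Quotient.mk _ a) =
            .op ((toDbfQuotient (e₀ N R)).map (rightMul a))) ∧
      -- for graded modules: `Hom(Λ, Λ(n))` is the part of degree `n` of `Λ/Λe₀Λ`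
      HomFinite k (DbfGrQuotient 𝓡 𝒩) ∧
      ∀ n : ℤ,
        Function.Surjective (fun a : endAlgGrading 𝓡 𝒩 n =>
          (toDbfGrQuotient 𝓡 𝒩).map (rightMulGr a)) ∧
        ∀ a : endAlgGrading 𝓡 𝒩 n, (toDbfGrQuotient 𝓡 𝒩).map (rightMulGr a) = 0 ↔
          (a : EndAlg N R) ∈ twoSided (e₀ N R)) := by
  refine ⟨fun h => ?_, fun 𝓡 _ 𝒩 _ _ h => ?_⟩
  · have := h.isLocalRing
    refine exists_algEquiv_end (e₀_mul_e₀ N R)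
      (exists_finite_sub_mem_twoSided hk.2 fun p hp hle => ?_) hΛ
    by_contra hmp
    have hlt : p < m := lt_of_le_of_ne
      ((IsLocalRing.le_maximalIdeal hp.ne_top).trans_eq
        (IsLocalRing.eq_maximalIdeal inferInstance).symm) fun h => hmp h.ge
    obtain ⟨s, hs, hs'⟩ := exists_mem_scalarIdeal hGor hsing hN p hlt
    exact hs (hle hs')
  · have hfin := exists_finite_sub_mem_twoSided (N := N) hk.2 fun p hp hle => by
      -- In the graded case `p` need not lie in `m`, but its homogeneous core is a prime that does,
      -- and it still contains the homogeneous ideal `scalarIdeal N R`. Hence the core equals `m`,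
      -- and `m ≤ p`.
      have hq : (p.homogeneousCore 𝓡).toIdeal.IsPrime := hp.homogeneousCore
      have hJq : scalarIdeal N R ≤ (p.homogeneousCore 𝓡).toIdeal := by
        rw [← (scalarIdeal_isHomogeneous 𝓡 𝒩).toIdeal_homogeneousCore_eq_self]
        exact Ideal.homogeneousCore_mono 𝓡 hle
      have hqm := h.le_of_isHomogeneous _ (p.homogeneousCore 𝓡).isHomogeneous hq.ne_top
      by_contra hmp
      have hlt := lt_of_le_of_ne hqm
        fun h => hmp (h.ge.trans (Ideal.toIdeal_homogeneousCore_le 𝓡 p))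
      obtain ⟨s, hs, hs'⟩ := exists_mem_scalarIdeal hGor hsing hN _ hlt
      exact hs (hJq hs')
    exact ⟨exists_algEquiv_end (e₀_mul_e₀ N R) hfin hΛ,
      graded_quotient (e₀_mem 𝓡 𝒩) (e₀_mul_e₀ N R) hfin hΛ⟩
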